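/- Let $d\ge 0$ and $0\le m\le d$ be integers, and let $E=\mathcal O\oplus\mathcal O(m)$ on the complex projective plane $\mathbb P^2$. A Higgs field on $E$ is an element $\Phi\in H^0(\mathbb P^2,\mathrm{End}\,E(d))$, where $\mathrm{End}\,E(d)=\mathrm{End}\,E\otimes\mathcal O(d)$; the pair $(E,\Phi)$ is called stable if every sub-line bundle $L\subset E$ with $\Phi(L)\subseteq L\otimes\mathcal O(d)$ satisfies $\deg L<\tfrac12\deg E=\tfrac m2$. The group $\mathrm{Aut}(E)$ acts on Higgs fields by conjugation. (1) Suppose $d\ge 1$. The set of stable Higgs fields, with the topology induced by the Zariski topology of the vector space $H^0(\mathbb P^2,\mathrm{End}\,E(d))$, modulo conjugation by $\mathrm{Aut}(E)$, with the quotient topology, has (Krull) dimension $$2d^2+6d+1\quad\text{if } m=0,\qquad 2d^2+6d+\tfrac12m(m-3)+2\quad\text{if } m>0.$$ (2) Let $\mathcal M^{\mathrm{VW}}_{m,0,d}$ be the moduli space of stable pairs $(E',\Phi')$ on $\mathbb P^2$ with $E'$ of rank two, $c_1(E')=m$, $c_2(E')=0$ and $\Phi'\in H^0(\mathbb P^2,\mathrm{End}\,E'(d))$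 trace-free. For every trace-free Higgs field $\Phi$ on $E$ such that $(E,\Phi)$ is stable, the Zariski tangent space of $\mathcal M^{\mathrm{VW}}_{m,0,d}$ at $(E,\Phi)$, i.e. the vector space of isomorphism classes of first-order deformations of the pair $(E,\Phi)$ over $\mathbb C[\varepsilon]/(\varepsilon^2)$ with trace-free Higgs field, is finite-dimensional, of dimension $$\tfrac32d(d+3)\quad\text{if } m=0,\qquad \tfrac32d(d+3)+\tfrac12m(m-3)+1\quad\text{if } m>0.$$ -/

import Mathlib

open scoped LinearAlgebra.Projectivization

noncomputable section

namespace VafaWitten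

/-! ### The line bundles `𝒪(k)` on the complex projective plane -/

/-- The homogeneous coordinate ring `ℂ[x₀, x₁, x₂]` of the projective plane. -/
abbrev CoordRing : Type := MvPolynomial (Fin 3) ℂ

/-- The field `ℂ(x₀, x₁, x₂)`.  Rational sections of every line bundle `𝒪(k)` on the plane are
elements of this field (quotients of homogeneous polynomials whose degrees differ by `k`). -/
abbrev RatField : Type := FractionRing CoordRing

/-- The set of points of the complex projective plane. -/
abbrev Plane : Type := ℙ ℂ (Fin 3 → ℂ)

/-- `f` is a regular section of `𝒪(k)` near the point `p`: it can be written as `P / Q` with `P`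
and `Q` homogeneous, `deg P - deg Q = k` and `Q(p) ≠ 0`. -/
def IsRegularAt (k : ℤ) (p : Plane) (f : RatField) : Prop :=
  ∃ (P Q : CoordRing) (i j : ℕ), P.IsHomogeneous i ∧ Q.IsHomogeneous j ∧ (i : ℤ) = j + k ∧
    MvPolynomial.eval p.rep Q ≠ 0 ∧
    f * algebraMap CoordRing RatField Q = algebraMap CoordRing RatField P

lemma isRegularAt_zero (k : ℤ) (p : Plane) : IsRegularAt k p 0 := by
  obtain ⟨l, hl⟩ : ∃ l, p.rep l ≠ 0 := by
    by_contra! h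
    exact p.rep_nonzero (funext h)
  refine ⟨0, MvPolynomial.X l ^ k.natAbs, ((k.natAbs : ℤ) + k).toNat, k.natAbs,
    MvPolynomial.isHomogeneous_zero _ _ _, ?_, ?_, ?_, ?_⟩
  · simpa using (MvPolynomial.isHomogeneous_X ℂ l).pow k.natAbs
  · omega
  · rw [map_pow, MvPolynomial.eval_X]
    exact pow_ne_zero _ hl
  · simp

lemma IsRegularAt.add {k : ℤ} {p : Plane} {f g : RatField} (hf : IsRegularAt k p f)
    (hg : IsRegularAt k p g) : IsRegularAt k p (f + g) := by
  obtain ⟨P, Q, i, j, hP, hQ, hd, hn, he⟩ := hf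
  obtain ⟨P', Q', i', j', hP', hQ', hd', hn', he'⟩ := hg
  refine ⟨P * Q' + P' * Q, Q * Q', i + j', j + j', (hP.mul hQ').add ?_, hQ.mul hQ', ?_, ?_, ?_⟩
  · have : i + j' = i' + j := by omega
    rw [this]
    exact hP'.mul hQ
  · push_cast
    omega
  · rw [map_mul]
    exact mul_ne_zero hn hn'
  · rw [map_mul, map_add, map_mul, map_mul, ← he, ← he']
    ring

lemma IsRegularAt.mul {k l : ℤ} {p : Plane} {f g : RatField} (hf : IsRegularAt k p f)
    (hg : IsRegularAt l p g) : IsRegularAt (k + l) p (f * g) := by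
  obtain ⟨P, Q, i, j, hP, hQ, hd, hn, he⟩ := hf
  obtain ⟨P', Q', i', j', hP', hQ', hd', hn', he'⟩ := hg
  refine ⟨P * P', Q * Q', i + i', j + j', hP.mul hP', hQ.mul hQ', ?_, ?_, ?_⟩
  · push_cast
    omega
  · rw [map_mul]
    exact mul_ne_zero hn hn'
  · rw [map_mul, map_mul, ← he, ← he']
    ring

lemma IsRegularAt.smul {k : ℤ} {p : Plane} {f : RatField} (c : ℂ) (hf : IsRegularAt k p f) :
    IsRegularAt k p (c • f) := by
  obtain ⟨P, Q, i, j, hP, hQ, hd, hn, he⟩ := hf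
  refine ⟨MvPolynomial.C c * P, Q, i, j, ?_, hQ, hd, hn, ?_⟩
  · simpa using (MvPolynomial.isHomogeneous_C (Fin 3) c).mul hP
  · rw [smul_mul_assoc, he, map_mul, Algebra.smul_def,
      IsScalarTower.algebraMap_apply ℂ CoordRing RatField]
    rfl

/-- `Γ(U, 𝒪(k))` for a non-empty Zariski open set `U` of the plane, as a space of rational
sections: those which are regular at every point of `U`. -/
def sections (U : Set Plane) (k : ℤ) : Submodule ℂ RatField where
  carrier := {f | ∀ p ∈ U, IsRegularAt k p f}
  zero_mem' := fun p _ => isRegularAt_zero k p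
  add_mem' := fun hf hg p hp => (hf p hp).add (hg p hp)
  smul_mem' := fun c _ hf p hp => (hf p hp).smul c

/-! ### The split bundle `E = 𝒪(a 0) ⊕ 𝒪(a 1)` and its twisted endomorphisms -/

/-- Two by two matrices of rational functions. -/
abbrev Mat : Type := Matrix (Fin 2) (Fin 2) RatField

/-- `Γ(U, End E (k))` for `E = 𝒪(a 0) ⊕ 𝒪(a 1)`: the entry `(i, j)` is a morphism
`𝒪(a j) → 𝒪(a i + k)`, that is, a section of `𝒪(a i - a j + k)`. -/
def endSections (a : Fin 2 → ℤ) (U : Set Plane) (k : ℤ) : Submodule ℂ Mat where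
  carrier := {M | ∀ i j, M i j ∈ sections U (a i - a j + k)}
  zero_mem' := fun _ _ => Submodule.zero_mem _
  add_mem' := fun hM hN i j => Submodule.add_mem _ (hM i j) (hN i j)
  smul_mem' := fun c _ hM i j => Submodule.smul_mem _ c (hM i j)

/-- `Γ(U, End₀ E (k))`: the trace-free elements of `Γ(U, End E (k))`. -/
def endSections₀ (a : Fin 2 → ℤ) (U : Set Plane) (k : ℤ) : Submodule ℂ Mat :=
  endSections a U k ⊓ LinearMap.ker (Matrix.traceLinearMap (Fin 2) ℂ RatField)

/-- The space `H⁰(ℙ², End E (d))` of Higgs fields on `E`. -/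
abbrev higgsFields (a : Fin 2 → ℤ) (d : ℤ) : Submodule ℂ Mat :=
  endSections a Set.univ d

/-- Stability of the pair `(E, Φ)`, `Φ ∈ H⁰(ℙ², End E (d))`.  A sub-line bundle `𝒪(k) ⊂ E` is a
non-zero morphism `s : 𝒪(k) → E`, i.e. a pair of sections of `𝒪(a i - k)`, not both zero.  It is
`Φ`-invariant, `Φ(𝒪(k)) ⊆ 𝒪(k + d)`, when `Φ ∘ s = s ∘ lam` for some
`lam ∈ Hom(𝒪(k), 𝒪(k + d)) = H⁰(ℙ², 𝒪(d))`.  The pair is stable when every such sub-line bundle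
satisfies `k < deg E / 2`. -/
def IsStable (a : Fin 2 → ℤ) (d : ℤ) (Φ : Mat) : Prop :=
  ∀ (k : ℤ) (s : Fin 2 → RatField) (lam : RatField), s ≠ 0 →
    (∀ i, s i ∈ sections Set.univ (a i - k)) → lam ∈ sections Set.univ d →
    Φ.mulVec s = lam • s → 2 * k < a 0 + a 1

lemma endSections_mul {a : Fin 2 → ℤ} {U : Set Plane} {M N : Mat}
    (hM : M ∈ endSections a U 0) (hN : N ∈ endSections a U 0) : M * N ∈ endSections a U 0 := by
  intro i j
  rw [Matrix.mul_apply]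
  refine Submodule.sum_mem _ fun l _ p hp => ?_
  have h := (hM i l p hp).mul (hN l j p hp)
  have e : a i - a l + 0 + (a l - a j + 0) = a i - a j + 0 := by ring
  rwa [e] at h

lemma isRegularAt_one (p : Plane) : IsRegularAt 0 p 1 :=
  ⟨1, 1, 0, 0, MvPolynomial.isHomogeneous_one _ _, MvPolynomial.isHomogeneous_one _ _,
    by simp, by simp, by simp⟩

lemma endSections_one (a : Fin 2 → ℤ) (U : Set Plane) : (1 : Mat) ∈ endSections a U 0 := by
  intro i j p _
  by_cases h : i = j
  · subst h
    simpa using isRegularAt_one p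
  · rw [Matrix.one_apply_ne h]
    exact isRegularAt_zero _ p

/-- The automorphism group of `E`: the invertible elements of the ring `H⁰(ℙ², End E)`. -/
def autGroup (a : Fin 2 → ℤ) : Subgroup Matˣ where
  carrier := {g | (g : Mat) ∈ endSections a Set.univ 0 ∧
    ((g⁻¹ : Matˣ) : Mat) ∈ endSections a Set.univ 0}
  one_mem' := by
    simpa using endSections_one a Set.univ
  mul_mem' := by
    rintro g h ⟨hg, hg'⟩ ⟨hh, hh'⟩
    refine ⟨endSections_mul hg hh, ?_⟩
    rw [mul_inv_rev]
    exact endSections_mul hh' hg'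
  inv_mem' := by
    rintro g ⟨hg, hg'⟩
    exact ⟨hg', by simpa using hg⟩

/-! ### Stable Higgs fields up to conjugation -/

/-- The algebra of polynomial functions on a complex vector space. -/
def polyFunctions (V : Type) [AddCommGroup V] [Module ℂ V] : Subalgebra ℂ (V → ℂ) :=
  Algebra.adjoin ℂ (Set.range fun (l : Module.Dual ℂ V) (v : V) => l v)

/-- The Zariski topology on a complex vector space: the sets `{f ≠ 0}`, for `f` a polynomial
function, form a basis of open sets. -/
@[reducible] def zariskiTopology (V : Type) [AddCommGroup V] [Module ℂ V] : TopologicalSpace V :=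
  TopologicalSpace.generateFrom
    (Set.range fun (f : polyFunctions V) => {v : V | (f : V → ℂ) v ≠ 0})

/-- The set of all Higgs fields `Φ ∈ H⁰(ℙ², End E (d))` such that `(E, Φ)` is stable. -/
def StableHiggs (a : Fin 2 → ℤ) (d : ℤ) : Type :=
  {Φ : higgsFields a d // IsStable a d (Φ : Mat)}

/-- Stable Higgs fields carry the topology induced by the Zariski topology of
`H⁰(ℙ², End E (d))`. -/
instance (a : Fin 2 → ℤ) (d : ℤ) : TopologicalSpace (StableHiggs a d) :=
  (zariskiTopology (higgsFields a d)).induced Subtype.val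

/-- Conjugation of stable Higgs fields by automorphisms of `E`. -/
def conjSetoid (a : Fin 2 → ℤ) (d : ℤ) : Setoid (StableHiggs a d) where
  r Φ Ψ := ∃ g ∈ autGroup a, (Ψ.1 : Mat) = (g : Mat) * (Φ.1 : Mat) * ((g⁻¹ : Matˣ) : Mat)
  iseqv := by
    refine ⟨fun Φ => ⟨1, one_mem _, by simp⟩, ?_, ?_⟩
    · rintro Φ Ψ ⟨g, hg, h⟩
      refine ⟨g⁻¹, inv_mem hg, ?_⟩
      rw [h]
      simp [mul_assoc]
    · rintro Φ Ψ Θ ⟨g, hg, h⟩ ⟨g', hg', h'⟩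
      refine ⟨g' * g, mul_mem hg' hg, ?_⟩
      rw [h', h]
      simp [mul_assoc]

/-- The space of Higgs fields `Φ ∈ H⁰(ℙ², End E (d))` with `(E, Φ)` stable, up to conjugation by
automorphisms of `E`. -/
def StableHiggsModConj (a : Fin 2 → ℤ) (d : ℤ) : Type :=
  Quotient (conjSetoid a d)

/-- The quotient of the Zariski topology. -/
instance (a : Fin 2 → ℤ) (d : ℤ) : TopologicalSpace (StableHiggsModConj a d) :=
  inferInstanceAs (TopologicalSpace (Quotient (conjSetoid a d)))

/-! ### The Zariski tangent space of the moduli space of stable pairs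

The tangent space at `(E, Φ)` is the space of isomorphism classes of first-order deformations of
the pair over `ℂ[ε]`, with trace-free Higgs field and constant determinant (the Picard group of the
plane being discrete and `H¹(ℙ², 𝒪) = 0`, the latter is no restriction up to isomorphism).  On each
standard affine chart every first-order deformation of `E` is trivial, so a deformation is given by
gluing matrices `1 + ε A i j` on the overlaps together with Higgs fields `Φ + ε φ i` on the charts
which are compatible with the gluing. -/

/-- The standard affine chart `x i ≠ 0`. -/
def chart (i : Fin 3) : Set Plane := {p | p.rep i ≠ 0}

/-- The matrix `M + ε N` over the dual numbers. -/
def thicken (M N : Mat) : Matrix (Fin 2) (Fin 2) (DualNumber RatField) :=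
  Matrix.of fun i j => TrivSqZeroExt.inl (M i j) + TrivSqZeroExt.inr (N i j)

lemma thicken_mul (M N M' N' : Mat) :
    thicken M N * thicken M' N' = thicken (M * M') (M * N' + N * M') := by
  ext i j
  · simp [thicken, Matrix.mul_apply, Fin.sum_univ_two]
  · simp [thicken, Matrix.mul_apply, Fin.sum_univ_two]
    ring

lemma thicken_inj {M N M' N' : Mat} : thicken M N = thicken M' N' ↔ M = M' ∧ N = N' := by
  constructor
  · intro h
    have h' := fun i j => congrFun (congrFun h i) j
    constructor
    · ext i j
      simpa [thicken] using congrArg TrivSqZeroExt.fst (h' i j)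
    · ext i j
      simpa [thicken] using congrArg TrivSqZeroExt.snd (h' i j)
  · rintro ⟨rfl, rfl⟩
    rfl

/-- The first-order parts `A i j` of the gluing matrices and `φ i` of the Higgs fields. -/
abbrev DefData : Type := (Fin 3 → Fin 3 → Mat) × (Fin 3 → Mat)

/-- First-order deformations of the pair `(E, Φ)`. -/
structure IsDeformation (a : Fin 2 → ℤ) (d : ℤ) (Φ : Mat) (x : DefData) : Prop where
  gluing_mem : ∀ i j, x.1 i j ∈ endSections₀ a (chart i ∩ chart j) 0
  higgs_mem : ∀ i, x.2 i ∈ endSections₀ a (chart i) d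
  cocycle : ∀ i j k, thicken 1 (x.1 i j) * thicken 1 (x.1 j k) = thicken 1 (x.1 i k)
  compatible : ∀ i j,
    thicken Φ (x.2 i) * thicken 1 (x.1 i j) = thicken 1 (x.1 i j) * thicken Φ (x.2 j)

/-- An isomorphism of first-order deformations which restricts to the identity of `(E, Φ)`: it is
given by `1 + ε b i` on the charts, commuting with the gluing and with the Higgs fields. -/
def DefIso (a : Fin 2 → ℤ) (Φ : Mat) (x y : DefData) : Prop :=
  ∃ b : Fin 3 → Mat, (∀ i, b i ∈ endSections₀ a (chart i) 0) ∧
    (∀ i j, thicken 1 (b i) * thicken 1 (x.1 i j) = thicken 1 (y.1 i j) * thicken 1 (b j)) ∧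
    ∀ i, thicken 1 (b i) * thicken Φ (x.2 i) = thicken Φ (y.2 i) * thicken 1 (b i)

lemma isDeformation_iff {a : Fin 2 → ℤ} {d : ℤ} {Φ : Mat} {x : DefData} :
    IsDeformation a d Φ x ↔
      (∀ i j, x.1 i j ∈ endSections₀ a (chart i ∩ chart j) 0) ∧
      (∀ i, x.2 i ∈ endSections₀ a (chart i) d) ∧
      (∀ i j k, x.1 i j + x.1 j k = x.1 i k) ∧
      ∀ i j, x.2 i - x.2 j = x.1 i j * Φ - Φ * x.1 i j := by
  constructor
  · rintro ⟨h₁, h₂, h₃, h₄⟩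
    refine ⟨h₁, h₂, fun i j k => ?_, fun i j => ?_⟩
    · have h := h₃ i j k
      rw [thicken_mul, thicken_inj] at h
      rw [← h.2]
      simp [add_comm]
    · have h := h₄ i j
      rw [thicken_mul, thicken_mul, thicken_inj] at h
      have h' := h.2
      rw [mul_one, one_mul] at h'
      rw [sub_eq_sub_iff_add_eq_add, add_comm, h', add_comm]
  · rintro ⟨h₁, h₂, h₃, h₄⟩
    refine ⟨h₁, h₂, fun i j k => ?_, fun i j => ?_⟩
    · rw [thicken_mul, thicken_inj, ← h₃ i j k]
      simp [add_comm]
    · rw [thicken_mul, thicken_mul, thicken_inj]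
      have h := h₄ i j
      rw [sub_eq_sub_iff_add_eq_add] at h
      simp only [mul_one, one_mul, true_and]
      rw [add_comm, h, add_comm]

lemma defIso_iff {a : Fin 2 → ℤ} {Φ : Mat} {x y : DefData} :
    DefIso a Φ x y ↔ ∃ b : Fin 3 → Mat, (∀ i, b i ∈ endSections₀ a (chart i) 0) ∧
      (∀ i j, y.1 i j - x.1 i j = b i - b j) ∧ ∀ i, y.2 i - x.2 i = b i * Φ - Φ * b i := by
  unfold DefIso
  refine exists_congr fun b => and_congr_right fun _ => and_congr ?_ ?_
  · refine forall_congr' fun i => forall_congr' fun j => ?_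
    rw [thicken_mul, thicken_mul, thicken_inj, sub_eq_sub_iff_add_eq_add]
    simp only [mul_one, one_mul, true_and]
    constructor
    · intro h
      rw [add_comm, ← h, add_comm]
    · intro h
      rw [add_comm, ← h, add_comm]
  · refine forall_congr' fun i => ?_
    rw [thicken_mul, thicken_mul, thicken_inj, sub_eq_sub_iff_add_eq_add]
    simp only [mul_one, one_mul, true_and]
    constructor
    · intro h
      rw [add_comm, ← h, add_comm]
    · intro h
      rw [add_comm, add_comm (Φ * b i), h]

/-- The vector space of first-order deformations of `(E, Φ)`. -/
def deformations (a : Fin 2 → ℤ) (d : ℤ) (Φ : Mat) : Submodule ℂ DefData where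
  carrier := {x | IsDeformation a d Φ x}
  zero_mem' := by
    refine isDeformation_iff.2 ⟨fun _ _ => Submodule.zero_mem _, fun _ => Submodule.zero_mem _,
      fun _ _ _ => ?_, fun _ _ => ?_⟩ <;> simp
  add_mem' := by
    intro x y hx hy
    obtain ⟨h₁, h₂, h₃, h₄⟩ := isDeformation_iff.1 hx
    obtain ⟨k₁, k₂, k₃, k₄⟩ := isDeformation_iff.1 hy
    refine isDeformation_iff.2 ⟨fun i j => Submodule.add_mem _ (h₁ i j) (k₁ i j),
      fun i => Submodule.add_mem _ (h₂ i) (k₂ i), fun i j k => ?_, fun i j => ?_⟩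
    · change x.1 i j + y.1 i j + (x.1 j k + y.1 j k) = x.1 i k + y.1 i k
      rw [← h₃ i j k, ← k₃ i j k]
      abel
    · change x.2 i + y.2 i - (x.2 j + y.2 j) =
        (x.1 i j + y.1 i j) * Φ - Φ * (x.1 i j + y.1 i j)
      rw [add_sub_add_comm, h₄, k₄, add_mul, mul_add]
      abel
  smul_mem' := by
    intro c x hx
    obtain ⟨h₁, h₂, h₃, h₄⟩ := isDeformation_iff.1 hx
    refine isDeformation_iff.2 ⟨fun i j => Submodule.smul_mem _ c (h₁ i j),
      fun i => Submodule.smul_mem _ c (h₂ i), fun i j k => ?_, fun i j => ?_⟩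
    · change c • x.1 i j + c • x.1 j k = c • x.1 i k
      rw [← h₃ i j k, smul_add]
    · change c • x.2 i - c • x.2 j = c • x.1 i j * Φ - Φ * (c • x.1 i j)
      rw [← smul_sub, h₄, smul_sub, smul_mul_assoc, mul_smul_comm]

/-- The deformations which are isomorphic to the trivial one. -/
def trivialDeformations (a : Fin 2 → ℤ) (d : ℤ) (Φ : Mat) :
    Submodule ℂ (deformations a d Φ) where
  carrier := {x | DefIso a Φ 0 x}
  zero_mem' := by
    refine defIso_iff.2 ⟨0, fun _ => Submodule.zero_mem _, fun _ _ => ?_, fun _ => ?_⟩ <;> simp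
  add_mem' := by
    intro x y hx hy
    obtain ⟨b, h₁, h₂, h₃⟩ := defIso_iff.1 hx
    obtain ⟨c, k₁, k₂, k₃⟩ := defIso_iff.1 hy
    refine defIso_iff.2 ⟨b + c, fun i => Submodule.add_mem _ (h₁ i) (k₁ i), fun i j => ?_,
      fun i => ?_⟩
    · have h := h₂ i j
      have k := k₂ i j
      simp only [Prod.fst_zero, Pi.zero_apply, sub_zero] at h k
      simp only [Submodule.coe_add, Prod.fst_add, Prod.fst_zero, Pi.add_apply, Pi.zero_apply,
        sub_zero, h, k]
      abel
    · have h := h₃ i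
      have k := k₃ i
      simp only [Prod.snd_zero, Pi.zero_apply, sub_zero] at h k
      simp only [Submodule.coe_add, Prod.snd_add, Prod.snd_zero, Pi.add_apply, Pi.zero_apply,
        sub_zero, h, k, add_mul, mul_add]
      abel
  smul_mem' := by
    intro r x hx
    obtain ⟨b, h₁, h₂, h₃⟩ := defIso_iff.1 hx
    refine defIso_iff.2 ⟨r • b, fun i => Submodule.smul_mem _ r (h₁ i), fun i j => ?_,
      fun i => ?_⟩
    · have h := h₂ i j
      simp only [Prod.fst_zero, Pi.zero_apply, sub_zero] at h
      simp only [Submodule.coe_smul, Prod.smul_fst, Prod.fst_zero, Pi.smul_apply, Pi.zero_apply,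
        sub_zero, h, smul_sub]
    · have h := h₃ i
      simp only [Prod.snd_zero, Pi.zero_apply, sub_zero] at h
      simp only [Submodule.coe_smul, Prod.smul_snd, Prod.snd_zero, Pi.smul_apply, Pi.zero_apply,
        sub_zero, h, smul_sub, smul_mul_assoc, mul_smul_comm]

/-- Two deformations are isomorphic if and only if they differ by a trivial one. -/
lemma defIso_iff_sub_mem {a : Fin 2 → ℤ} {d : ℤ} {Φ : Mat} (x y : deformations a d Φ) :
    DefIso a Φ x y ↔ y - x ∈ trivialDeformations a d Φ := by
  change _ ↔ DefIso a Φ 0 _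
  rw [defIso_iff, defIso_iff]
  simp

/-- The Zariski tangent space at `(E, Φ)` of the moduli space of stable pairs with trace-free Higgs
field: the vector space of first-order deformations of `(E, Φ)` up to isomorphism. -/
abbrev ZariskiTangentSpace (a : Fin 2 → ℤ) (d : ℤ) (Φ : Mat) : Type :=
  deformations a d Φ ⧸ trivialDeformations a d Φ

end VafaWitten

end

/-!
Both parts rest on the description of `Γ(U, 𝒪(k))` by homogeneous polynomials, which gives
`h⁰(ℙ², 𝒪(k)) = (k + 2).choose 2` for `k ≥ 0` and `H¹(ℙ², 𝒪(k)) = 0` for all `k`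
(`finrank_sections`, `exists_sections_sub_eq_of_cocycle`).

**Tangent space.**  Since `H¹(ℙ², End₀ E) = 0`, every first-order deformation of the bundle `E` is
trivial, so the tangent space is the cokernel of `b ↦ [b, Φ]` from `H⁰(End₀ E)` to
`H⁰(End₀ E (d))`.  Stable pairs are simple, so this map is injective
(`finite_and_finrank_zariskiTangentSpace`), and it remains to count sections.

**Dimension of the quotient.**  Let `V` be the space of Higgs fields and `k = dim Aut E - 1`, the
scalars acting trivially; the dimension is `dim V - k`.

For the upper bound, the quotient map is open with irreducible fibres, so taking preimages is a
strictly monotone map from irreducible closed sets of the quotient to irreducible closed sets of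
stable Higgs fields.  The latter have dimension at most `dim V`, while every preimage contains the
closure of a conjugacy class, inside which there is an explicit chain of length `k`
(`topologicalKrullDim_stableHiggsModConj_le`).  The links of the chain are closures of orbits of
linear families of automorphisms, which are irreducible because any two of their points are joined
by a rational curve (`isIrreducible_of_rationalCurves`).

For the lower bound, there is a chain of length `dim V - k` of closures of images of affine
subspaces transverse to the orbits.  Strictness of an inclusion is certified by a closed set of
stable Higgs fields which is saturated under conjugation and contains the smaller subspace but not
the larger one (`irredClosureImage_lt`).  For `m > 0` these sets are cut out by the trace and the
determinant, and by linear conditions on the first row `(A, B)` of the Higgs field, which `Aut E`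
changes only by scaling `B` and adding multiples of `B` to `A` (`le_topologicalKrullDim_of_pos`).
For `m = 0` the automorphism group is `GL₂(ℂ)`, which conjugates all coefficient matrices of the
Higgs field simultaneously, and the sets are level sets of traces of words in these matrices
(`le_topologicalKrullDim_zero`).
-/

open scoped LinearAlgebra.Projectivization

noncomputable section

namespace VafaWitten

/-! ### Sections of line bundles are quotients of homogeneous polynomials -/

open MvPolynomial in
lemma homogeneousComponent_mul_of_isHomogeneous {P Q : CoordRing} {i j : ℕ}
    (hQ : Q.IsHomogeneous j) :
    homogeneousComponent (i + j) (P * Q) = homogeneousComponent i P * Q := by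
  conv_lhs => rw [← sum_homogeneousComponent P, Finset.sum_mul, map_sum]
  have h : ∀ n, homogeneousComponent (i + j) (homogeneousComponent n P * Q) =
      if n = i then homogeneousComponent i P * Q else 0 := by
    intro n
    rw [homogeneousComponent_of_mem ((homogeneousComponent_isHomogeneous n P).mul hQ)]
    by_cases hn : n = i
    · simp [hn]
    · rw [if_neg hn, if_neg (by omega)]
  simp_rw [h]
  rw [Finset.sum_ite_eq']
  split_ifs with hi
  · rfl
  · rw [homogeneousComponent_eq_zero _ _ (by simpa using hi), zero_mul]

open MvPolynomial in
lemma isHomogeneous_of_mul {P Q : CoordRing} {i j : ℕ} (hQ : Q.IsHomogeneous j) (hQ0 : Q ≠ 0)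
    (h : (P * Q).IsHomogeneous (i + j)) : P.IsHomogeneous i := by
  have e := homogeneousComponent_mul_of_isHomogeneous (P := P) (i := i) hQ
  rw [homogeneousComponent_eq_self h] at e
  rw [mul_right_cancel₀ hQ0 e]
  exact homogeneousComponent_isHomogeneous _ _

lemma algebraMap_injective : Function.Injective (algebraMap CoordRing RatField) :=
  IsFractionRing.injective _ _

lemma eval_rep_ne_zero_iff {P : CoordRing} {i : ℕ} (hP : P.IsHomogeneous i) {v : Fin 3 → ℂ}
    (hv : v ≠ 0) :
    MvPolynomial.eval (Projectivization.mk ℂ v hv).rep P ≠ 0 ↔ MvPolynomial.eval v P ≠ 0 := by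
  obtain ⟨c, hc⟩ := Projectivization.exists_smul_eq_mk_rep ℂ v hv
  rw [← hc]
  have : MvPolynomial.eval (c • v) P = (c : ℂ) ^ i * MvPolynomial.eval v P := by
    rw [MvPolynomial.eval_eq, MvPolynomial.eval_eq, Finset.mul_sum]
    refine Finset.sum_congr rfl fun e he => ?_
    have h := hP.degree_eq_sum_deg_support he
    rw [h]
    simp only [Pi.smul_apply, Units.smul_def, smul_eq_mul, mul_pow, Finset.prod_mul_distrib,
      Finset.prod_pow_eq_pow_sum]
    ring
  rw [this]
  simp

lemma eval_zero_of_isHomogeneous {M : CoordRing} {e : ℕ} (hM : M.IsHomogeneous e) (he : 0 < e) :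
    MvPolynomial.eval 0 M = 0 := by
  rw [MvPolynomial.eval_zero, MvPolynomial.constantCoeff_eq]
  exact hM.coeff_eq_zero (by simpa using he.ne)

/-- A section of `𝒪(k)` over the locus `M ≠ 0` of a form `M` of positive degree has a power of `M`
as denominator.  In lowest terms, its denominator has no zero off the hypersurface `M = 0`, so the
Nullstellensatz applies. -/
lemma exists_mul_pow_eq_of_mem_sections {M : CoordRing} {e : ℕ} (hM : M.IsHomogeneous e)
    (he : 0 < e) (hM0 : M ≠ 0) {k : ℤ} {f : RatField}
    (hf : f ∈ sections {p | MvPolynomial.eval p.rep M ≠ 0} k) :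
    ∃ N : ℕ, ∀ n ≥ N, ∃ (P : CoordRing) (i : ℕ), P.IsHomogeneous i ∧ (i : ℤ) = n * e + k ∧
      f * algebraMap CoordRing RatField M ^ n = algebraMap CoordRing RatField P := by
  set Q : CoordRing := ↑(IsFractionRing.den CoordRing f) with hQ
  set P : CoordRing := IsFractionRing.num CoordRing f with hP
  have hQ0 : Q ≠ 0 := nonZeroDivisors.coe_ne_zero _
  have hfQ : f * algebraMap CoordRing RatField Q = algebraMap CoordRing RatField P := by
    rw [IsFractionRing.num_mul_den_eq_num_iff_eq]
  have hrel : IsRelPrime P Q := IsFractionRing.num_den_reduced CoordRing f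
  have hdvd : ∀ P' Q' : CoordRing,
      f * algebraMap CoordRing RatField Q' = algebraMap CoordRing RatField P' → Q ∣ Q' := by
    intro P' Q' h
    have h1 : P * Q' = P' * Q := by
      apply algebraMap_injective
      rw [map_mul, map_mul, ← h, ← hfQ]
      ring
    exact hrel.symm.dvd_of_dvd_mul_left ⟨P', by rw [h1]; ring⟩
  have hrad : M ∈ (Ideal.span {Q}).radical := by
    rw [← MvPolynomial.vanishingIdeal_zeroLocus_eq_radical (K := ℂ),
      MvPolynomial.mem_vanishingIdeal_iff]
    intro v hv
    have hv' : MvPolynomial.eval v Q = 0 := hv Q (Ideal.mem_span_singleton_self Q)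
    by_contra hne
    have hne' : MvPolynomial.eval v M ≠ 0 := hne
    have hv0 : v ≠ 0 := by
      rintro rfl
      apply hne'
      exact eval_zero_of_isHomogeneous hM he
    obtain ⟨P', Q', i, j, -, hQ', -, hn, hmul⟩ :=
      hf (Projectivization.mk ℂ v hv0) ((eval_rep_ne_zero_iff hM hv0).2 hne')
    rw [eval_rep_ne_zero_iff hQ' hv0] at hn
    obtain ⟨R, rfl⟩ := hdvd P' Q' hmul
    rw [map_mul, hv', zero_mul] at hn
    exact hn rfl
  obtain ⟨N, hN⟩ := hrad
  have hN' : Q ∣ M ^ N := Ideal.mem_span_singleton.1 hN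
  refine ⟨max N k.natAbs, fun n hn => ?_⟩
  obtain ⟨R, hR⟩ := hN'.trans (pow_dvd_pow M (le_of_max_le_left hn))
  have hne : 0 ≤ (n : ℤ) * e + k := by
    have h1 : k.natAbs ≤ n := le_of_max_le_right hn
    nlinarith [abs_nonneg k, neg_abs_le k, Int.natCast_natAbs k]
  have hfn : f * algebraMap CoordRing RatField M ^ n = algebraMap CoordRing RatField (P * R) := by
    rw [← map_pow, hR, map_mul, ← mul_assoc, hfQ, map_mul]
  refine ⟨P * R, ((n : ℤ) * e + k).toNat, ?_, Int.toNat_of_nonneg hne, hfn⟩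
  -- some point off the hypersurface provides a representation by homogeneous polynomials
  obtain ⟨v, hv⟩ : ∃ v, MvPolynomial.eval v M ≠ 0 := by
    by_contra! h
    exact hM0 (MvPolynomial.funext fun v => by simpa using h v)
  have hv0 : v ≠ 0 := by
    rintro rfl
    apply hv
    exact eval_zero_of_isHomogeneous hM he
  obtain ⟨P', Q', i, j, hP', hQ', hd, hn', hmul⟩ :=
    hf (Projectivization.mk ℂ v hv0) ((eval_rep_ne_zero_iff hM hv0).2 hv)
  have hQ'0 : Q' ≠ 0 := by
    rintro rfl
    exact hn' (map_zero _)
  have h1 : P * R * Q' = P' * M ^ n := by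
    apply algebraMap_injective
    rw [map_mul, ← hfn, map_mul, ← hmul, map_pow]
    ring
  refine isHomogeneous_of_mul hQ' hQ'0 ?_
  rw [h1]
  have h2 := hP'.mul (hM.pow n)
  convert h2 using 1
  zify
  rw [Int.toNat_of_nonneg hne]
  linarith

lemma mem_sections_of_mul_pow_eq {M : CoordRing} {e : ℕ} (hM : M.IsHomogeneous e) {k : ℤ}
    {f : RatField} {n i : ℕ} {P : CoordRing} (hP : P.IsHomogeneous i) (hi : (i : ℤ) = n * e + k)
    (h : f * algebraMap CoordRing RatField M ^ n = algebraMap CoordRing RatField P) :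
    f ∈ sections {p | MvPolynomial.eval p.rep M ≠ 0} k := by
  intro p hp
  refine ⟨P, M ^ n, i, e * n, hP, hM.pow n, ?_, ?_, ?_⟩
  · push_cast
    linarith
  · rw [map_pow]
    exact pow_ne_zero _ hp
  · rw [map_pow, h]

lemma sections_mono {U U' : Set Plane} (h : U ⊆ U') (k : ℤ) : sections U' k ≤ sections U k :=
  fun _ hf p hp => hf p (h hp)

lemma chart_eq (i : Fin 3) :
    chart i = {p | MvPolynomial.eval p.rep (MvPolynomial.X i : CoordRing) ≠ 0} := by
  ext p
  simp [chart]

lemma chart_inter_eq (i j : Fin 3) :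
    chart i ∩ chart j =
      {p | MvPolynomial.eval p.rep (MvPolynomial.X i * MvPolynomial.X j : CoordRing) ≠ 0} := by
  ext p
  simp [chart]

lemma exists_mem_chart (p : Plane) : ∃ i, p ∈ chart i := by
  by_contra! h
  exact p.rep_nonzero (funext fun i => by simpa [chart] using h i)

lemma X_pow_dvd_of_dvd_mul {i j : Fin 3} (hij : i ≠ j) {n n' : ℕ} {P : CoordRing}
    (h : (MvPolynomial.X i : CoordRing) ^ n ∣ MvPolynomial.X j ^ n' * P) :
    (MvPolynomial.X i : CoordRing) ^ n ∣ P := by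
  have hp : Prime (MvPolynomial.X i : CoordRing) := MvPolynomial.X_prime
  refine hp.pow_dvd_of_dvd_mul_left n (fun hd => ?_) h
  have := hp.dvd_of_dvd_pow hd
  rw [MvPolynomial.X_dvd_X] at this
  exact hij this

/-- Global sections of `𝒪(k)` are homogeneous polynomials of degree `k`. -/
lemma mem_sections_univ_iff {k : ℤ} {f : RatField} :
    f ∈ sections Set.univ k ↔ ∃ (P : CoordRing) (i : ℕ), P.IsHomogeneous i ∧
      ((i : ℤ) = k ∨ P = 0) ∧ f = algebraMap CoordRing RatField P := by
  constructor
  · intro hf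
    -- compare the representations of `f` with denominators powers of `x₀` and of `x₁`
    have key := fun i : Fin 3 => exists_mul_pow_eq_of_mem_sections
      (MvPolynomial.isHomogeneous_X ℂ i) one_pos (MvPolynomial.X_ne_zero i)
      (sections_mono (Set.subset_univ _) k hf)
    obtain ⟨N, hN⟩ := key 0
    obtain ⟨N', hN'⟩ := key 1
    obtain ⟨P, i, hP, hi, h⟩ := hN N le_rfl
    obtain ⟨P', i', hP', hi', h'⟩ := hN' N' le_rfl
    have h1 : MvPolynomial.X 1 ^ N' * P = MvPolynomial.X 0 ^ N * P' := by
      apply algebraMap_injective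
      rw [map_mul, map_mul, ← h, ← h', map_pow, map_pow]
      ring
    obtain ⟨R, rfl⟩ := X_pow_dvd_of_dvd_mul (by decide) (Dvd.intro _ h1.symm)
    have hX : algebraMap CoordRing RatField (MvPolynomial.X 0) ^ N ≠ 0 := by
      rw [← map_pow, Ne, map_eq_zero_iff _ algebraMap_injective]
      exact pow_ne_zero _ (MvPolynomial.X_ne_zero _)
    have hf' : f = algebraMap CoordRing RatField R := by
      rw [map_mul, map_pow, mul_comm] at h
      exact mul_left_cancel₀ hX h
    by_cases hR : R = 0
    · exact ⟨R, 0, by rw [hR]; exact MvPolynomial.isHomogeneous_zero _ _ _, Or.inr hR, hf'⟩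
    have hXN := (MvPolynomial.isHomogeneous_X ℂ (0 : Fin 3)).pow N
    have hle : N ≤ i := by
      have hne : (MvPolynomial.X 0 : CoordRing) ^ N * R ≠ 0 :=
        mul_ne_zero (pow_ne_zero _ (MvPolynomial.X_ne_zero _)) hR
      rw [← hP.totalDegree hne, MvPolynomial.totalDegree_mul_of_isDomain
        (pow_ne_zero _ (MvPolynomial.X_ne_zero _)) hR,
        hXN.totalDegree (pow_ne_zero _ (MvPolynomial.X_ne_zero _))]
      omega
    refine ⟨R, i - N, ?_, Or.inl (by push_cast [hle]; push_cast at hi; linarith), hf'⟩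
    refine isHomogeneous_of_mul hXN (pow_ne_zero _ (MvPolynomial.X_ne_zero _)) ?_
    rw [mul_comm]
    convert hP using 1
    omega
  · rintro ⟨P, i, hP, hi | rfl, rfl⟩
    · intro p _
      exact ⟨P, 1, i, 0, hP, MvPolynomial.isHomogeneous_one _ _, by simp [hi], by simp, by simp⟩
    · rw [map_zero]
      exact zero_mem _

lemma sections_univ_of_neg {k : ℤ} (hk : k < 0) {f : RatField}
    (hf : f ∈ sections Set.univ k) : f = 0 := by
  obtain ⟨P, i, -, hi | rfl, rfl⟩ := mem_sections_univ_iff.1 hf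
  · omega
  · exact map_zero _

lemma mem_sections_univ_zero {f : RatField} :
    f ∈ sections Set.univ 0 ↔ ∃ c : ℂ, f = algebraMap ℂ RatField c := by
  rw [mem_sections_univ_iff]
  constructor
  · rintro ⟨P, i, hP, hi, rfl⟩
    have hP0 : P.IsHomogeneous 0 := by
      rcases hi with hi | rfl
      · obtain rfl : i = 0 := by exact_mod_cast hi
        exact hP
      · exact MvPolynomial.isHomogeneous_zero _ _ _
    refine ⟨MvPolynomial.coeff 0 P, ?_⟩
    rw [← MvPolynomial.totalDegree_zero_iff_isHomogeneous,
      MvPolynomial.totalDegree_eq_zero_iff_eq_C] at hP0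
    conv_lhs => rw [hP0]
    rw [IsScalarTower.algebraMap_apply ℂ CoordRing RatField]
    rfl
  · rintro ⟨c, rfl⟩
    exact ⟨MvPolynomial.C c, 0, MvPolynomial.isHomogeneous_C _ _, Or.inl rfl,
      IsScalarTower.algebraMap_apply ℂ CoordRing RatField c⟩

lemma sections_mul_mem {U : Set Plane} {k l n : ℤ} (h : k + l = n) {f g : RatField}
    (hf : f ∈ sections U k) (hg : g ∈ sections U l) : f * g ∈ sections U n :=
  fun p hp => h ▸ (hf p hp).mul (hg p hp)

/-- `H⁰(ℙ², 𝒪(n))` is the space of forms of degree `n`. -/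
def formsEquivSections (n : ℕ) :
    MvPolynomial.homogeneousSubmodule (Fin 3) ℂ n ≃ₗ[ℂ] sections Set.univ (n : ℤ) :=
  LinearEquiv.ofBijective
    (((IsScalarTower.toAlgHom ℂ CoordRing RatField).toLinearMap.comp
      (MvPolynomial.homogeneousSubmodule (Fin 3) ℂ n).subtype).codRestrict _
        fun P => mem_sections_univ_iff.2 ⟨P, n, P.2, Or.inl rfl, rfl⟩) <| by
    constructor
    · intro P Q h
      exact Subtype.ext (algebraMap_injective (congrArg Subtype.val h))
    · rintro ⟨f, hf⟩
      obtain ⟨P, i, hP, hi, rfl⟩ := mem_sections_univ_iff.1 hf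
      refine ⟨⟨P, ?_⟩, rfl⟩
      rcases hi with hi | rfl
      · obtain rfl : i = n := by exact_mod_cast hi
        exact hP
      · exact zero_mem _

lemma finite_homogeneousSubmodule (n : ℕ) :
    Module.Finite ℂ (MvPolynomial.homogeneousSubmodule (Fin 3) ℂ n) :=
  Module.Finite.iff_fg.2 (MvPolynomial.homogeneousSubmodule_fg _ _ n)

instance (k : ℤ) : Module.Finite ℂ (sections Set.univ k) := by
  rcases lt_or_ge k 0 with hk | hk
  · have : sections Set.univ k = ⊥ := eq_bot_iff.2 fun f hf => sections_univ_of_neg hk hf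
    rw [this]
    infer_instance
  · lift k to ℕ using hk
    have := finite_homogeneousSubmodule k
    exact Module.Finite.equiv (formsEquivSections k)

lemma finrank_sections_of_neg {k : ℤ} (hk : k < 0) :
    Module.finrank ℂ (sections Set.univ k) = 0 := by
  have : sections Set.univ k = ⊥ := eq_bot_iff.2 fun f hf => sections_univ_of_neg hk hf
  rw [this, finrank_bot]

lemma finrank_sections (n : ℕ) :
    Module.finrank ℂ (sections Set.univ (n : ℤ)) = (n + 2).choose 2 := by
  rw [← (formsEquivSections n).finrank_eq, MvPolynomial.homogeneousSubmodule_eq_finsupp_supported]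
  have e : {d : Fin 3 →₀ ℕ | d.degree = n} =
      ↑((Finset.univ : Finset (Fin 3)).finsuppAntidiag n) := by
    ext d
    simp [Finsupp.degree_eq_sum]
  rw [e]
  refine (AddMonoidAlgebra.supportedEquivFinsupp (R := ℂ) (S := ℂ)
    (↑((Finset.univ : Finset (Fin 3)).finsuppAntidiag n) : Set (Fin 3 →₀ ℕ))).finrank_eq.trans ?_
  · rw [Module.finrank_finsupp_self]
    simp [Finset.card_finsuppAntidiag_nat_eq_choose]
    rw [← Nat.choose_symm_add, add_comm]

/-- The variable `x₁` is not a zero divisor modulo the monomial ideal `(x₀ᴺ, x₂ᴺ)`; the coefficients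
which express a form as a member of this ideal can be taken to be forms. -/
lemma exists_forms_of_X_pow_mul_eq {N i : ℕ} {P A B : CoordRing} (hP : P.IsHomogeneous (i + N))
    (h : MvPolynomial.X 1 ^ N * P = MvPolynomial.X 2 ^ N * A + MvPolynomial.X 0 ^ N * B) :
    ∃ A' B' : CoordRing, A'.IsHomogeneous i ∧ B'.IsHomogeneous i ∧
      P = A' * MvPolynomial.X 2 ^ N + B' * MvPolynomial.X 0 ^ N := by
  have hspan : ∀ R : CoordRing, R ∈ Ideal.span
      ((fun s => MvPolynomial.monomial s (1 : ℂ)) ''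
        {Finsupp.single (2 : Fin 3) N, Finsupp.single 0 N}) ↔
      ∃ a b, R = a * MvPolynomial.X 2 ^ N + b * MvPolynomial.X 0 ^ N := by
    intro R
    rw [Set.image_pair, Ideal.mem_span_pair, MvPolynomial.X_pow_eq_monomial,
      MvPolynomial.X_pow_eq_monomial]
    simp only [eq_comm]
  have hmem : P ∈ Ideal.span ((fun s => MvPolynomial.monomial s (1 : ℂ)) ''
        {Finsupp.single (2 : Fin 3) N, Finsupp.single 0 N}) := by
    have h1 := (hspan (MvPolynomial.X 1 ^ N * P)).2 ⟨A, B, by rw [h]; ring⟩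
    rw [MvPolynomial.mem_ideal_span_monomial_image] at h1 ⊢
    intro e he
    obtain ⟨s, hs, hle⟩ := h1 (Finsupp.single 1 N + e) (by
      rw [MvPolynomial.mem_support_iff, MvPolynomial.X_pow_eq_monomial,
        MvPolynomial.coeff_monomial_mul, one_mul]
      exact MvPolynomial.mem_support_iff.1 he)
    refine ⟨s, hs, ?_⟩
    rcases hs with rfl | rfl
    · rw [Finsupp.single_le_iff] at hle ⊢
      simpa using hle
    · rw [Finsupp.single_le_iff] at hle ⊢
      simpa using hle
  obtain ⟨a, b, hab⟩ := (hspan P).1 hmem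
  refine ⟨MvPolynomial.homogeneousComponent i a, MvPolynomial.homogeneousComponent i b,
    MvPolynomial.homogeneousComponent_isHomogeneous _ _,
    MvPolynomial.homogeneousComponent_isHomogeneous _ _, ?_⟩
  have hX : ∀ l : Fin 3, (MvPolynomial.X l ^ N : CoordRing).IsHomogeneous N := fun l => by
    simpa using (MvPolynomial.isHomogeneous_X ℂ l).pow N
  conv_lhs => rw [← MvPolynomial.homogeneousComponent_eq_self hP, hab, map_add,
    homogeneousComponent_mul_of_isHomogeneous (hX 2),
    homogeneousComponent_mul_of_isHomogeneous (hX 0)]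

/-- The vanishing of `H¹(ℙ², 𝒪(k))`, for Čech cocycles on the standard affine charts.  The relation
`f 0 1 + f 1 2 = f 0 2` puts the numerator of `f 0 2` into the ideal `(x₀ᴺ, x₂ᴺ)`, which splits
`f 0 2` into sections over the charts `0` and `2`. -/
theorem exists_sections_sub_eq_of_cocycle {k : ℤ} {f : Fin 3 → Fin 3 → RatField}
    (hf : ∀ i j, f i j ∈ sections (chart i ∩ chart j) k)
    (hc : ∀ i j l, f i j + f j l = f i l) :
    ∃ b : Fin 3 → RatField, (∀ i, b i ∈ sections (chart i) k) ∧ ∀ i j, f i j = b i - b j := by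
  have key : ∀ i j, ∃ N : ℕ, ∀ n ≥ N, ∃ (P : CoordRing) (e : ℕ), P.IsHomogeneous e ∧
      (e : ℤ) = n * (2 : ℕ) + k ∧
      f i j * algebraMap CoordRing RatField (MvPolynomial.X i * MvPolynomial.X j) ^ n =
        algebraMap CoordRing RatField P := fun i j =>
    exists_mul_pow_eq_of_mem_sections
      ((MvPolynomial.isHomogeneous_X ℂ i).mul (MvPolynomial.isHomogeneous_X ℂ j)) (by norm_num)
      (mul_ne_zero (MvPolynomial.X_ne_zero i) (MvPolynomial.X_ne_zero j))
      (by rw [← chart_inter_eq]; exact hf i j)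
  obtain ⟨N₁, h₁⟩ := key 0 1
  obtain ⟨N₂, h₂⟩ := key 1 2
  obtain ⟨N₃, h₃⟩ := key 0 2
  set N := N₁ + N₂ + N₃ + k.natAbs with hN
  obtain ⟨P, e, hP, he, hfP⟩ := h₁ N (by omega)
  obtain ⟨Q, e', hQ, he', hfQ⟩ := h₂ N (by omega)
  obtain ⟨R, e'', hR, he'', hfR⟩ := h₃ N (by omega)
  obtain rfl : e = e' := by omega
  obtain rfl : e = e'' := by omega
  obtain ⟨i, rfl⟩ : ∃ i, e = i + N := ⟨e - N, by omega⟩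
  have hi : (i : ℤ) = N + k := by push_cast at he; omega
  have hx : ∀ l, algebraMap CoordRing RatField (MvPolynomial.X l) ≠ 0 := fun l => by
    rw [Ne, map_eq_zero_iff _ algebraMap_injective]
    exact MvPolynomial.X_ne_zero _
  have hR' : MvPolynomial.X 1 ^ N * R = MvPolynomial.X 2 ^ N * P + MvPolynomial.X 0 ^ N * Q := by
    apply algebraMap_injective
    simp only [map_mul, map_add, map_pow, ← hfP, ← hfQ, ← hfR, ← hc 0 1 2]
    ring
  obtain ⟨A, B, hA, hB, rfl⟩ := exists_forms_of_X_pow_mul_eq hR hR'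
  set x := fun l => algebraMap CoordRing RatField (MvPolynomial.X l) with hxdef
  have hx0 : ∀ l, x l ≠ 0 := hx
  simp only [map_mul, map_add, map_pow] at hfP hfQ hfR
  have hc' := hc 0 1 2
  -- the splitting of `f 0 2` into fractions with denominators `x₀ᴺ` and `x₂ᴺ`
  set b₀ := algebraMap CoordRing RatField A / x 0 ^ N with hb₀
  set b₂ := -algebraMap CoordRing RatField B / x 2 ^ N with hb₂
  have hf02 : f 0 2 = b₀ - b₂ := by
    have h0 := hx0 0
    have h2 := hx0 2
    rw [hb₀, hb₂]
    field_simp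
    change f 0 2 * (x 0 * x 2) ^ N = _ at hfR
    rw [mul_pow] at hfR
    rw [← mul_assoc] at hfR
    linear_combination hfR
  have mem₀ : b₀ ∈ sections (chart 0) k := by
    rw [chart_eq]
    refine mem_sections_of_mul_pow_eq (MvPolynomial.isHomogeneous_X ℂ 0) hA (n := N)
      (by push_cast; linarith) ?_
    exact div_mul_cancel₀ _ (pow_ne_zero _ (hx0 0))
  have mem₂ : b₂ ∈ sections (chart 2) k := by
    rw [chart_eq]
    refine mem_sections_of_mul_pow_eq (MvPolynomial.isHomogeneous_X ℂ 2) hB.neg (n := N)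
      (by push_cast; linarith) ?_
    rw [map_neg]
    exact div_mul_cancel₀ _ (pow_ne_zero _ (hx0 2))
  -- `b₀ - f 0 1` has denominators `(x₀ x₁)ᴺ` and `(x₁ x₂)ᴺ`, hence also `x₁ᴺ`
  have mem₁ : b₀ - f 0 1 ∈ sections (chart 1) k := by
    have e1 : (b₀ - f 0 1) * (x 0 * x 1) ^ N =
        algebraMap CoordRing RatField (A * MvPolynomial.X 1 ^ N - P) := by
      have h0 := hx0 0
      rw [sub_mul, map_sub, ← hfP, map_mul, map_pow, hb₀, mul_pow]
      field_simp
      simp only [hxdef]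
      ring
    have e2 : (b₀ - f 0 1) * (x 1 * x 2) ^ N =
        algebraMap CoordRing RatField (Q - B * MvPolynomial.X 1 ^ N) := by
      have h2 := hx0 2
      have : b₀ - f 0 1 = f 1 2 + b₂ := by linear_combination -hc' - hf02
      rw [this, add_mul, map_sub, ← hfQ, map_mul, map_pow, hb₂, mul_pow]
      field_simp
      simp only [hxdef]
      ring
    have e3 : MvPolynomial.X 2 ^ N * (A * MvPolynomial.X 1 ^ N - P) =
        MvPolynomial.X 0 ^ N * (Q - B * MvPolynomial.X 1 ^ N) := by
      apply algebraMap_injective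
      rw [map_mul, map_mul, ← e1, ← e2, map_pow, map_pow]
      ring
    obtain ⟨S, hS⟩ := X_pow_dvd_of_dvd_mul (by decide) (Dvd.intro _ e3.symm)
    have hX : ∀ l : Fin 3, (MvPolynomial.X l ^ N : CoordRing).IsHomogeneous N := fun l => by
      simpa using (MvPolynomial.isHomogeneous_X ℂ l).pow N
    have hShom : S.IsHomogeneous i := by
      refine isHomogeneous_of_mul (hX 0) (pow_ne_zero _ (MvPolynomial.X_ne_zero _)) ?_
      rw [mul_comm, ← hS]
      exact (hA.mul (hX 1)).sub hP
    rw [chart_eq]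
    refine mem_sections_of_mul_pow_eq (MvPolynomial.isHomogeneous_X ℂ 1) hShom (n := N)
      (by push_cast; linarith) ?_
    rw [hS, map_mul, map_pow, mul_pow] at e1
    exact mul_left_cancel₀ (pow_ne_zero N (hx0 0)) (by rw [← e1]; ring)
  refine ⟨fun l => b₀ - f 0 l, fun l => ?_, fun l l' => ?_⟩
  · have h00 : f 0 0 = 0 := by simpa using hc 0 0 0
    fin_cases l
    · simpa [h00] using mem₀
    · exact mem₁
    · simpa [hf02] using mem₂
  · linear_combination hc 0 l l'

/-- Sections over the three charts which agree are a global section. -/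
lemma mem_sections_univ_of_forall_chart {k : ℤ} {f : RatField}
    (hf : ∀ i, f ∈ sections (chart i) k) : f ∈ sections Set.univ k := fun p _ =>
  let ⟨i, hi⟩ := exists_mem_chart p
  hf i p hi

/-! ### The space of Higgs fields -/

lemma endSections_mul_mem {a : Fin 2 → ℤ} {U : Set Plane} {k l n : ℤ} (hn : k + l = n) {M N : Mat}
    (hM : M ∈ endSections a U k) (hN : N ∈ endSections a U l) : M * N ∈ endSections a U n := by
  intro i j
  rw [Matrix.mul_apply]
  exact Submodule.sum_mem _ fun r _ => sections_mul_mem (by subst hn; ring) (hM i r) (hN r j)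

lemma mem_endSections_iff {a : Fin 2 → ℤ} {U : Set Plane} {k : ℤ} {M : Mat} :
    M ∈ endSections a U k ↔ ∀ i j, M i j ∈ sections U (a i - a j + k) := Iff.rfl

/-- A global section of `End E (k)` amounts to its four entries. -/
def endSectionsEquiv (a : Fin 2 → ℤ) (k : ℤ) : endSections a Set.univ k ≃ₗ[ℂ]
    ((i : Fin 2) → (j : Fin 2) → sections Set.univ (a i - a j + k)) where
  toFun M i j := ⟨M.1 i j, M.2 i j⟩
  invFun f := ⟨Matrix.of fun i j => (f i j : RatField), fun i j => (f i j).2⟩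
  left_inv _ := rfl
  right_inv _ := rfl
  map_add' _ _ := rfl
  map_smul' _ _ := rfl

instance (a : Fin 2 → ℤ) (k : ℤ) : Module.Finite ℂ (endSections a Set.univ k) :=
  Module.Finite.equiv (endSectionsEquiv a k).symm

lemma finrank_endSections (a : Fin 2 → ℤ) (k : ℤ) :
    Module.finrank ℂ (endSections a Set.univ k) =
      Module.finrank ℂ (sections Set.univ (a 0 - a 0 + k)) +
      Module.finrank ℂ (sections Set.univ (a 0 - a 1 + k)) +
      (Module.finrank ℂ (sections Set.univ (a 1 - a 0 + k)) +
      Module.finrank ℂ (sections Set.univ (a 1 - a 1 + k))) := by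
  rw [(endSectionsEquiv a k).finrank_eq, Module.finrank_pi_fintype, Fin.sum_univ_two,
    Module.finrank_pi_fintype, Module.finrank_pi_fintype, Fin.sum_univ_two, Fin.sum_univ_two]

lemma mem_endSections₀_iff {a : Fin 2 → ℤ} {U : Set Plane} {k : ℤ} {M : Mat} :
    M ∈ endSections₀ a U k ↔ (∀ i j, M i j ∈ sections U (a i - a j + k)) ∧ M 0 0 + M 1 1 = 0 := by
  rw [endSections₀, Submodule.mem_inf, LinearMap.mem_ker, Matrix.traceLinearMap_apply,
    Matrix.trace_fin_two, mem_endSections_iff]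

/-- A trace-free global section of `End E (k)` amounts to its entries other than the last one. -/
def endSections₀Equiv (a : Fin 2 → ℤ) (k : ℤ) : endSections₀ a Set.univ k ≃ₗ[ℂ]
    (sections Set.univ k × sections Set.univ (a 0 - a 1 + k) ×
      sections Set.univ (a 1 - a 0 + k)) where
  toFun M := (⟨M.1 0 0, by simpa using M.2.1 0 0⟩, ⟨M.1 0 1, M.2.1 0 1⟩, ⟨M.1 1 0, M.2.1 1 0⟩)
  invFun f := ⟨!![(f.1 : RatField), f.2.1; f.2.2, -f.1], mem_endSections₀_iff.2 ⟨by
    intro i j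
    fin_cases i <;> fin_cases j
    · simp
    · exact f.2.1.2
    · exact f.2.2.2
    · simp, by simp⟩⟩
  left_inv M := by
    ext i j
    have := (mem_endSections₀_iff.1 M.2).2
    fin_cases i <;> fin_cases j
    · rfl
    · rfl
    · rfl
    · exact neg_eq_of_add_eq_zero_right this
  right_inv _ := rfl
  map_add' _ _ := rfl
  map_smul' _ _ := rfl

instance (a : Fin 2 → ℤ) (k : ℤ) : Module.Finite ℂ (endSections₀ a Set.univ k) :=
  Module.Finite.equiv (endSections₀Equiv a k).symm

lemma finrank_endSections₀ (a : Fin 2 → ℤ) (k : ℤ) :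
    Module.finrank ℂ (endSections₀ a Set.univ k) =
      Module.finrank ℂ (sections Set.univ k) +
      (Module.finrank ℂ (sections Set.univ (a 0 - a 1 + k)) +
      Module.finrank ℂ (sections Set.univ (a 1 - a 0 + k))) := by
  rw [(endSections₀Equiv a k).finrank_eq, Module.finrank_prod, Module.finrank_prod]

/-! ### Stability -/

/-- For `m > 0`, the destabilizing sub-line bundle is the summand `𝒪(m)`, which a Higgs field
preserves if and only if its component `𝒪(m) → 𝒪(d)` vanishes. -/
lemma isStable_iff_of_pos {m : ℤ} (hm : 0 < m) {d : ℤ} {Φ : Mat}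
    (hΦ : Φ ∈ endSections ![0, m] Set.univ d) : IsStable ![0, m] d Φ ↔ Φ 0 1 ≠ 0 := by
  constructor
  · intro h h0
    have := h m ![0, 1] (Φ 1 1) (fun h => by simpa using congrFun h 1) (by
      intro i
      fin_cases i
      · simp
      · exact fun p _ => by simpa using isRegularAt_one p) (by simpa using hΦ 1 1) (by
      ext i
      fin_cases i <;> simp [Matrix.mulVec, dotProduct, h0])
    simp at this
    omega
  · intro h k s lam hs hsec _ he
    by_contra hk
    have hk' : 0 < k := by
      simp at hk
      omega
    have h0 : s 0 = 0 := sections_univ_of_neg (by simpa using hk') (hsec 0)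
    have e0 := congrFun he 0
    simp [Matrix.mulVec, dotProduct, h0, h] at e0
    apply hs
    ext i
    fin_cases i
    · exact h0
    · exact e0

lemma IsStable.mulVec_ne {d : ℤ} {Φ : Mat} (h : IsStable ![0, 0] d Φ) {s : Fin 2 → ℂ}
    (hs : s ≠ 0) {lam : RatField} (hlam : lam ∈ sections Set.univ d) :
    Φ.mulVec (fun i => algebraMap ℂ RatField (s i)) ≠
      lam • fun i => algebraMap ℂ RatField (s i) := by
  intro he
  have := h 0 _ lam (fun h0 => hs (funext fun i =>
    (map_eq_zero_iff _ (algebraMap ℂ RatField).injective).1 (congrFun h0 i))) (by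
      intro i
      have : (![0, 0] : Fin 2 → ℤ) i - 0 = 0 := by fin_cases i <;> rfl
      rw [this]
      exact mem_sections_univ_zero.2 ⟨_, rfl⟩) hlam he
  simp at this

/-- For `m = 0`, sub-line bundles of degree at least zero are trivial, spanned by a constant
vector. -/
lemma isStable_zero_of_forall {d : ℤ} {Φ : Mat} (h : ∀ (s : Fin 2 → ℂ), s ≠ 0 →
    ∀ lam : RatField, Φ.mulVec (fun i => algebraMap ℂ RatField (s i)) ≠
      lam • fun i => algebraMap ℂ RatField (s i)) : IsStable ![0, 0] d Φ := by
  intro k s lam hs hsec _ he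
  by_contra hk
  have hk' : 0 ≤ k := by
    simp at hk
    omega
  have e : ∀ i, (![0, 0] : Fin 2 → ℤ) i - k = -k := by
    intro i
    fin_cases i <;> simp
  rcases hk'.eq_or_lt with rfl | hlt
  · have : ∀ i, ∃ c, s i = algebraMap ℂ RatField c := fun i => by
      have := hsec i
      rw [e, neg_zero] at this
      exact mem_sections_univ_zero.1 this
    choose c hc using this
    obtain rfl : s = fun i => algebraMap ℂ RatField (c i) := funext hc
    refine h c (fun h0 => hs ?_) lam he
    ext i
    simp [h0]
  · refine hs (funext fun i => ?_)
    have := hsec i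
    rw [e] at this
    exact sections_univ_of_neg (by omega) this

/-- A stable pair is simple: it has no trace-free infinitesimal automorphisms. -/
theorem eq_zero_of_commute_of_isStable {m : ℤ} (hm : 0 ≤ m) {d : ℤ} {Φ : Mat}
    (hΦ : Φ ∈ endSections ![0, m] Set.univ d) (hs : IsStable ![0, m] d Φ) {b : Mat}
    (hb : b ∈ endSections₀ ![0, m] Set.univ 0) (hc : b * Φ = Φ * b) : b = 0 := by
  obtain ⟨hb1, hb2⟩ := mem_endSections₀_iff.1 hb
  have e := fun i j => congrFun (congrFun hc i) j
  simp only [Matrix.mul_apply, Fin.sum_univ_two] at e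
  have hb3 : b 1 1 = - b 0 0 := (neg_eq_of_add_eq_zero_right hb2).symm
  rcases hm.eq_or_lt with rfl | hm
  · have : ∀ i j, ∃ c, b i j = algebraMap ℂ RatField c := fun i j => by
      have := hb1 i j
      have e0 : ∀ i, (![0, 0] : Fin 2 → ℤ) i = 0 := by
        intro i
        fin_cases i <;> rfl
      rw [e0, e0] at this
      exact mem_sections_univ_zero.1 (by simpa using this)
    choose c hcb using this
    by_contra hb0
    -- an eigenvector of the constant matrix `b` is a common eigenvector
    have hΦ' : ∀ i j, Φ i j ∈ sections Set.univ d := fun i j => by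
      have := hΦ i j
      have e0 : ∀ i, (![0, 0] : Fin 2 → ℤ) i = 0 := by
        intro i
        fin_cases i <;> rfl
      rw [e0, e0] at this
      simpa using this
    have hc3 : c 1 1 = - c 0 0 := (algebraMap ℂ RatField).injective (by
      rw [map_neg, ← hcb, ← hcb, hb3])
    obtain ⟨r, hr⟩ := IsAlgClosed.exists_pow_nat_eq (c 0 0 ^ 2 + c 0 1 * c 1 0) (n := 2) two_pos
    have e00 := e 0 0
    have e01 := e 0 1
    have e10 := e 1 0
    have e11 := e 1 1
    simp only [hcb, hc3, map_neg] at e00 e01 e10 e11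
    have hr' : algebraMap ℂ RatField r ^ 2 = algebraMap ℂ RatField (c 0 0) ^ 2 +
        algebraMap ℂ RatField (c 0 1) * algebraMap ℂ RatField (c 1 0) := by
      rw [← map_pow, hr]
      simp
    by_cases h1 : c 0 1 = 0
    · by_cases h2 : c 1 0 = 0
      · have h3 : c 0 0 ≠ 0 := by
          intro h3
          apply hb0
          ext i j
          fin_cases i <;> fin_cases j <;> simp [hcb, h1, h2, h3, hc3]
        have h3' : algebraMap ℂ RatField (c 0 0) ≠ 0 := by simpa using h3
        refine hs.mulVec_ne (s := ![1, 0]) (fun h => by simpa using congrFun h 0) (hΦ' 0 0) ?_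
        have : Φ 1 0 = 0 := by
          have : (2 * algebraMap ℂ RatField (c 0 0)) * Φ 1 0 = 0 := by
            simp only [h2, map_zero] at e10
            linear_combination -e10
          simpa [h3'] using this
        ext i
        fin_cases i <;> simp [Matrix.mulVec, dotProduct, this]
      · have h2' : algebraMap ℂ RatField (c 1 0) ≠ 0 := by simpa using h2
        refine hs.mulVec_ne (s := ![0, 1]) (fun h => by simpa using congrFun h 1) (hΦ' 1 1) ?_
        have : Φ 0 1 = 0 := by
          have : algebraMap ℂ RatField (c 1 0) * Φ 0 1 = 0 := by
            simp only [h1, map_zero] at e00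
            linear_combination -e00
          simpa [h2'] using this
        ext i
        fin_cases i <;> simp [Matrix.mulVec, dotProduct, this]
    · -- `r` is an eigenvalue of `b`, with eigenvector `(c 0 1, r - c 0 0)`
      have h1' : algebraMap ℂ RatField (c 0 1) ≠ 0 := by simpa using h1
      have hlam : Φ 0 0 + ((r - c 0 0) / c 0 1) • Φ 0 1 ∈ sections Set.univ d :=
        add_mem (hΦ' 0 0) (Submodule.smul_mem _ _ (hΦ' 0 1))
      refine hs.mulVec_ne (s := ![c 0 1, r - c 0 0]) (fun h => h1 (by simpa using congrFun h 0))
        hlam ?_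
      have e4 : Φ 1 0 * algebraMap ℂ RatField (c 0 1) =
          algebraMap ℂ RatField (c 1 0) * Φ 0 1 := by linear_combination e00
      ext i
      fin_cases i
      · simp [Matrix.mulVec, dotProduct, Algebra.smul_def]
        field_simp
      · simp [Matrix.mulVec, dotProduct, Algebra.smul_def]
        field_simp
        linear_combination (algebraMap ℂ RatField (c 0 1)) * e4 - Φ 0 1 * hr' +
          (algebraMap ℂ RatField r - algebraMap ℂ RatField (c 0 0)) * e01
  · rw [isStable_iff_of_pos hm hΦ] at hs
    have h01 : b 0 1 = 0 := sections_univ_of_neg (by simpa using hm) (hb1 0 1)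
    have h10 : b 1 0 = 0 := by
      have := e 0 0
      rw [h01] at this
      have : Φ 0 1 * b 1 0 = 0 := by linear_combination -this
      simpa [hs] using this
    have h00 : b 0 0 = 0 := by
      have := e 0 1
      rw [h01, hb3] at this
      have : 2 * Φ 0 1 * b 0 0 = 0 := by linear_combination this
      simpa [hs] using this
    ext i j
    fin_cases i <;> fin_cases j <;> simp [h01, h10, h00, hb3]

/-! ### First-order deformations -/

/-- The commutator with `Φ`, from infinitesimal automorphisms of `E` to Higgs fields. -/
def commutatorMap (a : Fin 2 → ℤ) {d : ℤ} {Φ : Mat} (hΦ : Φ ∈ endSections a Set.univ d) :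
    endSections₀ a Set.univ 0 →ₗ[ℂ] endSections₀ a Set.univ d where
  toFun b := ⟨b.1 * Φ - Φ * b.1, ⟨sub_mem (endSections_mul_mem (zero_add d) b.2.1 hΦ)
    (endSections_mul_mem (add_zero d) hΦ b.2.1), by
      rw [SetLike.mem_coe, LinearMap.mem_ker, Matrix.traceLinearMap_apply, Matrix.trace_sub,
        Matrix.trace_mul_comm, sub_self]⟩⟩
  map_add' b c := Subtype.ext (by
    simp only [Submodule.coe_add, add_mul, mul_add]
    abel)
  map_smul' r b := Subtype.ext (by
    simp only [Submodule.coe_smul, smul_mul_assoc, mul_smul_comm, smul_sub, RingHom.id_apply])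

/-- The deformations of `(E, Φ)` which leave the bundle `E` constant. -/
def constantBundleDeformation (a : Fin 2 → ℤ) (d : ℤ) (Φ : Mat) :
    endSections₀ a Set.univ d →ₗ[ℂ] deformations a d Φ where
  toFun φ := ⟨(0, fun _ => φ.1), isDeformation_iff.2
    ⟨fun _ _ => Submodule.zero_mem _,
      fun i => ⟨fun k l => sections_mono (Set.subset_univ _) _ (φ.2.1 k l), φ.2.2⟩,
      fun _ _ _ => by simp, fun _ _ => by simp⟩⟩
  map_add' _ _ := Subtype.ext (Prod.ext (by simp) rfl)
  map_smul' _ _ := Subtype.ext (Prod.ext (by simp) rfl)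

lemma mem_trivialDeformations_iff {a : Fin 2 → ℤ} {d : ℤ} {Φ : Mat} {x : deformations a d Φ} :
    x ∈ trivialDeformations a d Φ ↔
      ∃ b : Fin 3 → Mat, (∀ i, b i ∈ endSections₀ a (chart i) 0) ∧
      (∀ i j, x.1.1 i j = b i - b j) ∧ ∀ i, x.1.2 i = b i * Φ - Φ * b i := by
  change DefIso a Φ 0 x ↔ _
  rw [defIso_iff]
  simp

/-- Every first-order deformation of the bundle `E` is trivial, since `H¹(ℙ², End₀ E) = 0`. -/
lemma exists_endSections₀_sub_eq {a : Fin 2 → ℤ} {k : ℤ} {f : Fin 3 → Fin 3 → Mat}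
    (hf : ∀ i j, f i j ∈ endSections₀ a (chart i ∩ chart j) k)
    (hc : ∀ i j l, f i j + f j l = f i l) :
    ∃ b : Fin 3 → Mat, (∀ i, b i ∈ endSections₀ a (chart i) k) ∧ ∀ i j, f i j = b i - b j := by
  have key := fun r s => exists_sections_sub_eq_of_cocycle (f := fun i j => f i j r s)
    (fun i j => (hf i j).1 r s)
    (fun i j l => congrFun (congrFun (hc i j l) r) s)
  choose b hb he using key
  refine ⟨fun i => !![b 0 0 i, b 0 1 i; b 1 0 i, -b 0 0 i], fun i => ?_, fun i j => ?_⟩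
  · refine mem_endSections₀_iff.2 ⟨fun r s => ?_, by simp⟩
    have h00 := hb 0 0 i
    rw [sub_self] at h00
    fin_cases r <;> fin_cases s
    · exact hb 0 0 i
    · exact hb 0 1 i
    · exact hb 1 0 i
    · simpa using h00
  · have h11 := (mem_endSections₀_iff.1 (hf i j)).2
    have h00 := he 0 0 i j
    ext r s
    fin_cases r <;> fin_cases s
    · exact he 0 0 i j
    · exact he 0 1 i j
    · exact he 1 0 i j
    · simp
      linear_combination h11 - h00

/-- The tangent space is the cokernel of the commutator map `H⁰(End₀ E) → H⁰(End₀ E (d))`, which is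
injective for a stable pair. -/
theorem finite_and_finrank_zariskiTangentSpace {m : ℤ} (hm : 0 ≤ m) {d : ℤ} {Φ : Mat}
    (hΦ : Φ ∈ endSections ![0, m] Set.univ d) (hs : IsStable ![0, m] d Φ) :
    Module.Finite ℂ (ZariskiTangentSpace ![0, m] d Φ) ∧
    Module.finrank ℂ (ZariskiTangentSpace ![0, m] d Φ) +
      Module.finrank ℂ (endSections₀ ![0, m] Set.univ 0) =
        Module.finrank ℂ (endSections₀ ![0, m] Set.univ d) := by
  set a : Fin 2 → ℤ := ![0, m] with ha
  set F := (trivialDeformations a d Φ).mkQ.comp (constantBundleDeformation a d Φ) with hF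
  have hsurj : Function.Surjective F := by
    intro y
    obtain ⟨x, rfl⟩ := Submodule.mkQ_surjective _ y
    obtain ⟨h₁, h₂, h₃, h₄⟩ := isDeformation_iff.1 x.2
    obtain ⟨b, hb, he⟩ := exists_endSections₀_sub_eq h₁ h₃
    -- gauging away the gluing matrices makes the local Higgs fields agree
    have hmem : ∀ i, x.1.2 i - (b i * Φ - Φ * b i) ∈ endSections₀ a (chart i) d := fun i =>
      sub_mem (h₂ i) ⟨sub_mem
        (endSections_mul_mem (zero_add d) (hb i).1
          fun k l => sections_mono (Set.subset_univ _) _ (hΦ k l))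
        (endSections_mul_mem (add_zero d)
          (fun k l => sections_mono (Set.subset_univ _) _ (hΦ k l)) (hb i).1), by
        rw [SetLike.mem_coe, LinearMap.mem_ker, Matrix.traceLinearMap_apply, Matrix.trace_sub,
          Matrix.trace_mul_comm, sub_self]⟩
    have heq : ∀ i, x.1.2 i - (b i * Φ - Φ * b i) = x.1.2 0 - (b 0 * Φ - Φ * b 0) := fun i => by
      have h := h₄ i 0
      rw [he, sub_mul, mul_sub] at h
      rw [sub_eq_iff_eq_add] at h
      rw [h]
      abel
    refine ⟨⟨x.1.2 0 - (b 0 * Φ - Φ * b 0), ⟨fun k l => mem_sections_univ_of_forall_chart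
      fun i => ?_, (hmem 0).2⟩⟩, ?_⟩
    · rw [← heq i]
      exact (hmem i).1 k l
    · rw [hF, LinearMap.comp_apply, Submodule.mkQ_apply, Submodule.mkQ_apply, eq_comm,
        Submodule.Quotient.eq, mem_trivialDeformations_iff]
      refine ⟨b, hb, fun i j => ?_, fun i => ?_⟩
      · rw [← he]
        exact sub_zero _
      · change x.1.2 i - (x.1.2 0 - (b 0 * Φ - Φ * b 0)) = _
        rw [← heq i, sub_sub_cancel]
  have hker : LinearMap.ker F = LinearMap.range (commutatorMap a hΦ) := by
    ext φ
    rw [LinearMap.mem_ker, hF, LinearMap.comp_apply, Submodule.mkQ_apply,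
      Submodule.Quotient.mk_eq_zero, mem_trivialDeformations_iff, LinearMap.mem_range]
    constructor
    · rintro ⟨b, hb, h₁, h₂⟩
      have hb0 : ∀ i, b i = b 0 := fun i => by
        have : (0 : Mat) = b i - b 0 := h₁ i 0
        exact sub_eq_zero.1 this.symm
      refine ⟨⟨b 0, fun k l => mem_sections_univ_of_forall_chart fun i => ?_, (hb 0).2⟩, ?_⟩
      · rw [← hb0 i]
        exact (hb i).1 k l
      · exact Subtype.ext (h₂ 0).symm
    · rintro ⟨b, rfl⟩
      refine ⟨fun _ => b.1, fun i =>
        ⟨fun k l => sections_mono (Set.subset_univ _) _ (b.2.1 k l), b.2.2⟩, fun i j => ?_,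
        fun i => rfl⟩
      rw [sub_self]
      rfl
  have hinj : Function.Injective (commutatorMap a hΦ) := by
    rw [injective_iff_map_eq_zero]
    intro b hb
    exact Subtype.ext (eq_zero_of_commute_of_isStable hm hΦ hs b.2
      (sub_eq_zero.1 (congrArg Subtype.val hb)))
  have hfin : Module.Finite ℂ (ZariskiTangentSpace a d Φ) := Module.Finite.of_surjective F hsurj
  refine ⟨hfin, ?_⟩
  have h1 := LinearMap.finrank_range_add_finrank_ker F
  rw [LinearMap.range_eq_top.2 hsurj, finrank_top, hker, LinearMap.finrank_range_of_inj hinj] at h1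
  exact h1

/-! ### The Zariski topology of a vector space -/

section Zariski

variable {V : Type} [AddCommGroup V] [Module ℂ V]

lemma dual_mem_polyFunctions (l : Module.Dual ℂ V) : (fun v => l v) ∈ polyFunctions V :=
  Algebra.subset_adjoin ⟨l, rfl⟩

lemma const_mem_polyFunctions (c : ℂ) : (fun _ : V => c) ∈ polyFunctions V :=
  (polyFunctions V).algebraMap_mem c

lemma polyFunctions_comp_linearMap {W : Type} [AddCommGroup W] [Module ℂ W] (A : V →ₗ[ℂ] W)
    {f : W → ℂ} (hf : f ∈ polyFunctions W) : f ∘ A ∈ polyFunctions V := by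
  refine Algebra.adjoin_induction (p := fun f _ => f ∘ A ∈ polyFunctions V) ?_ ?_ ?_ ?_ hf
  · rintro _ ⟨l, rfl⟩
    exact dual_mem_polyFunctions (l.comp A)
  · intro c
    exact const_mem_polyFunctions c
  · intro f g _ _ hf hg
    exact add_mem hf hg
  · intro f g _ _ hf hg
    exact mul_mem hf hg

lemma continuous_zariski {W : Type} [AddCommGroup W] [Module ℂ W] (A : V →ₗ[ℂ] W) :
    @Continuous V W (zariskiTopology V) (zariskiTopology W) A := by
  let _ := zariskiTopology V
  let _ := zariskiTopology W
  refine continuous_generateFrom_iff.2 ?_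
  rintro _ ⟨f, rfl⟩
  exact TopologicalSpace.isOpen_generateFrom_of_mem ⟨⟨_, polyFunctions_comp_linearMap A f.2⟩, rfl⟩

lemma bilin_mem_polyFunctions [Module.Finite ℂ V] (β : V →ₗ[ℂ] V →ₗ[ℂ] ℂ) :
    (fun v => β v v) ∈ polyFunctions V := by
  let b := Module.finBasis ℂ V
  have : (fun v => β v v) = ∑ i, (fun v => b.coord i v) * fun v => β (b i) v := by
    ext v
    have h : β v v = β (∑ i, b.repr v i • b i) v := by rw [b.sum_repr]
    rw [h]
    simp [-Module.Basis.sum_repr]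
  rw [this]
  exact sum_mem fun i _ => mul_mem (dual_mem_polyFunctions _) (dual_mem_polyFunctions _)

lemma polyFunctions_eq_range (n : ℕ) (b : Module.Basis (Fin n) ℂ V) :
    polyFunctions V =
      (MvPolynomial.aeval (R := ℂ) fun (i : Fin n) (v : V) => b.coord i v).range := by
  rw [← Algebra.adjoin_range_eq_range_aeval]
  apply le_antisymm
  · refine Algebra.adjoin_le ?_
    rintro _ ⟨l, rfl⟩
    have : (fun v => l v) = ∑ i, l (b i) • fun v => b.coord i v := by
      ext v
      have h : l v = l (∑ i, b.repr v i • b i) := by rw [b.sum_repr]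
      rw [h]
      simp [-Module.Basis.sum_repr, mul_comm]
    change (fun v => l v) ∈ _
    rw [this]
    exact sum_mem fun i _ => Subalgebra.smul_mem _ (Algebra.subset_adjoin (Set.mem_range_self i)) _
  · refine Algebra.adjoin_mono ?_
    rintro _ ⟨i, rfl⟩
    exact ⟨b.coord i, rfl⟩

lemma isTopologicalBasis_zariski :
    @TopologicalSpace.IsTopologicalBasis V (zariskiTopology V)
      (Set.range fun (f : polyFunctions V) => {v : V | (f : V → ℂ) v ≠ 0}) := by
  let _ := zariskiTopology V
  refine ⟨?_, ?_, rfl⟩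
  · rintro _ ⟨f, rfl⟩ _ ⟨g, rfl⟩ v hv
    refine ⟨_, ⟨f * g, rfl⟩, ?_, ?_⟩
    · exact mul_ne_zero hv.1 hv.2
    · intro w hw
      exact ⟨left_ne_zero_of_mul hw, right_ne_zero_of_mul hw⟩
  · refine Set.eq_univ_of_forall fun v => ?_
    exact ⟨_, ⟨1, rfl⟩, one_ne_zero (α := ℂ)⟩

lemma isClosed_zariski {f : V → ℂ} (hf : f ∈ polyFunctions V) :
    @IsClosed V (zariskiTopology V) {v | f v = 0} := by
  let _ := zariskiTopology V
  rw [← isOpen_compl_iff]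
  exact isTopologicalBasis_zariski.isOpen ⟨⟨f, hf⟩, rfl⟩

/-- The vector space embeds into the spectrum of the polynomial ring, as the set of closed points
with its subspace topology. -/
theorem topologicalKrullDim_zariski_le [Module.Finite ℂ V] :
    @topologicalKrullDim V (zariskiTopology V) ≤ (Module.finrank ℂ V : ℕ) := by
  let _ := zariskiTopology V
  set n := Module.finrank ℂ V
  let b : Module.Basis (Fin n) ℂ V := Module.finBasis ℂ V
  let φ : V → PrimeSpectrum (MvPolynomial (Fin n) ℂ) := fun v =>
    ⟨RingHom.ker (MvPolynomial.eval fun i => b.coord i v), RingHom.ker_isPrime _⟩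
  have hφ : Topology.IsInducing φ := by
    refine ⟨?_⟩
    change zariskiTopology V = _
    rw [PrimeSpectrum.isTopologicalBasis_basic_opens.eq_generateFrom, induced_generateFrom_eq,
      zariskiTopology, ← Set.range_comp]
    congr 1
    have key : ∀ (P : MvPolynomial (Fin n) ℂ) (v : V),
        (MvPolynomial.aeval (R := ℂ) (fun (i : Fin n) (v : V) => b.coord i v) P) v =
          MvPolynomial.eval (fun i => b.coord i v) P := by
      intro P v
      have h1 := MvPolynomial.comp_aeval (R := ℂ) (fun (i : Fin n) (v : V) => b.coord i v)
        (Pi.evalAlgHom ℂ (fun _ : V => ℂ) v)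
      exact DFunLike.congr_fun h1 P
    ext s
    constructor
    · rintro ⟨⟨f, hf⟩, rfl⟩
      rw [polyFunctions_eq_range n b] at hf
      obtain ⟨P, rfl⟩ := hf
      refine ⟨P, ?_⟩
      ext v
      change MvPolynomial.eval (fun i => b.coord i v) P ≠ 0 ↔ _
      rw [← key]
      rfl
    · rintro ⟨P, rfl⟩
      refine ⟨⟨MvPolynomial.aeval (R := ℂ) (fun (i : Fin n) (v : V) => b.coord i v) P, ?_⟩, ?_⟩
      · rw [polyFunctions_eq_range n b]
        exact ⟨P, rfl⟩
      · ext v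
        change MvPolynomial.aeval (R := ℂ) (fun (i : Fin n) (v : V) => b.coord i v) P v ≠ 0 ↔
          MvPolynomial.eval (fun i => b.coord i v) P ≠ 0
        rw [← key]
  refine hφ.topologicalKrullDim_le.trans ?_
  rw [PrimeSpectrum.topologicalKrullDim_eq_ringKrullDim,
    MvPolynomial.ringKrullDim_of_isNoetherianRing, ringKrullDim_eq_zero_of_field]
  simp

/-- The map `γ`, considered only where `h ≠ 0`, is a rational curve in the vector space `V`: each
linear functional of it is a polynomial divided by a power of `h`. -/
def IsRationalCurve (h : Polynomial ℂ) (γ : ℂ → V) : Prop :=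
  ∀ l : Module.Dual ℂ V, ∃ (p : Polynomial ℂ) (k : ℕ),
    ∀ t, h.eval t ≠ 0 → l (γ t) * h.eval t ^ k = p.eval t

lemma IsRationalCurve.comp_polyFunction {h : Polynomial ℂ} {γ : ℂ → V} (hγ : IsRationalCurve h γ)
    {f : V → ℂ} (hf : f ∈ polyFunctions V) : ∃ (p : Polynomial ℂ) (k : ℕ),
    ∀ t, h.eval t ≠ 0 → f (γ t) * h.eval t ^ k = p.eval t := by
  refine Algebra.adjoin_induction (p := fun f _ => ∃ (p : Polynomial ℂ) (k : ℕ),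
    ∀ t, h.eval t ≠ 0 → f (γ t) * h.eval t ^ k = p.eval t) ?_ ?_ ?_ ?_ hf
  · rintro _ ⟨l, rfl⟩
    exact hγ l
  · intro c
    exact ⟨Polynomial.C c, 0, fun t _ => by simp⟩
  · rintro f g _ _ ⟨p, k, hp⟩ ⟨q, k', hq⟩
    refine ⟨p * h ^ k' + q * h ^ k, k + k', fun t ht => ?_⟩
    rw [Polynomial.eval_add, Polynomial.eval_mul, Polynomial.eval_mul, ← hp t ht, ← hq t ht,
      Polynomial.eval_pow, Polynomial.eval_pow, Pi.add_apply]
    ring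
  · rintro f g _ _ ⟨p, k, hp⟩ ⟨q, k', hq⟩
    refine ⟨p * q, k + k', fun t ht => ?_⟩
    rw [Polynomial.eval_mul, ← hp t ht, ← hq t ht, Pi.mul_apply]
    ring

lemma isRationalCurve_line (h : Polynomial ℂ) (v w : V) :
    IsRationalCurve h fun t => v + t • w := fun l =>
  ⟨Polynomial.C (l v) + Polynomial.X * Polynomial.C (l w), 0, fun t _ => by simp; ring⟩

end Zariski

/-! ### Irreducible sets of stable Higgs fields -/

section Irreducible

variable {a : Fin 2 → ℤ} {d : ℤ}

lemma isClosed_stableHiggs {f : higgsFields a d → ℂ} (hf : f ∈ polyFunctions (higgsFields a d)) :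
    IsClosed {Φ : StableHiggs a d | f Φ.1 = 0} := by
  let _ := zariskiTopology (higgsFields a d)
  exact (isClosed_zariski hf).preimage continuous_induced_dom

lemma exists_polyFunction_of_isOpen {U : Set (StableHiggs a d)} (hU : IsOpen U)
    {Φ : StableHiggs a d} (hΦ : Φ ∈ U) : ∃ f ∈ polyFunctions (higgsFields a d), f Φ.1 ≠ 0 ∧
      ∀ Ψ : StableHiggs a d, f Ψ.1 ≠ 0 → Ψ ∈ U := by
  let _ := zariskiTopology (higgsFields a d)
  obtain ⟨U', hU', rfl⟩ := isOpen_induced_iff.1 hU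
  obtain ⟨_, ⟨f, rfl⟩, hf, hsub⟩ :=
    (isTopologicalBasis_zariski (V := higgsFields a d)).exists_subset_of_mem_open (a := Φ.1) hΦ hU'
  exact ⟨f, f.2, hf, fun Ψ hΨ => hsub hΨ⟩

/-- A set of stable Higgs fields is irreducible if any two of its points lie on a rational curve
inside it. -/
theorem isIrreducible_of_rationalCurves {T : Set (StableHiggs a d)} (hne : T.Nonempty)
    (hT : ∀ Φ ∈ T, ∀ Ψ ∈ T, ∃ (h : Polynomial ℂ) (γ : ℂ → higgsFields a d),
      IsRationalCurve h γ ∧ (∀ t, h.eval t ≠ 0 → ∃ Θ ∈ T, Θ.1 = γ t) ∧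
      (∃ t, h.eval t ≠ 0 ∧ γ t = Φ.1) ∧ ∃ t, h.eval t ≠ 0 ∧ γ t = Ψ.1) :
    IsIrreducible T := by
  refine ⟨hne, fun U U' hU hU' => ?_⟩
  rintro ⟨Φ, hΦ, hΦU⟩ ⟨Ψ, hΨ, hΨU⟩
  obtain ⟨f, hf, hfΦ, hfU⟩ := exists_polyFunction_of_isOpen hU hΦU
  obtain ⟨g, hg, hgΨ, hgU⟩ := exists_polyFunction_of_isOpen hU' hΨU
  obtain ⟨h, γ, hγ, hmem, ⟨t₀, ht₀, e₀⟩, ⟨t₁, ht₁, e₁⟩⟩ := hT Φ hΦ Ψ hΨ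
  obtain ⟨p, k, hp⟩ := hγ.comp_polyFunction hf
  obtain ⟨q, k', hq⟩ := hγ.comp_polyFunction hg
  have hp0 : p ≠ 0 := by
    rintro rfl
    have := hp t₀ ht₀
    rw [e₀, Polynomial.eval_zero] at this
    exact mul_ne_zero hfΦ (pow_ne_zero _ ht₀) this
  have hq0 : q ≠ 0 := by
    rintro rfl
    have := hq t₁ ht₁
    rw [e₁, Polynomial.eval_zero] at this
    exact mul_ne_zero hgΨ (pow_ne_zero _ ht₁) this
  have hh0 : h ≠ 0 := by
    rintro rfl
    exact ht₀ Polynomial.eval_zero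
  obtain ⟨t, ht⟩ : ∃ t, (h * (p * q)).eval t ≠ 0 := by
    by_contra! hall
    exact mul_ne_zero hh0 (mul_ne_zero hp0 hq0) (Polynomial.funext fun t => by simpa using hall t)
  rw [Polynomial.eval_mul, Polynomial.eval_mul] at ht
  have hth := left_ne_zero_of_mul ht
  have htp := left_ne_zero_of_mul (right_ne_zero_of_mul ht)
  have htq := right_ne_zero_of_mul (right_ne_zero_of_mul ht)
  obtain ⟨Θ, hΘ, e⟩ := hmem t hth
  refine ⟨Θ, hΘ, hfU Θ ?_, hgU Θ ?_⟩
  · rw [e]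
    exact left_ne_zero_of_mul (hp t hth ▸ htp)
  · rw [e]
    exact left_ne_zero_of_mul (hq t hth ▸ htq)

theorem topologicalKrullDim_stableHiggs_le :
    topologicalKrullDim (StableHiggs a d) ≤ (Module.finrank ℂ (higgsFields a d) : ℕ) := by
  let _ := zariskiTopology (higgsFields a d)
  have h : Topology.IsInducing (Subtype.val : StableHiggs a d → higgsFields a d) := ⟨rfl⟩
  exact h.topologicalKrullDim_le.trans topologicalKrullDim_zariski_le

end Irreducible

/-! ### Heights in partially ordered sets -/

section Height

open Order

/-- If `f` is strictly monotone on the interval `[L, L']` of subspaces, then the height of `f L'`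
exceeds that of `f L` by at least `dim L' - dim L`. -/
lemma height_add_finrank_le {V : Type*} [AddCommGroup V] [Module ℂ V] [Module.Finite ℂ V]
    {Y : Type*} [Preorder Y] (f : Submodule ℂ V → Y) {L L' : Submodule ℂ V} (hLL' : L ≤ L')
    (hf : ∀ L₁ L₂, L ≤ L₁ → L₁ < L₂ → L₂ ≤ L' → f L₁ < f L₂) :
    height (f L) + (Module.finrank ℂ L' : ℕ) ≤ height (f L') + (Module.finrank ℂ L : ℕ) := by
  induction hn : Module.finrank ℂ L' - Module.finrank ℂ L generalizing L with
  | zero =>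
    have : L = L' := Submodule.eq_of_le_of_finrank_le hLL' (by omega)
    rw [this]
  | succ n ih =>
    have hlt : L < L' := lt_of_le_of_ne hLL' (by rintro rfl; simp at hn)
    obtain ⟨v, hv', hv⟩ := SetLike.exists_of_lt hlt
    set L₁ := L ⊔ Submodule.span ℂ {v} with hL₁
    have h1 : L < L₁ := lt_of_le_of_ne le_sup_left fun h => hv (by
      rw [h]
      exact Submodule.mem_sup_right (Submodule.mem_span_singleton_self v))
    have h2 : L₁ ≤ L' := sup_le hLL' (by simpa using hv')
    have h3 : Module.finrank ℂ L₁ ≤ Module.finrank ℂ L + 1 := by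
      refine (Submodule.finrank_add_le_finrank_add_finrank _ _).trans ?_
      gcongr
      exact (finrank_span_le_card ({v} : Set V)).trans (by simp)
    have h4 : Module.finrank ℂ L < Module.finrank ℂ L₁ := Submodule.finrank_lt_finrank_of_lt h1
    have h5 : Module.finrank ℂ L₁ = Module.finrank ℂ L + 1 := by omega
    have := ih h2 (fun M₁ M₂ h h' h'' => hf M₁ M₂ (h1.le.trans h) h' h'') (by omega)
    have h6 := height_add_one_le (hf L L₁ le_rfl h1 h2)
    rw [h5] at this
    push_cast at this
    have h7 : height (f L) + 1 + (Module.finrank ℂ L' : ℕ) ≤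
        height (f L') + (Module.finrank ℂ L : ℕ) + 1 := by
      calc height (f L) + 1 + (Module.finrank ℂ L' : ℕ)
          ≤ height (f L₁) + (Module.finrank ℂ L' : ℕ) := by gcongr
        _ ≤ _ := by rw [add_assoc]; exact this
    rw [add_right_comm] at h7
    exact (ENat.add_le_add_iff_right ENat.one_ne_top).1 h7

/-- If every value of a strictly monotone map has height at least `k`, then the dimension of the
target exceeds that of the source by at least `k`. -/
lemma krullDim_add_le_of_strictMono {α β : Type*} [Preorder α] [Preorder β] {f : α → β}
    (hf : StrictMono f) {k n : ℕ} (hk : ∀ x, (k : ℕ∞) ≤ height (f x))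
    (hn : krullDim β ≤ ((n + k : ℕ) : WithBot ℕ∞)) : krullDim α ≤ (n : WithBot ℕ∞) := by
  have key : ∀ (r : ℕ) (p : LTSeries α), p.length = r → ((r + k : ℕ) : ℕ∞) ≤ height (f p.last) := by
    intro r
    induction r with
    | zero =>
      intro p _
      simpa using hk p.last
    | succ r ih =>
      intro p hp
      have h1 := ih p.eraseLast (by simp [hp])
      have h2 := height_add_one_le (hf (p.eraseLast_last_rel_last (by omega)))
      refine le_trans ?_ h2
      have : ((r + 1 + k : ℕ) : ℕ∞) = ((r + k : ℕ) : ℕ∞) + 1 := by push_cast; ring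
      rw [this]
      gcongr
  refine iSup_le fun p => ?_
  have h := (WithBot.coe_le_coe.2 (key p.length p rfl)).trans ((height_le_krullDim _).trans hn)
  have h' : ((p.length + k : ℕ) : ℕ∞) ≤ ((n + k : ℕ) : ℕ∞) := WithBot.coe_le_coe.1 h
  have h'' : p.length ≤ n := by
    have : p.length + k ≤ n + k := by exact_mod_cast h'
    omega
  exact_mod_cast h''

end Height

/-! ### The action of the automorphism group -/

section Action

variable {a : Fin 2 → ℤ} {d : ℤ}

lemma det_mem_sections {g : Mat} (hg : g ∈ endSections a Set.univ 0) :
    g.det ∈ sections Set.univ 0 := by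
  rw [Matrix.det_fin_two]
  exact sub_mem (sections_mul_mem (by ring) (hg 0 0) (hg 1 1))
    (sections_mul_mem (by ring) (hg 0 1) (hg 1 0))

lemma adjugate_mem_endSections {g : Mat} (hg : g ∈ endSections a Set.univ 0) :
    g.adjugate ∈ endSections a Set.univ 0 := by
  rw [Matrix.adjugate_fin_two]
  intro i j
  have h00 := hg 0 0
  have h11 := hg 1 1
  rw [sub_self] at h00 h11
  fin_cases i <;> fin_cases j
  · simpa using h11
  · simpa using neg_mem (hg 0 1)
  · simpa using neg_mem (hg 1 0)
  · simpa using h00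

/-- An endomorphism of `E` is invertible if its determinant, a constant, is non-zero. -/
lemma exists_mem_autGroup {g : Mat} (hg : g ∈ endSections a Set.univ 0) (hd : g.det ≠ 0) :
    ∃ u ∈ autGroup a, (u : Mat) = g := by
  have hu : IsUnit g.det := isUnit_iff_ne_zero.2 hd
  refine ⟨g.nonsingInvUnit hu, ⟨hg, ?_⟩, rfl⟩
  change g⁻¹ ∈ _
  obtain ⟨c, hc⟩ := mem_sections_univ_zero.1 (det_mem_sections hg)
  have : g⁻¹ = c⁻¹ • g.adjugate := by
    rw [Matrix.inv_def, Ring.inverse_eq_inv', hc, ← map_inv₀, algebraMap_smul]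
  rw [this]
  exact Submodule.smul_mem _ _ (adjugate_mem_endSections hg)

lemma IsStable.conj {Φ : Mat} (h : IsStable a d Φ) {g : Matˣ} (hg : g ∈ autGroup a) :
    IsStable a d ((g : Mat) * Φ * ((g⁻¹ : Matˣ) : Mat)) := by
  intro k s lam hs hsec hlam he
  refine h k (((g⁻¹ : Matˣ) : Mat).mulVec s) lam ?_ ?_ hlam ?_
  · intro h0
    apply hs
    have := congrArg (g : Mat).mulVec h0
    rwa [Matrix.mulVec_mulVec, Units.mul_inv, Matrix.one_mulVec, Matrix.mulVec_zero] at this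
  · intro i
    change ∑ j : Fin 2, _ * _ ∈ sections Set.univ (a i - k)
    refine Submodule.sum_mem _ fun j _ => ?_
    exact sections_mul_mem (by ring) (hg.2 i j) (hsec j)
  · have := congrArg ((g⁻¹ : Matˣ) : Mat).mulVec he
    rw [Matrix.mulVec_mulVec, Matrix.mulVec_smul, mul_assoc, ← mul_assoc, Units.inv_mul,
      one_mul] at this
    rw [Matrix.mulVec_mulVec, this]

/-- Conjugation by an automorphism of `E`, as a linear map on Higgs fields. -/
def conjHiggs (d : ℤ) {g : Matˣ} (hg : g ∈ autGroup a) : higgsFields a d →ₗ[ℂ] higgsFields a d where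
  toFun Φ := ⟨(g : Mat) * Φ.1 * ((g⁻¹ : Matˣ) : Mat), endSections_mul_mem (add_zero d)
    (endSections_mul_mem (zero_add d) hg.1 Φ.2) hg.2⟩
  map_add' Φ Ψ := Subtype.ext (by simp [mul_add, add_mul])
  map_smul' c Φ := Subtype.ext (by simp)

/-- Conjugation by an automorphism of `E`, on stable Higgs fields. -/
def conjStable {g : Matˣ} (hg : g ∈ autGroup a) (Φ : StableHiggs a d) : StableHiggs a d :=
  ⟨conjHiggs d hg Φ.1, Φ.2.conj hg⟩

lemma continuous_conjStable {g : Matˣ} (hg : g ∈ autGroup a) :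
    Continuous (conjStable hg : StableHiggs a d → StableHiggs a d) := by
  let _ := zariskiTopology (higgsFields a d)
  exact continuous_induced_rng.2 ((continuous_zariski (conjHiggs d hg)).comp continuous_induced_dom)

/-- The quotient map from stable Higgs fields to their conjugacy classes. -/
def conjClass (Φ : StableHiggs a d) : StableHiggsModConj a d := Quotient.mk (conjSetoid a d) Φ

lemma conjClass_eq_iff {Φ Ψ : StableHiggs a d} : conjClass Φ = conjClass Ψ ↔
    ∃ g ∈ autGroup a, (Ψ.1 : Mat) = (g : Mat) * (Φ.1 : Mat) * ((g⁻¹ : Matˣ) : Mat) :=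
  Quotient.eq (r := conjSetoid a d)

lemma conjClass_conjStable {g : Matˣ} (hg : g ∈ autGroup a) (Φ : StableHiggs a d) :
    conjClass (conjStable hg Φ) = conjClass Φ :=
  (conjClass_eq_iff.2 ⟨g, hg, rfl⟩).symm

lemma conjClass_surjective : Function.Surjective (conjClass (a := a) (d := d)) :=
  Quotient.mk_surjective

lemma isQuotientMap_conjClass : Topology.IsQuotientMap (conjClass (a := a) (d := d)) :=
  isQuotientMap_quotient_mk'

lemma isOpenMap_conjClass : IsOpenMap (conjClass (a := a) (d := d)) := by
  intro U hU
  rw [← isQuotientMap_conjClass.isOpen_preimage]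
  have : conjClass ⁻¹' (conjClass '' U) =
      ⋃ (g : Matˣ) (hg : g ∈ autGroup a), conjStable (d := d) hg ⁻¹' U := by
    ext Φ
    simp only [Set.mem_preimage, Set.mem_image, Set.mem_iUnion]
    constructor
    · rintro ⟨Ψ, hΨ, he⟩
      obtain ⟨g, hg, e⟩ := conjClass_eq_iff.1 he.symm
      refine ⟨g, hg, ?_⟩
      have : conjStable hg Φ = Ψ := Subtype.ext (Subtype.ext e.symm)
      rwa [this]
    · rintro ⟨g, hg, h⟩
      exact ⟨_, h, conjClass_conjStable hg Φ⟩
  rw [this]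
  exact isOpen_iUnion fun g => isOpen_iUnion fun hg => hU.preimage (continuous_conjStable hg)

/-- A set of stable Higgs fields is irreducible if any two of its elements are conjugate to the same
`Θ` by members of a pencil of endomorphisms of `E`, the invertible members of which conjugate `Θ`
into the set. -/
theorem isIrreducible_of_pencils {T : Set (StableHiggs a d)} (hne : T.Nonempty)
    (hT : ∀ Φ ∈ T, ∀ Ψ ∈ T, ∃ (Θ : higgsFields a d) (g₀ g₁ : Mat),
      g₀ ∈ endSections a Set.univ 0 ∧ g₁ ∈ endSections a Set.univ 0 ∧
      (∀ t : ℂ, (g₀ + t • g₁).det ≠ 0 →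
        ∃ Ξ ∈ T, (Ξ.1 : Mat) * (g₀ + t • g₁) = (g₀ + t • g₁) * Θ) ∧
      (∃ t : ℂ, (g₀ + t • g₁).det ≠ 0 ∧ (Φ.1 : Mat) * (g₀ + t • g₁) = (g₀ + t • g₁) * Θ) ∧
      ∃ t : ℂ, (g₀ + t • g₁).det ≠ 0 ∧ (Ψ.1 : Mat) * (g₀ + t • g₁) = (g₀ + t • g₁) * Θ) :
    IsIrreducible T := by
  refine isIrreducible_of_rationalCurves hne fun Φ hΦ Ψ hΨ => ?_
  obtain ⟨Θ, g₀, g₁, h₀, h₁, hmem, ⟨t₀, hd₀, e₀⟩, ⟨t₁, hd₁, e₁⟩⟩ := hT Φ hΦ Ψ hΨ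
  obtain ⟨c₀, hc₀⟩ := mem_sections_univ_zero.1 (det_mem_sections h₀)
  obtain ⟨c₁, hc₁⟩ := mem_sections_univ_zero.1 (det_mem_sections h₁)
  obtain ⟨c₂, hc₂⟩ := mem_sections_univ_zero.1 (det_mem_sections (add_mem h₀ h₁))
  -- the determinant along the pencil
  let h : Polynomial ℂ := Polynomial.C c₀ + Polynomial.C (c₂ - c₀ - c₁) * Polynomial.X +
    Polynomial.C c₁ * Polynomial.X ^ 2
  have hdet : ∀ t : ℂ, (g₀ + t • g₁).det = algebraMap ℂ RatField (h.eval t) := by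
    intro t
    have e : h.eval t = c₀ + (c₂ - c₀ - c₁) * t + c₁ * t ^ 2 := by simp [h]
    rw [e, map_add, map_add, map_mul, map_mul, map_sub, map_sub, ← hc₀, ← hc₁, ← hc₂, map_pow]
    simp only [Matrix.det_fin_two, Matrix.add_apply, Matrix.smul_apply]
    simp only [Algebra.smul_def]
    ring
  have hne : ∀ t : ℂ, (g₀ + t • g₁).det ≠ 0 ↔ h.eval t ≠ 0 := fun t => by
    rw [hdet, Ne, Ne, map_eq_zero]
  have hmul : ∀ {M N : Mat}, M ∈ endSections a Set.univ 0 → N ∈ endSections a Set.univ 0 →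
      M * Θ.1 * N ∈ higgsFields a d := fun hM hN =>
    endSections_mul_mem (add_zero d) (endSections_mul_mem (zero_add d) hM Θ.2) hN
  -- the conjugate of `Θ` along the pencil is a quadratic polynomial divided by the determinant
  let M₀ : higgsFields a d := ⟨g₀ * Θ.1 * g₀.adjugate, hmul h₀ (adjugate_mem_endSections h₀)⟩
  let M₁ : higgsFields a d := ⟨g₀ * Θ.1 * g₁.adjugate + g₁ * Θ.1 * g₀.adjugate,
    add_mem (hmul h₀ (adjugate_mem_endSections h₁)) (hmul h₁ (adjugate_mem_endSections h₀))⟩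
  let M₂ : higgsFields a d := ⟨g₁ * Θ.1 * g₁.adjugate, hmul h₁ (adjugate_mem_endSections h₁)⟩
  have hadj : ∀ t : ℂ, (g₀ + t • g₁) * Θ.1 * (g₀ + t • g₁).adjugate =
      (M₀ + t • M₁ + t ^ 2 • M₂ : higgsFields a d) := by
    intro t
    have : (g₀ + t • g₁).adjugate = g₀.adjugate + t • g₁.adjugate := by
      ext i j
      fin_cases i <;> fin_cases j <;> simp [Matrix.adjugate_fin_two, add_comm]
    rw [this]
    simp only [Submodule.coe_add, Submodule.coe_smul, M₀, M₁, M₂, add_mul, mul_add, smul_mul_assoc,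
      mul_smul_comm, smul_add, smul_smul, pow_two]
    abel
  have key : ∀ (Ξ : higgsFields a d) (t : ℂ), (g₀ + t • g₁).det ≠ 0 →
      (Ξ : Mat) * (g₀ + t • g₁) = (g₀ + t • g₁) * Θ →
      Ξ = (h.eval t)⁻¹ • (M₀ + t • M₁ + t ^ 2 • M₂) := by
    intro Ξ t ht e
    rw [eq_inv_smul_iff₀ ((hne t).1 ht)]
    apply Subtype.ext
    rw [← hadj, ← e, mul_assoc, Matrix.mul_adjugate, hdet, Submodule.coe_smul, mul_smul_comm,
      mul_one, algebraMap_smul]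
  refine ⟨h, fun t => (h.eval t)⁻¹ • (M₀ + t • M₁ + t ^ 2 • M₂), fun l => ?_, fun t ht => ?_,
    ⟨t₀, (hne t₀).1 hd₀, (key _ t₀ hd₀ e₀).symm⟩, ⟨t₁, (hne t₁).1 hd₁, (key _ t₁ hd₁ e₁).symm⟩⟩
  · refine ⟨Polynomial.C (l M₀) + Polynomial.C (l M₁) * Polynomial.X +
      Polynomial.C (l M₂) * Polynomial.X ^ 2, 1, fun t ht => ?_⟩
    simp only [map_smul, map_add, smul_eq_mul, Polynomial.eval_add, Polynomial.eval_mul,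
      Polynomial.eval_C, Polynomial.eval_X, Polynomial.eval_pow, pow_one]
    field_simp
  · obtain ⟨Ξ, hΞ, e⟩ := hmem t ((hne t).2 ht)
    exact ⟨Ξ, hΞ, key _ t ((hne t).2 ht) e⟩

/-- Conjugacy classes are irreducible, because the invertible members of the pencil spanned by two
automorphisms of `E` are automorphisms. -/
lemma isIrreducible_fiber (Φ : StableHiggs a d) :
    IsIrreducible {Ψ : StableHiggs a d | conjClass Ψ = conjClass Φ} := by
  refine isIrreducible_of_pencils ⟨Φ, rfl⟩ fun Ψ hΨ Ψ' hΨ' => ?_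
  obtain ⟨g, hg, e⟩ := conjClass_eq_iff.1 (Eq.symm hΨ)
  obtain ⟨g', hg', e'⟩ := conjClass_eq_iff.1 (Eq.symm hΨ')
  have hd : ∀ u : Matˣ, (u : Mat).det ≠ 0 := fun u =>
    ((Matrix.isUnit_iff_isUnit_det _).1 u.isUnit).ne_zero
  refine ⟨Φ.1, g, (g' : Mat) - g, hg.1, sub_mem hg'.1 hg.1, fun t ht => ?_, ⟨0, ?_, ?_⟩,
    ⟨1, ?_, ?_⟩⟩
  · obtain ⟨u, hu, hut⟩ := exists_mem_autGroup
      (add_mem hg.1 (Submodule.smul_mem _ t (sub_mem hg'.1 hg.1))) ht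
    refine ⟨conjStable hu Φ, conjClass_conjStable hu Φ, ?_⟩
    rw [← hut]
    change (u : Mat) * (Φ.1 : Mat) * ((u⁻¹ : Matˣ) : Mat) * u = _
    rw [mul_assoc, Units.inv_mul, mul_one]
  · simpa using hd g
  · rw [zero_smul, add_zero, e, mul_assoc, Units.inv_mul, mul_one]
  · simpa using hd g'
  · rw [one_smul, add_sub_cancel, e', mul_assoc, Units.inv_mul, mul_one]

/-! ### Chains of irreducible closed sets in the quotient -/

/-- The closure of an irreducible set of stable Higgs fields. -/
def irredClosure {T : Set (StableHiggs a d)} (hT : IsIrreducible T) :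
    TopologicalSpace.IrreducibleCloseds (StableHiggs a d) :=
  ⟨closure T, hT.closure, isClosed_closure⟩

lemma irredClosure_lt {T T' : Set (StableHiggs a d)} (hT : IsIrreducible T)
    (hT' : IsIrreducible T') (hsub : T ⊆ T') {K : Set (StableHiggs a d)} (hK : IsClosed K)
    (hTK : T ⊆ K) {Φ : StableHiggs a d} (hΦ : Φ ∈ T') (hΦK : Φ ∉ K) :
    irredClosure hT < irredClosure hT' := by
  refine lt_of_le_of_ne (closure_mono hsub : closure T ⊆ closure T') fun h => hΦK ?_
  have h1 : closure T = closure T' :=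
    congrArg TopologicalSpace.IrreducibleCloseds.carrier h
  exact closure_minimal hTK hK (h1 ▸ subset_closure hΦ)

/-- The closure of the image of an irreducible set in the space of conjugacy classes. -/
def irredClosureImage {T : Set (StableHiggs a d)} (hT : IsIrreducible T) :
    TopologicalSpace.IrreducibleCloseds (StableHiggsModConj a d) :=
  ⟨closure (conjClass '' T),
    (hT.image _ isQuotientMap_conjClass.continuous.continuousOn).closure, isClosed_closure⟩

/-- To separate the closures of the images of `T ⊆ T'` it suffices to find a closed set of stable
Higgs fields, saturated under conjugation, which contains `T` but not `T'`. -/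
lemma irredClosureImage_lt {T T' : Set (StableHiggs a d)} (hT : IsIrreducible T)
    (hT' : IsIrreducible T') (hsub : T ⊆ T') {K : Set (StableHiggs a d)} (hK : IsClosed K)
    (hinv : ∀ Φ Ψ : StableHiggs a d, conjClass Φ = conjClass Ψ → Φ ∈ K → Ψ ∈ K)
    (hTK : T ⊆ K) {Φ : StableHiggs a d} (hΦ : Φ ∈ T') (hΦK : Φ ∉ K) :
    irredClosureImage hT < irredClosureImage hT' := by
  have hpre : conjClass ⁻¹' (conjClass '' K) = K := by
    refine Set.Subset.antisymm ?_ (Set.subset_preimage_image _ _)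
    rintro Ψ ⟨Ξ, hΞ, e⟩
    exact hinv Ξ Ψ e hΞ
  have hcl : IsClosed (conjClass '' K) := by
    rw [← isQuotientMap_conjClass.isClosed_preimage, hpre]
    exact hK
  refine lt_of_le_of_ne (closure_mono (Set.image_mono hsub) :
    closure (conjClass '' T) ⊆ closure (conjClass '' T')) fun h => hΦK ?_
  have h1 : closure (conjClass '' T) = closure (conjClass '' T') :=
    congrArg TopologicalSpace.IrreducibleCloseds.carrier h
  rw [← hpre]
  exact closure_minimal (Set.image_mono hTK) hcl (h1 ▸ subset_closure ⟨Φ, hΦ, rfl⟩)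

/-- The preimage of an irreducible closed set of conjugacy classes.  It is irreducible, because
conjugacy classes are irreducible and the quotient map is open. -/
def preimageConjClass (Z : TopologicalSpace.IrreducibleCloseds (StableHiggsModConj a d)) :
    TopologicalSpace.IrreducibleCloseds (StableHiggs a d) :=
  ⟨conjClass ⁻¹' Z, by
    refine ⟨Z.isIrreducible.1.preimage conjClass_surjective,
      Z.isIrreducible.2.preimage_of_isPreirreducible_fiber conjClass isOpenMap_conjClass ?_⟩
    intro y
    obtain ⟨Φ, rfl⟩ := conjClass_surjective y
    exact (isIrreducible_fiber Φ).2, Z.isClosed.preimage isQuotientMap_conjClass.continuous⟩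

lemma strictMono_preimageConjClass :
    StrictMono (preimageConjClass (a := a) (d := d)) := by
  have hmono : Monotone (preimageConjClass (a := a) (d := d)) := fun Z Z' h Φ hΦ =>
    h (show conjClass Φ ∈ Z from hΦ)
  refine hmono.strictMono_of_injective fun Z Z' h => ?_
  have : conjClass ⁻¹' (Z : Set (StableHiggsModConj a d)) = conjClass ⁻¹' Z' :=
    congrArg TopologicalSpace.IrreducibleCloseds.carrier h
  exact SetLike.coe_injective (conjClass_surjective.preimage_injective this)

/-- If every conjugacy class contains an irreducible set whose closure has height at least `k` among
the irreducible closed sets, then the dimension of the quotient is at most that of the space of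
Higgs fields minus `k`.  Such chains inside the classes stand in for the fibre dimension. -/
theorem topologicalKrullDim_stableHiggsModConj_le {k n : ℕ}
    (hn : Module.finrank ℂ (higgsFields a d) = n + k)
    (hk : ∀ Φ : StableHiggs a d, ∃ (T : Set (StableHiggs a d)) (hT : IsIrreducible T),
      (∀ Ψ ∈ T, conjClass Ψ = conjClass Φ) ∧ (k : ℕ∞) ≤ Order.height (irredClosure hT)) :
    topologicalKrullDim (StableHiggsModConj a d) ≤ (n : WithBot ℕ∞) := by
  refine krullDim_add_le_of_strictMono strictMono_preimageConjClass (k := k) (fun Z => ?_)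
    (by rw [← hn]; exact topologicalKrullDim_stableHiggs_le)
  obtain ⟨q, hq⟩ := Z.isIrreducible.1
  obtain ⟨Φ, rfl⟩ := conjClass_surjective q
  obtain ⟨T, hT, hTΦ, hh⟩ := hk Φ
  refine hh.trans (Order.height_mono ?_)
  refine closure_minimal (fun Ψ hΨ => ?_) (preimageConjClass Z).isClosed
  change conjClass Ψ ∈ (Z : Set (StableHiggsModConj a d))
  rw [hTΦ Ψ hΨ]
  exact hq

end Action

/-! ### Affine pieces of the space of Higgs fields -/

section Tools

variable {a : Fin 2 → ℤ} {d : ℤ}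

lemma exists_mul_eq_mul {g : Mat} (hg : g ∈ endSections a Set.univ 0) (hd : g.det ≠ 0)
    (Φ : StableHiggs a d) : ∃ Ψ : StableHiggs a d, (Ψ.1 : Mat) * g = g * Φ.1 := by
  obtain ⟨u, hu, rfl⟩ := exists_mem_autGroup hg hd
  refine ⟨conjStable hu Φ, ?_⟩
  change (u : Mat) * (Φ.1 : Mat) * ((u⁻¹ : Matˣ) : Mat) * u = _
  rw [mul_assoc, Units.inv_mul, mul_one]

lemma conjClass_eq_of_mul_eq_mul {g : Mat} (hg : g ∈ endSections a Set.univ 0) (hd : g.det ≠ 0)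
    {Φ Ψ : StableHiggs a d} (h : (Ψ.1 : Mat) * g = g * Φ.1) : conjClass Ψ = conjClass Φ := by
  obtain ⟨u, hu, rfl⟩ := exists_mem_autGroup hg hd
  exact (conjClass_eq_iff.2 ⟨u, hu, by rw [← h, mul_assoc, Units.mul_inv, mul_one]⟩).symm

lemma exists_mul_eq_mul_of_conjClass_eq {Φ Ψ : StableHiggs a d} (h : conjClass Φ = conjClass Ψ) :
    ∃ g ∈ endSections a Set.univ 0, g.det ≠ 0 ∧ (Ψ.1 : Mat) * g = g * Φ.1 := by
  obtain ⟨u, hu, e⟩ := conjClass_eq_iff.1 h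
  exact ⟨u, hu.1, ((Matrix.isUnit_iff_isUnit_det _).1 u.isUnit).ne_zero, by
    rw [e, mul_assoc, Units.inv_mul, mul_one]⟩

/-- The entries of a Higgs field, as linear functions. -/
def entry (a : Fin 2 → ℤ) (d : ℤ) (i j : Fin 2) : higgsFields a d →ₗ[ℂ] RatField where
  toFun Φ := Φ.1 i j
  map_add' _ _ := rfl
  map_smul' _ _ := rfl

lemma isClosed_linear_mem {W : Type*} [AddCommGroup W] [Module ℂ W]
    (A : higgsFields a d →ₗ[ℂ] W) (M : Submodule ℂ W) :
    IsClosed {Φ : StableHiggs a d | A Φ.1 ∈ M} := by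
  have : {Φ : StableHiggs a d | A Φ.1 ∈ M} =
      ⋂ (l : Module.Dual ℂ W) (_ : M ≤ LinearMap.ker l), {Φ | l (A Φ.1) = 0} := by
    ext Φ
    simp only [Set.mem_ofPred_eq, Set.mem_iInter]
    constructor
    · exact fun h l hl => hl h
    · intro h
      by_contra hn
      obtain ⟨l, hl, hM⟩ := Submodule.exists_le_ker_of_notMem hn
      exact hl (h l hM)
  rw [this]
  exact isClosed_iInter fun l => isClosed_iInter fun _ =>
    isClosed_stableHiggs (dual_mem_polyFunctions (l.comp A))

/-- The part of the affine subspace `z + L` of the space of Higgs fields where two given linear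
functionals do not vanish. -/
def affinePiece (z : higgsFields a d) (χ χ' : Module.Dual ℂ (higgsFields a d))
    (L : Submodule ℂ (higgsFields a d)) : Set (StableHiggs a d) :=
  {Φ | Φ.1 - z ∈ L ∧ χ Φ.1 ≠ 0 ∧ χ' Φ.1 ≠ 0}

lemma isIrreducible_affinePiece {z : higgsFields a d} {χ χ' : Module.Dual ℂ (higgsFields a d)}
    (hz : χ z ≠ 0) (hz' : χ' z ≠ 0) {L : Submodule ℂ (higgsFields a d)}
    (hstable : ∀ v : higgsFields a d, v - z ∈ L → χ v ≠ 0 → χ' v ≠ 0 →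
      IsStable a d (v : Mat)) : IsIrreducible (affinePiece z χ χ' L) := by
  refine isIrreducible_of_rationalCurves
    ⟨⟨z, hstable z (by simp) hz hz'⟩, by simp, hz, hz'⟩ ?_
  rintro Φ ⟨hΦ, h1, h1'⟩ Ψ ⟨hΨ, h2, h2'⟩
  let h : Polynomial ℂ := (Polynomial.C (χ Φ.1) + Polynomial.X * Polynomial.C (χ (Ψ.1 - Φ.1))) *
    (Polynomial.C (χ' Φ.1) + Polynomial.X * Polynomial.C (χ' (Ψ.1 - Φ.1)))
  have hh : ∀ t, h.eval t = χ (Φ.1 + t • (Ψ.1 - Φ.1)) * χ' (Φ.1 + t • (Ψ.1 - Φ.1)) := by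
    intro t
    simp only [h, Polynomial.eval_mul, Polynomial.eval_add, Polynomial.eval_C, Polynomial.eval_X,
      map_add, map_smul, smul_eq_mul]
  refine ⟨h, _, isRationalCurve_line h Φ.1 (Ψ.1 - Φ.1), fun t ht => ?_, ⟨0, ?_, ?_⟩, ⟨1, ?_, ?_⟩⟩
  · rw [hh] at ht
    have h3 := left_ne_zero_of_mul ht
    have h4 := right_ne_zero_of_mul ht
    have : Φ.1 + t • (Ψ.1 - Φ.1) - z = (Φ.1 - z) + t • ((Ψ.1 - z) - (Φ.1 - z)) := by
      rw [sub_sub_sub_cancel_right]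
      abel
    have hL : Φ.1 + t • (Ψ.1 - Φ.1) - z ∈ L := by
      rw [this]
      exact add_mem hΦ (Submodule.smul_mem _ _ (sub_mem hΨ hΦ))
    exact ⟨⟨_, hstable _ hL h3 h4⟩, ⟨hL, h3, h4⟩, rfl⟩
  · rw [hh, zero_smul, add_zero]
    exact mul_ne_zero h1 h1'
  · rw [zero_smul, add_zero]
  · rw [hh, one_smul, add_sub_cancel]
    exact mul_ne_zero h2 h2'
  · rw [one_smul, add_sub_cancel]

lemma affinePiece_mono {z : higgsFields a d} {χ χ' : Module.Dual ℂ (higgsFields a d)}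
    {L L' : Submodule ℂ (higgsFields a d)} (h : L ≤ L') :
    affinePiece z χ χ' L ⊆ affinePiece z χ χ' L' := fun _ hΦ => ⟨h hΦ.1, hΦ.2⟩

/-- One stage in the construction of a long chain: the bound `dim L ≤ height (f L)` passes from `L`
to a larger subspace `L'` if `f` is strictly monotone in between. -/
lemma finrank_le_height_of_stage {V : Type*} [AddCommGroup V] [Module ℂ V] [Module.Finite ℂ V]
    {Y : Type*} [Preorder Y] (f : Submodule ℂ V → Y) {L L' : Submodule ℂ V} (hLL' : L ≤ L')
    (h : (Module.finrank ℂ L : ℕ∞) ≤ Order.height (f L))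
    (hf : ∀ L₁ L₂, L ≤ L₁ → L₁ < L₂ → L₂ ≤ L' → f L₁ < f L₂) :
    (Module.finrank ℂ L' : ℕ∞) ≤ Order.height (f L') := by
  have h1 := height_add_finrank_le f hLL' hf
  have h2 : (Module.finrank ℂ L' : ℕ∞) + (Module.finrank ℂ L : ℕ) ≤
      Order.height (f L') + (Module.finrank ℂ L : ℕ) := by
    refine le_trans ?_ h1
    rw [add_comm]
    gcongr
  exact (ENat.add_le_add_iff_right (ENat.natCast_ne_top _)).1 h2

end Tools

/-! ### The upper bound for `m > 0` -/

section Positive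

variable {m d : ℤ}

/-- The endomorphisms of `𝒪 ⊕ 𝒪(m)` are lower triangular, as `Hom(𝒪(m), 𝒪) = 0`. -/
lemma endSections_zero_of_pos (hm : 0 < m) {g : Mat}
    (hg : g ∈ endSections ![0, m] Set.univ 0) : ∃ (r s : ℂ), ∃ c ∈ sections Set.univ m,
      g = !![algebraMap ℂ RatField r, 0; c, algebraMap ℂ RatField s] := by
  obtain ⟨r, hr⟩ := mem_sections_univ_zero.1 (by simpa using hg 0 0)
  obtain ⟨s, hs⟩ := mem_sections_univ_zero.1 (by simpa using hg 1 1)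
  have h01 : g 0 1 = 0 := sections_univ_of_neg (by simpa using hm) (hg 0 1)
  refine ⟨r, s, g 1 0, by simpa using hg 1 0, ?_⟩
  ext i j
  fin_cases i <;> fin_cases j
  · exact hr
  · exact h01
  · rfl
  · exact hs

lemma lower_mem_endSections (r s : ℂ) {c : RatField} (hc : c ∈ sections Set.univ m) :
    !![algebraMap ℂ RatField r, 0; c, algebraMap ℂ RatField s] ∈
      endSections ![0, m] Set.univ 0 := by
  intro i j
  fin_cases i <;> fin_cases j
  · simpa using mem_sections_univ_zero.2 ⟨r, rfl⟩
  · simp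
  · simpa using hc
  · simpa using mem_sections_univ_zero.2 ⟨s, rfl⟩

/-- Up to the scaling of `B` and the subtraction of a multiple of `B` from `A`, the first row
`(A, B)` of a Higgs field is invariant under conjugation. -/
lemma exists_entries_of_conjClass_eq (hm : 0 < m) {Φ Ψ : StableHiggs ![0, m] d}
    (h : conjClass Φ = conjClass Ψ) : ∃ s : ℂ, ∃ c ∈ sections Set.univ m,
      (Ψ.1 : Mat) 0 1 = s • (Φ.1 : Mat) 0 1 ∧
      (Ψ.1 : Mat) 0 0 = (Φ.1 : Mat) 0 0 - (Φ.1 : Mat) 0 1 * c := by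
  obtain ⟨g, hg, hd, e⟩ := exists_mul_eq_mul_of_conjClass_eq h
  obtain ⟨r, s, c, hc, rfl⟩ := endSections_zero_of_pos hm hg
  simp only [Matrix.det_fin_two_of, zero_mul, sub_zero, ne_eq, mul_eq_zero, not_or] at hd
  have e00 := congrFun (congrFun e 0) 0
  have e01 := congrFun (congrFun e 0) 1
  simp [Matrix.mul_apply, Fin.sum_univ_two] at e00 e01
  obtain ⟨hr, hs⟩ := hd
  have h01 : (Ψ.1 : Mat) 0 1 = (r / s) • (Φ.1 : Mat) 0 1 := by
    rw [Algebra.smul_def, map_div₀]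
    field_simp
    linear_combination e01
  refine ⟨r / s, s⁻¹ • c, Submodule.smul_mem _ _ hc, h01, ?_⟩
  rw [Algebra.smul_def, map_inv₀]
  field_simp
  apply mul_left_cancel₀ hr
  linear_combination (algebraMap ℂ RatField s) * e00 - c * e01

/-- The conjugates of `Φ` by the automorphisms of `E` with diagonal entries `1 + r ≠ 0` and `1`, and
with lower left entry `c`, for `(r, c)` in a subspace `L` of `ℂ × H⁰(𝒪(m))`. -/
def orbitPiece (Φ : StableHiggs ![0, m] d) (L : Submodule ℂ (ℂ × sections Set.univ m)) :
    Set (StableHiggs ![0, m] d) :=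
  {Ψ | ∃ p ∈ L, 1 + p.1 ≠ 0 ∧
    (Ψ.1 : Mat) *
        !![algebraMap ℂ RatField (1 + p.1), 0; (p.2 : RatField), algebraMap ℂ RatField 1] =
      !![algebraMap ℂ RatField (1 + p.1), 0; (p.2 : RatField), algebraMap ℂ RatField 1] * Φ.1}

lemma det_lower_ne_zero_iff (r : ℂ) (c : RatField) :
    (!![algebraMap ℂ RatField r, 0; c, algebraMap ℂ RatField 1] : Mat).det ≠ 0 ↔ r ≠ 0 := by
  simp

lemma isIrreducible_orbitPiece (Φ : StableHiggs ![0, m] d)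
    (L : Submodule ℂ (ℂ × sections Set.univ m)) : IsIrreducible (orbitPiece Φ L) := by
  refine isIrreducible_of_pencils ⟨Φ, 0, zero_mem _, by simp, ?_⟩ ?_
  · have : (!![algebraMap ℂ RatField (1 + (0 : ℂ × sections Set.univ m).1), 0;
        ((0 : ℂ × sections Set.univ m).2 : RatField), algebraMap ℂ RatField 1] : Mat) = 1 := by
      ext i j
      fin_cases i <;> fin_cases j <;> simp
    rw [this, mul_one, one_mul]
  · rintro Ψ ⟨p, hp, hp1, e⟩ Ψ' ⟨q, hq, hq1, e'⟩
    have key : ∀ t : ℂ, (!![algebraMap ℂ RatField (1 + p.1), 0; (p.2 : RatField),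
        algebraMap ℂ RatField 1] + t • !![algebraMap ℂ RatField (q.1 - p.1), 0;
          ((q.2 - p.2 : sections Set.univ m) : RatField), algebraMap ℂ RatField 0] : Mat) =
        !![algebraMap ℂ RatField (1 + (p + t • (q - p)).1), 0;
          ((p + t • (q - p)).2 : RatField), algebraMap ℂ RatField 1] := by
      intro t
      ext i j
      fin_cases i <;> fin_cases j
      · simp only [Matrix.add_apply, Matrix.smul_apply]
        simp [Algebra.smul_def]
        ring
      · simp
      · simp
      · simp
    refine ⟨Φ.1, _, !![algebraMap ℂ RatField (q.1 - p.1), 0;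
      ((q.2 - p.2 : sections Set.univ m) : RatField), algebraMap ℂ RatField 0],
      lower_mem_endSections (1 + p.1) 1 p.2.2, lower_mem_endSections _ _ (q.2 - p.2).2,
      fun t ht => ?_, ⟨0, ?_, ?_⟩, ⟨1, ?_, ?_⟩⟩
    · rw [key] at ht ⊢
      obtain ⟨Ξ, hΞ⟩ := exists_mul_eq_mul (lower_mem_endSections _ _ (p + t • (q - p)).2.2) ht Φ
      exact ⟨Ξ, ⟨_, add_mem hp (Submodule.smul_mem _ _ (sub_mem hq hp)),
        (det_lower_ne_zero_iff _ _).1 ht, hΞ⟩, hΞ⟩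
    · rw [key, zero_smul, add_zero]
      exact (det_lower_ne_zero_iff _ _).2 hp1
    · rw [key, zero_smul, add_zero]
      exact e
    · rw [key, one_smul, add_sub_cancel]
      exact (det_lower_ne_zero_iff _ _).2 hq1
    · rw [key, one_smul, add_sub_cancel]
      exact e'

/-- Conjugation by `(1 + r, c)` moves the first row `(A, B)` of a Higgs field by `(- c B, r B)`. -/
lemma orbitPiece_entries {Φ Ψ : StableHiggs ![0, m] d} {r : ℂ} {c : RatField} (hr : 1 + r ≠ 0)
    (h : (Ψ.1 : Mat) * !![algebraMap ℂ RatField (1 + r), 0; c, algebraMap ℂ RatField 1] =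
      !![algebraMap ℂ RatField (1 + r), 0; c, algebraMap ℂ RatField 1] * Φ.1) :
    (Ψ.1 : Mat) 0 0 - (Φ.1 : Mat) 0 0 = -(c * (Φ.1 : Mat) 0 1) ∧
      (Ψ.1 : Mat) 0 1 - (Φ.1 : Mat) 0 1 = r • (Φ.1 : Mat) 0 1 := by
  have e00 := congrFun (congrFun h 0) 0
  have e01 := congrFun (congrFun h 0) 1
  simp [Matrix.mul_apply, Fin.sum_univ_two] at e00 e01
  have hr' : 1 + algebraMap ℂ RatField r ≠ 0 := by
    rw [← map_one (algebraMap ℂ RatField), ← map_add, Ne, map_eq_zero]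
    exact hr
  rw [Algebra.smul_def]
  refine ⟨?_, by linear_combination e01⟩
  apply mul_left_cancel₀ hr'
  linear_combination e00 - c * e01

/-- As `B ≠ 0`, the parameters `(r, c)` can be read off linearly from the conjugate of `Φ` by
`(1 + r, c)`, so that a larger space of parameters gives a larger closure. -/
lemma height_orbitPiece (hm : 0 < m) (Φ : StableHiggs ![0, m] d) :
    ((1 + Module.finrank ℂ (sections Set.univ m) : ℕ) : ℕ∞) ≤
      Order.height (irredClosure (isIrreducible_orbitPiece Φ ⊤)) := by
  have hB : (Φ.1 : Mat) 0 1 ≠ 0 := (isStable_iff_of_pos hm Φ.1.2).1 Φ.2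
  set B := (Φ.1 : Mat) 0 1 with hBdef
  let φ : ℂ × sections Set.univ m →ₗ[ℂ] RatField × RatField :=
    { toFun := fun p => (-((p.2 : RatField) * B), p.1 • B)
      map_add' := fun p q => by ext <;> simp [add_mul, add_smul]; ring
      map_smul' := fun r p => by ext <;> simp [mul_smul] }
  have hφ : Function.Injective φ := by
    rw [injective_iff_map_eq_zero]
    intro p hp
    have h1 : -((p.2 : RatField) * B) = 0 := congrArg Prod.fst hp
    have h2 : p.1 • B = 0 := congrArg Prod.snd hp
    ext
    · simpa [hB] using h2
    · simpa [hB] using h1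
  have hstep : ∀ L₁ L₂ : Submodule ℂ (ℂ × sections Set.univ m), ⊥ ≤ L₁ → L₁ < L₂ → L₂ ≤ ⊤ →
      irredClosure (isIrreducible_orbitPiece Φ L₁) <
        irredClosure (isIrreducible_orbitPiece Φ L₂) := by
    intro L₁ L₂ _ hlt _
    obtain ⟨q, hq₂, hq₁⟩ := SetLike.exists_of_lt hlt
    have hq : φ q ∉ L₁.map φ := by
      rintro ⟨p, hp, e⟩
      exact hq₁ (hφ e ▸ hp)
    obtain ⟨l, hl, hker⟩ := Submodule.exists_le_ker_of_notMem hq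
    -- rescale `q` to make the corresponding endomorphism invertible
    obtain ⟨t, ht0, ht⟩ : ∃ t : ℂ, t ≠ 0 ∧ 1 + t * q.1 ≠ 0 := by
      by_cases h : 1 + q.1 = 0
      · refine ⟨2, two_ne_zero, fun h' => one_ne_zero (α := ℂ) ?_⟩
        linear_combination 2 * h - h'
      · exact ⟨1, one_ne_zero, by simpa using h⟩
    obtain ⟨Ψ, hΨ⟩ := exists_mul_eq_mul (lower_mem_endSections (1 + t * q.1) 1 (t • q.2).2)
      ((det_lower_ne_zero_iff _ _).2 ht) Φ
    have hval : ∀ (Ψ : StableHiggs ![0, m] d) (p : ℂ × sections Set.univ m), 1 + p.1 ≠ 0 →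
        (Ψ.1 : Mat) * !![algebraMap ℂ RatField (1 + p.1), 0; (p.2 : RatField),
            algebraMap ℂ RatField 1] =
          !![algebraMap ℂ RatField (1 + p.1), 0; (p.2 : RatField), algebraMap ℂ RatField 1] *
            Φ.1 →
        l ((entry _ _ 0 0 Ψ.1, entry _ _ 0 1 Ψ.1)) + -l ((entry _ _ 0 0 Φ.1, entry _ _ 0 1 Φ.1)) =
          l (φ p) := by
      intro Ψ p hp h
      obtain ⟨h1, h2⟩ := orbitPiece_entries hp h
      rw [← sub_eq_add_neg, ← map_sub]
      congr 1
      exact Prod.ext h1 h2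
    refine irredClosure_lt _ _ (fun Ψ ⟨p, hp, h⟩ => ⟨p, hlt.le hp, h⟩)
      (isClosed_stableHiggs (f := fun v => l ((entry _ _ 0 0 v, entry _ _ 0 1 v)) +
        -l ((entry _ _ 0 0 Φ.1, entry _ _ 0 1 Φ.1)))
        (add_mem (dual_mem_polyFunctions (l.comp ((entry _ _ 0 0).prod (entry _ _ 0 1))))
          (const_mem_polyFunctions _))) ?_ (Φ := Ψ)
      ⟨t • q, Submodule.smul_mem _ _ hq₂, ht, hΨ⟩ ?_
    · rintro Ψ ⟨p, hp, hp1, h⟩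
      exact (hval Ψ p hp1 h).trans (hker ⟨p, hp, rfl⟩)
    · intro h
      have h' := (hval Ψ (t • q) ht hΨ).symm.trans h
      rw [map_smul, map_smul, smul_eq_mul] at h'
      exact mul_ne_zero ht0 hl h'
  have := finrank_le_height_of_stage
    (fun L => irredClosure (isIrreducible_orbitPiece Φ L)) (bot_le (a := ⊤)) (by simp) hstep
  rwa [finrank_top, Module.finrank_prod, Module.finrank_self] at this

theorem topologicalKrullDim_le_of_pos (hm : 0 < m) {n : ℕ}
    (hn : Module.finrank ℂ (higgsFields ![0, m] d) =
      n + (1 + Module.finrank ℂ (sections Set.univ m))) :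
    topologicalKrullDim (StableHiggsModConj ![0, m] d) ≤ (n : WithBot ℕ∞) := by
  refine topologicalKrullDim_stableHiggsModConj_le hn fun Φ =>
    ⟨orbitPiece Φ ⊤, isIrreducible_orbitPiece Φ ⊤, ?_, height_orbitPiece hm Φ⟩
  rintro Ψ ⟨p, -, hp, h⟩
  exact conjClass_eq_of_mul_eq_mul (lower_mem_endSections (1 + p.1) 1 p.2.2)
    ((det_lower_ne_zero_iff _ _).2 hp) h

end Positive

/-! ### The lower bound for `m > 0` -/

section PositiveLower

variable {m d : ℤ}

lemma eq_zero_of_entries {a : Fin 2 → ℤ} {d : ℤ} {v : higgsFields a d}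
    (h : ∀ i j, entry a d i j v = 0) : v = 0 := by
  ext i j
  exact h i j

/-- The negative of the determinant of a Higgs field, composed with a linear functional, is a
polynomial function. -/
lemma det_mem_polyFunctions (a : Fin 2 → ℤ) (d : ℤ) (l : RatField →ₗ[ℂ] ℂ) :
    (fun v : higgsFields a d => l (entry a d 0 1 v * entry a d 1 0 v -
      entry a d 0 0 v * entry a d 1 1 v)) ∈ polyFunctions (higgsFields a d) := by
  have h := fun i j k n => bilin_mem_polyFunctions
    (((LinearMap.mul ℂ RatField).compl₁₂ (entry a d i j) (entry a d k n)).compr₂ l)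
  have := sub_mem (h 0 1 1 0) (h 0 0 1 1)
  convert this using 1
  ext v
  simp

/-- The chain consists of the images of affine spaces through the Higgs field `z` with entry `B₀` in
the upper right corner and zeros elsewhere.  They are transverse to the orbits: the first diagonal
entry varies in a complement of `B₀ H⁰(𝒪(m))`, and the entry `B` in a complement of `ℂ B₀`. -/
theorem le_topologicalKrullDim_of_pos (hm : 0 < m) {B₀ : RatField}
    (hB₀ : B₀ ∈ sections Set.univ (d - m)) (hB₀0 : B₀ ≠ 0) {n : ℕ}
    (hn : Module.finrank ℂ (higgsFields ![0, m] d) =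
      n + (1 + Module.finrank ℂ (sections Set.univ m))) :
    (n : WithBot ℕ∞) ≤ topologicalKrullDim (StableHiggsModConj ![0, m] d) := by
  let e := entry ![0, m] d
  obtain ⟨l₀, hl₀⟩ : ∃ l : RatField →ₗ[ℂ] ℂ, l B₀ = 1 := by
    obtain ⟨l, hl, -⟩ := Submodule.exists_le_ker_of_notMem (p := (⊥ : Submodule ℂ RatField))
      (v := B₀) (by simpa using hB₀0)
    exact ⟨(l B₀)⁻¹ • l, by simp [hl]⟩
  -- the functions of the form `B₀ c`, which can be conjugated away from the entry `A`
  let N : Submodule ℂ RatField := (sections Set.univ m).map (LinearMap.mulLeft ℂ B₀)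
  obtain ⟨W, hW⟩ := Submodule.exists_isCompl N
  let z : higgsFields ![0, m] d := ⟨!![0, B₀; 0, 0], by
    intro i j
    fin_cases i <;> fin_cases j
    · exact zero_mem _
    · have : (0 : ℤ) - m + d = d - m := by ring
      change B₀ ∈ sections Set.univ (0 - m + d)
      rwa [this]
    · exact zero_mem _
    · exact zero_mem _⟩
  have hz : ∀ i j, e i j z = (!![0, B₀; 0, 0] : Mat) i j := fun i j => rfl
  let χ : Module.Dual ℂ (higgsFields ![0, m] d) := l₀.comp (e 0 1)
  have hχ : ∀ v, χ v ≠ 0 → χ v ≠ 0 → IsStable ![0, m] d (v : Mat) := by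
    intro v hv _
    refine (isStable_iff_of_pos hm v.2).2 fun h => hv ?_
    change l₀ ((v : Mat) 0 1) = 0
    rw [h, map_zero]
  have hχz : χ z ≠ 0 := by
    change l₀ B₀ ≠ 0
    simp [hl₀]
  have hirr := fun L => isIrreducible_affinePiece hχz hχz (L := L) fun v _ => hχ v
  let f := fun L => irredClosureImage (hirr L)
  have hentry : ∀ {L : Submodule ℂ (higgsFields ![0, m] d)} {Φ : StableHiggs ![0, m] d},
      Φ ∈ affinePiece z χ χ L → ∃ w ∈ L, ∀ i j, e i j Φ.1 = e i j z + e i j w := by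
    intro L Φ hΦ
    exact ⟨Φ.1 - z, hΦ.1, fun i j => by rw [← map_add, add_sub_cancel]⟩
  -- `z + v` lies in the piece attached to `L` if `l₀` vanishes on the second entry of `v`
  have hpoint : ∀ {L : Submodule ℂ (higgsFields ![0, m] d)} {v}, v ∈ L → l₀ (e 0 1 v) = 0 →
      ∃ Φ ∈ affinePiece z χ χ L, ∀ i j, e i j Φ.1 = e i j z + e i j v := by
    intro L v hv h0
    have h1 : χ (z + v) ≠ 0 := by
      change l₀ (e 0 1 (z + v)) ≠ 0
      rw [map_add, map_add, h0, add_zero]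
      exact hχz
    exact ⟨⟨z + v, hχ _ h1 h1⟩, ⟨by simpa using hv, h1, h1⟩, fun i j => map_add _ _ _⟩
  let S₁ : Submodule ℂ (higgsFields ![0, m] d) := LinearMap.ker (e 0 0) ⊓ LinearMap.ker (e 0 1)
  let S₂ : Submodule ℂ (higgsFields ![0, m] d) := W.comap (e 0 0) ⊓ LinearMap.ker (e 0 1)
  let S₃ : Submodule ℂ (higgsFields ![0, m] d) := W.comap (e 0 0) ⊓ LinearMap.ker χ
  have h12 : S₁ ≤ S₂ := fun v hv => ⟨by
    rw [SetLike.mem_coe, Submodule.mem_comap, LinearMap.mem_ker.1 hv.1]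
    exact zero_mem _, hv.2⟩
  have h23 : S₂ ≤ S₃ := fun v hv => ⟨hv.1, by
    rw [SetLike.mem_coe, LinearMap.mem_ker]
    change l₀ (e 0 1 v) = 0
    rw [LinearMap.mem_ker.1 hv.2, map_zero]⟩
  -- first the second row varies, detected by the trace and the determinant
  have stage₁ : ∀ L₁ L₂, ⊥ ≤ L₁ → L₁ < L₂ → L₂ ≤ S₁ → f L₁ < f L₂ := by
    intro L₁ L₂ _ hlt hle
    obtain ⟨v, hv₂, hv₁⟩ := SetLike.exists_of_lt hlt
    let φ : higgsFields ![0, m] d →ₗ[ℂ] RatField × RatField :=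
      (e 1 1).prod ((LinearMap.mulLeft ℂ B₀).comp (e 1 0))
    have hφv : φ v ∉ L₁.map φ := by
      rintro ⟨w, hw, hwv⟩
      refine hv₁ ?_
      have h1 : e 1 1 w = e 1 1 v := congrArg Prod.fst hwv
      have h2 : B₀ * e 1 0 w = B₀ * e 1 0 v := congrArg Prod.snd hwv
      have h3 := hle hv₂
      have h4 := hle (hlt.le hw)
      have h5 : v - w = 0 := by
        refine eq_zero_of_entries fun i j => ?_
        rw [map_sub, sub_eq_zero]
        fin_cases i <;> fin_cases j
        · exact (LinearMap.mem_ker.1 h3.1).trans (LinearMap.mem_ker.1 h4.1).symm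
        · exact (LinearMap.mem_ker.1 h3.2).trans (LinearMap.mem_ker.1 h4.2).symm
        · exact (mul_left_cancel₀ hB₀0 h2).symm
        · exact h1.symm
      rw [sub_eq_zero.1 h5]
      exact hw
    obtain ⟨l, hl, hker⟩ := Submodule.exists_le_ker_of_notMem hφv
    obtain ⟨Φ, hΦ, hΦe⟩ := hpoint hv₂ (by rw [LinearMap.mem_ker.1 (hle hv₂).2, map_zero])
    let F : higgsFields ![0, m] d → ℂ := fun u =>
      l (e 0 0 u + e 1 1 u, e 0 1 u * e 1 0 u - e 0 0 u * e 1 1 u)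
    have hF : F ∈ polyFunctions _ := by
      have h1 := add_mem (dual_mem_polyFunctions
        ((l.comp (LinearMap.inl ℂ RatField RatField)).comp (e 0 0 + e 1 1)))
        (det_mem_polyFunctions ![0, m] d (l.comp (LinearMap.inr ℂ RatField RatField)))
      convert h1 using 1
      ext u
      simp only [F, Pi.add_apply, LinearMap.comp_apply, ← map_add]
      simp [e]
    have hval : ∀ (Ψ : StableHiggs ![0, m] d) (w : higgsFields ![0, m] d), w ∈ S₁ →
        (∀ i j, e i j Ψ.1 = e i j z + e i j w) → F Ψ.1 = l (φ w) := by
      intro Ψ w hw h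
      have h1 : e 0 0 w = 0 := hw.1
      have h2 : e 0 1 w = 0 := hw.2
      simp [F, φ, h, hz, h1, h2]
    refine irredClosureImage_lt _ _ (affinePiece_mono hlt.le) (isClosed_stableHiggs hF) ?_ ?_ hΦ ?_
    · intro Ψ Ψ' h hΨ
      obtain ⟨g, hg, he⟩ := conjClass_eq_iff.1 h
      have htr : (Ψ'.1 : Mat).trace = (Ψ.1 : Mat).trace := by
        rw [he, Matrix.trace_units_conj]
      have hdet : (Ψ'.1 : Mat).det = (Ψ.1 : Mat).det := by
        rw [he, Matrix.det_units_conj]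
      rw [Matrix.trace_fin_two, Matrix.trace_fin_two] at htr
      rw [Matrix.det_fin_two, Matrix.det_fin_two] at hdet
      have : F Ψ'.1 = F Ψ.1 := by
        refine congrArg l (Prod.ext htr ?_)
        change (Ψ'.1 : Mat) 0 1 * (Ψ'.1 : Mat) 1 0 - (Ψ'.1 : Mat) 0 0 * (Ψ'.1 : Mat) 1 1 =
          (Ψ.1 : Mat) 0 1 * (Ψ.1 : Mat) 1 0 - (Ψ.1 : Mat) 0 0 * (Ψ.1 : Mat) 1 1
        linear_combination -hdet
      exact this.trans hΨ
    · intro Ψ hΨ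
      obtain ⟨w, hw, hwe⟩ := hentry hΨ
      exact (hval Ψ w (hle (hlt.le hw)) hwe).trans (hker ⟨w, hw, rfl⟩)
    · intro h
      exact hl ((hval Φ v (hle hv₂) hΦe).symm.trans h)
  -- then `A`, detected modulo the multiples of `B₀`
  have stage₂ : ∀ L₁ L₂, S₁ ≤ L₁ → L₁ < L₂ → L₂ ≤ S₂ → f L₁ < f L₂ := by
    intro L₁ L₂ hle₁ hlt hle
    obtain ⟨v, hv₂, hv₁⟩ := SetLike.exists_of_lt hlt
    have hv : e 0 0 v ∉ N ⊔ L₁.map (e 0 0) := by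
      intro h
      obtain ⟨y, hy, _, ⟨w, hw, rfl⟩, hsum⟩ := Submodule.mem_sup.1 h
      have hyW : y ∈ W := by
        rw [eq_sub_of_add_eq hsum]
        exact sub_mem (hle hv₂).1 (hle (hlt.le hw)).1
      have hy0 : y = 0 := by
        have : y ∈ N ⊓ W := ⟨hy, hyW⟩
        rwa [hW.inf_eq_bot, Submodule.mem_bot] at this
      rw [hy0, zero_add] at hsum
      have h1 : v - w ∈ S₁ := by
        constructor
        · rw [SetLike.mem_coe, LinearMap.mem_ker, map_sub, hsum, sub_self]
        · exact sub_mem (hle hv₂).2 (hle (hlt.le hw)).2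
      exact hv₁ (by simpa using add_mem (hle₁ h1) hw)
    obtain ⟨l, hl, hker⟩ := Submodule.exists_le_ker_of_notMem hv
    obtain ⟨Φ, hΦ, hΦe⟩ := hpoint hv₂ (by rw [LinearMap.mem_ker.1 (hle hv₂).2, map_zero])
    refine irredClosureImage_lt _ _ (affinePiece_mono hlt.le)
      (K := {Ψ | e 0 1 Ψ.1 ∈ Submodule.span ℂ {B₀}} ∩ {Ψ | l (e 0 0 Ψ.1) = 0})
      ((isClosed_linear_mem _ _).inter
        (isClosed_stableHiggs (dual_mem_polyFunctions (l.comp (e 0 0))))) ?_ ?_ hΦ ?_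
    · rintro Ψ Ψ' h ⟨hB, hA⟩
      obtain ⟨s, c, hc, h01, h00⟩ := exists_entries_of_conjClass_eq hm h
      have hB' : (Ψ.1 : Mat) 0 1 ∈ Submodule.span ℂ {B₀} := hB
      constructor
      · change (Ψ'.1 : Mat) 0 1 ∈ Submodule.span ℂ {B₀}
        rw [h01]
        exact Submodule.smul_mem _ _ hB'
      · change l ((Ψ'.1 : Mat) 0 0) = 0
        obtain ⟨r, hr⟩ := Submodule.mem_span_singleton.1 hB'
        rw [h00, map_sub, ← hr, smul_mul_assoc, map_smul]
        have h1 : l (B₀ * c) = 0 := hker (Submodule.mem_sup_left ⟨c, hc, rfl⟩)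
        have h2 : l ((Ψ.1 : Mat) 0 0) = 0 := hA
        rw [h1, h2, smul_zero, sub_zero]
    · intro Ψ hΨ
      obtain ⟨w, hw, hwe⟩ := hentry hΨ
      have h1 : e 0 1 w = 0 := (hle (hlt.le hw)).2
      constructor
      · rw [Set.mem_ofPred_eq, hwe, h1, add_zero, hz]
        exact Submodule.mem_span_singleton_self B₀
      · rw [Set.mem_ofPred_eq, hwe, hz]
        change l (0 + e 0 0 w) = 0
        rw [zero_add]
        exact hker (Submodule.mem_sup_right ⟨w, hw, rfl⟩)
    · rintro ⟨-, h⟩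
      rw [Set.mem_ofPred_eq, hΦe, hz] at h
      exact hl (by simpa using h)
  -- finally `B`, detected up to scalars
  have stage₃ : ∀ L₁ L₂, S₂ ≤ L₁ → L₁ < L₂ → L₂ ≤ S₃ → f L₁ < f L₂ := by
    intro L₁ L₂ hle₁ hlt hle
    obtain ⟨v, hv₂, hv₁⟩ := SetLike.exists_of_lt hlt
    obtain ⟨Φ, hΦ, hΦe⟩ := hpoint hv₂ (hle hv₂).2
    refine irredClosureImage_lt _ _ (affinePiece_mono hlt.le)
      (isClosed_linear_mem (e 0 1) (L₁.map (e 0 1) ⊔ Submodule.span ℂ {B₀})) ?_ ?_ hΦ ?_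
    · intro Ψ Ψ' h hB
      obtain ⟨s, c, hc, h01, h00⟩ := exists_entries_of_conjClass_eq hm h
      have hB' : (Ψ.1 : Mat) 0 1 ∈ L₁.map (e 0 1) ⊔ Submodule.span ℂ {B₀} := hB
      change (Ψ'.1 : Mat) 0 1 ∈ L₁.map (e 0 1) ⊔ Submodule.span ℂ {B₀}
      rw [h01]
      exact Submodule.smul_mem _ _ hB'
    · intro Ψ hΨ
      obtain ⟨w, hw, hwe⟩ := hentry hΨ
      rw [Set.mem_ofPred_eq, hwe, hz]
      exact add_mem (Submodule.mem_sup_right (Submodule.mem_span_singleton_self B₀))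
        (Submodule.mem_sup_left ⟨w, hw, rfl⟩)
    · intro h
      rw [Set.mem_ofPred_eq, hΦe, hz] at h
      obtain ⟨_, ⟨w, hw, rfl⟩, y, hy, hsum⟩ := Submodule.mem_sup.1 h
      obtain ⟨r, rfl⟩ := Submodule.mem_span_singleton.1 hy
      change e 0 1 w + r • B₀ = B₀ + e 0 1 v at hsum
      have hr : r = 1 := by
        have h1 := congrArg l₀ hsum
        have h2 : l₀ (e 0 1 w) = 0 := (hle (hlt.le hw)).2
        have h3 : l₀ (e 0 1 v) = 0 := (hle hv₂).2
        rw [map_add, map_add, h2, h3, map_smul, hl₀] at h1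
        simpa using h1
      rw [hr, one_smul, add_comm] at hsum
      have h4 : e 0 1 w = e 0 1 v := add_left_cancel hsum
      have h5 : v - w ∈ S₂ := by
        constructor
        · exact sub_mem (hle hv₂).1 (hle (hlt.le hw)).1
        · rw [SetLike.mem_coe, LinearMap.mem_ker, map_sub, h4, sub_self]
      exact hv₁ (by simpa using add_mem (hle₁ h5) hw)
  have hheight : (Module.finrank ℂ S₃ : ℕ∞) ≤ Order.height (f S₃) :=
    finrank_le_height_of_stage f h23 (finrank_le_height_of_stage f h12
      (finrank_le_height_of_stage f bot_le (by simp) stage₁) stage₂) stage₃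
  have hdim : n ≤ Module.finrank ℂ S₃ := by
    -- `S₃` is cut out by at most `dim H⁰(𝒪(m)) + 1` linear equations
    let ψ : higgsFields ![0, m] d →ₗ[ℂ] (RatField ⧸ W) × ℂ := (W.mkQ.comp (e 0 0)).prod χ
    have hker : LinearMap.ker ψ ≤ S₃ := by
      intro v hv
      have h1 : W.mkQ (e 0 0 v) = 0 := congrArg Prod.fst (LinearMap.mem_ker.1 hv)
      have h2 : χ v = 0 := congrArg Prod.snd (LinearMap.mem_ker.1 hv)
      exact ⟨by simpa using h1, h2⟩
    have hfinN : Module.Finite ℂ N := Module.Finite.map _ _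
    let eq := Submodule.quotientEquivOfIsCompl W N hW.symm
    have hfinQ : Module.Finite ℂ (RatField ⧸ W) := Module.Finite.equiv eq.symm
    have h1 := LinearMap.finrank_range_add_finrank_ker ψ
    have h2 : Module.finrank ℂ (LinearMap.range ψ) ≤ Module.finrank ℂ N + 1 := by
      refine (Submodule.finrank_le _).trans ?_
      rw [Module.finrank_prod, Module.finrank_self, eq.finrank_eq]
    have h3 : Module.finrank ℂ N ≤ Module.finrank ℂ (sections Set.univ m) :=
      Submodule.finrank_map_le _ _
    have h4 := Submodule.finrank_mono hker
    omega
  calc (n : WithBot ℕ∞) ≤ ((Module.finrank ℂ S₃ : ℕ∞) : WithBot ℕ∞) := by exact_mod_cast hdim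
    _ ≤ Order.height (f S₃) := WithBot.coe_le_coe.2 hheight
    _ ≤ _ := Order.height_le_krullDim _

end PositiveLower

/-! ### The upper bound for `m = 0` -/

section Zero

variable {d : ℤ}

/-- The conjugates of `Φ` by the invertible elements of a space of endomorphisms of `E`. -/
def conjugatesBy {a : Fin 2 → ℤ} (Φ : StableHiggs a d) (F : Submodule ℂ Mat) :
    Set (StableHiggs a d) :=
  {Ψ | ∃ g ∈ F, g.det ≠ 0 ∧ (Ψ.1 : Mat) * g = g * Φ.1}

lemma isIrreducible_conjugatesBy {a : Fin 2 → ℤ} (Φ : StableHiggs a d) {F : Submodule ℂ Mat}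
    (hF : F ≤ endSections a Set.univ 0) (h1 : (1 : Mat) ∈ F) :
    IsIrreducible (conjugatesBy Φ F) := by
  refine isIrreducible_of_pencils ⟨Φ, 1, h1, by simp, by simp⟩ ?_
  rintro Ψ ⟨g, hg, hd, e⟩ Ψ' ⟨g', hg', hd', e'⟩
  refine ⟨Φ.1, g, g' - g, hF hg, hF (sub_mem hg' hg), fun t ht => ?_, ⟨0, by simpa, by simpa⟩,
    ⟨1, by simpa, by simpa⟩⟩
  have hmem : g + t • (g' - g) ∈ F := add_mem hg (Submodule.smul_mem _ _ (sub_mem hg' hg))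
  obtain ⟨Ξ, hΞ⟩ := exists_mul_eq_mul (hF hmem) ht Φ
  exact ⟨Ξ, ⟨_, hmem, ht, hΞ⟩, hΞ⟩

lemma weight_sub_add_eq (i j : Fin 2) (k : ℤ) :
    (![0, 0] : Fin 2 → ℤ) i - (![0, 0] : Fin 2 → ℤ) j + k = k := by
  fin_cases i <;> fin_cases j <;> simp

lemma exists_const_of_mem_endSections {g : Mat} (hg : g ∈ endSections ![0, 0] Set.univ 0)
    (i j : Fin 2) : ∃ c : ℂ, g i j = algebraMap ℂ RatField c := by
  have := hg i j
  rw [weight_sub_add_eq] at this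
  exact mem_sections_univ_zero.1 this

lemma const_mem_endSections (c : Matrix (Fin 2) (Fin 2) ℂ) :
    c.map (algebraMap ℂ RatField) ∈ endSections ![0, 0] Set.univ 0 := by
  intro i j
  rw [weight_sub_add_eq]
  exact mem_sections_univ_zero.2 ⟨c i j, rfl⟩

lemma entry_mem_sections (Φ : higgsFields ![0, 0] d) (i j : Fin 2) :
    (Φ : Mat) i j ∈ sections Set.univ d := by
  have := Φ.2 i j
  rwa [weight_sub_add_eq] at this

lemma IsStable.entry_ne_zero (Φ : StableHiggs ![0, 0] d) : (Φ.1 : Mat) 1 0 ≠ 0 := by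
  intro h
  refine Φ.2.mulVec_ne (s := ![1, 0]) (fun h => by simpa using congrFun h 0)
    (entry_mem_sections Φ.1 0 0) ?_
  ext i
  fin_cases i <;> simp [Matrix.mulVec, dotProduct, h]

/-- If both `B` and `A - D` were multiples of `C`, then the trace-free part of the Higgs field would
be a multiple of a constant matrix, which has an eigenvector. -/
lemma IsStable.not_mem_span (Φ : StableHiggs ![0, 0] d) :
    (Φ.1 : Mat) 0 1 ∉ Submodule.span ℂ {(Φ.1 : Mat) 1 0} ∨
      (Φ.1 : Mat) 0 0 - (Φ.1 : Mat) 1 1 ∉ Submodule.span ℂ {(Φ.1 : Mat) 1 0} := by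
  by_contra! h
  obtain ⟨β, hβ⟩ := Submodule.mem_span_singleton.1 h.1
  obtain ⟨α, hα⟩ := Submodule.mem_span_singleton.1 h.2
  obtain ⟨x, hx⟩ : ∃ x : ℂ, x ^ 2 = α * x + β := by
    obtain ⟨r, hr⟩ := IsAlgClosed.exists_pow_nat_eq (α ^ 2 / 4 + β) (n := 2) two_pos
    exact ⟨r + α / 2, by linear_combination hr⟩
  have hx' : algebraMap ℂ RatField x ^ 2 =
      algebraMap ℂ RatField α * algebraMap ℂ RatField x + algebraMap ℂ RatField β := by
    rw [← map_pow, hx, map_add, map_mul]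
  refine Φ.2.mulVec_ne (s := ![x, 1]) (fun h => by simpa using congrFun h 1)
    (lam := x • (Φ.1 : Mat) 1 0 + (Φ.1 : Mat) 1 1)
    (add_mem (Submodule.smul_mem _ _ (entry_mem_sections Φ.1 1 0)) (entry_mem_sections Φ.1 1 1)) ?_
  rw [Algebra.smul_def] at hα hβ
  ext i
  fin_cases i
  · simp [Matrix.mulVec, dotProduct, Algebra.smul_def]
    linear_combination -(algebraMap ℂ RatField x) * hα - hβ - (Φ.1 : Mat) 1 0 * hx'
  · simp [Matrix.mulVec, dotProduct, Algebra.smul_def]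
    ring

/-- For `m = 0` the group `Aut E` is `GL₂(ℂ)`. The closure of a conjugacy class contains those of
the orbits of the Borel subgroup of upper triangular matrices, of its unipotent radical times the
scalars, and of the scalars, and these are pairwise distinct. -/
lemma height_conjugatesBy (Φ : StableHiggs ![0, 0] d) :
    (3 : ℕ∞) ≤ Order.height (irredClosure (isIrreducible_conjugatesBy Φ
      (F := endSections ![0, 0] Set.univ 0) le_rfl (endSections_one _ _))) := by
  let c : Fin 2 → Fin 2 → Mat →ₗ[ℂ] RatField := fun i j => Matrix.entryLinearMap ℂ RatField i j
  let F₃ : Submodule ℂ Mat := endSections ![0, 0] Set.univ 0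
  let F₂ : Submodule ℂ Mat := F₃ ⊓ LinearMap.ker (c 1 0)
  let F₁ : Submodule ℂ Mat := F₂ ⊓ LinearMap.ker (c 0 0 - c 1 1)
  let F₀ : Submodule ℂ Mat := F₁ ⊓ LinearMap.ker (c 0 1)
  have h10 : F₁ ≤ F₂ := inf_le_left
  have h21 : F₂ ≤ F₃ := inf_le_left
  have h00 : F₀ ≤ F₁ := inf_le_left
  have one₃ : (1 : Mat) ∈ F₃ := endSections_one _ _
  have one₂ : (1 : Mat) ∈ F₂ := ⟨one₃, by simp [c]⟩
  have one₁ : (1 : Mat) ∈ F₁ := ⟨one₂, by simp [c]⟩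
  have one₀ : (1 : Mat) ∈ F₀ := ⟨one₁, by simp [c]⟩
  have mono : ∀ {F F' : Submodule ℂ Mat}, F ≤ F' → conjugatesBy Φ F ⊆ conjugatesBy Φ F' :=
    fun h Ψ ⟨g, hg, hΨ⟩ => ⟨g, h hg, hΨ⟩
  have wit : ∀ k : Matrix (Fin 2) (Fin 2) ℂ, k.det ≠ 0 →
      ∃ Ψ : StableHiggs ![0, 0] d, (k.map (algebraMap ℂ RatField)).det ≠ 0 ∧
        (Ψ.1 : Mat) * k.map (algebraMap ℂ RatField) = k.map (algebraMap ℂ RatField) * Φ.1 := by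
    intro k hk
    have hd : (k.map (algebraMap ℂ RatField)).det ≠ 0 := by
      have := (algebraMap ℂ RatField).map_det k
      rw [RingHom.mapMatrix_apply] at this
      rw [← this]
      simpa using hk
    obtain ⟨Ψ, hΨ⟩ := exists_mul_eq_mul (const_mem_endSections k) hd Φ
    exact ⟨Ψ, hd, hΨ⟩
  have hC := IsStable.entry_ne_zero Φ
  set A := (Φ.1 : Mat) 0 0 with hA
  set B := (Φ.1 : Mat) 0 1 with hB
  set C := (Φ.1 : Mat) 1 0 with hC'
  set D := (Φ.1 : Mat) 1 1 with hD
  obtain ⟨l, hl, -⟩ := Submodule.exists_le_ker_of_notMem (p := (⊥ : Submodule ℂ RatField))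
      (v := C) (by simpa using hC)
  obtain ⟨ν, hνC, hν⟩ : ∃ ν : RatField →ₗ[ℂ] ℂ, ν C = 0 ∧ (ν B ≠ 0 ∨ ν (A - D) ≠ 0) := by
    rcases IsStable.not_mem_span Φ with h | h
    · obtain ⟨ν, h1, h2⟩ := Submodule.exists_le_ker_of_notMem h
      exact ⟨ν, h2 (Submodule.mem_span_singleton_self _), Or.inl h1⟩
    · obtain ⟨ν, h1, h2⟩ := Submodule.exists_le_ker_of_notMem h
      exact ⟨ν, h2 (Submodule.mem_span_singleton_self _), Or.inr h1⟩
  have irr₀ := isIrreducible_conjugatesBy Φ ((h00.trans h10).trans h21) one₀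
  have irr₁ := isIrreducible_conjugatesBy Φ (h10.trans h21) one₁
  have irr₂ := isIrreducible_conjugatesBy Φ h21 one₂
  have irr₃ := isIrreducible_conjugatesBy Φ (le_refl F₃) one₃
  have entries : ∀ {Ψ : StableHiggs ![0, 0] d} {g : Mat}, (Ψ.1 : Mat) * g = g * Φ.1 →
      (Ψ.1 : Mat) 0 0 * g 0 0 + (Ψ.1 : Mat) 0 1 * g 1 0 = g 0 0 * A + g 0 1 * C ∧
      (Ψ.1 : Mat) 1 0 * g 0 0 + (Ψ.1 : Mat) 1 1 * g 1 0 = g 1 0 * A + g 1 1 * C ∧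
      (Ψ.1 : Mat) 1 0 * g 0 1 + (Ψ.1 : Mat) 1 1 * g 1 1 = g 1 0 * B + g 1 1 * D := by
    intro Ψ g h
    have e := fun i j => congrFun (congrFun h i) j
    simp only [Matrix.mul_apply, Fin.sum_univ_two] at e
    exact ⟨e 0 0, e 1 0, e 1 1⟩
  have closed : ∀ (i j : Fin 2) (μ : RatField →ₗ[ℂ] ℂ) (r : ℂ),
      IsClosed {Ψ : StableHiggs ![0, 0] d | μ ((Ψ.1 : Mat) i j) - r = 0} := fun i j μ r =>
    isClosed_stableHiggs (f := fun v => μ (entry _ _ i j v) - r)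
      (sub_mem (dual_mem_polyFunctions (μ.comp (entry _ _ i j))) (const_mem_polyFunctions r))
  -- the upper left entry separates the orbit of the unipotent radical from `Φ`
  have step₁ : irredClosure irr₀ < irredClosure irr₁ := by
    obtain ⟨Ψ, hd, hΨ⟩ := wit !![1, 1; 0, 1] (by simp)
    refine irredClosure_lt _ _ (mono h00) (closed 0 0 l (l A)) ?_ (Φ := Ψ)
      ⟨_, ⟨⟨const_mem_endSections _, by simp [c]⟩, by simp [c]⟩, hd, hΨ⟩ ?_
    · rintro Ξ ⟨g, ⟨⟨⟨_, g10⟩, g00⟩, g01⟩, hgd, hg⟩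
      obtain ⟨e00, -, -⟩ := entries hg
      replace g10 : g 1 0 = 0 := g10
      replace g01 : g 0 1 = 0 := g01
      replace g00 : g 0 0 - g 1 1 = 0 := g00
      rw [Matrix.det_fin_two, g10, mul_zero, sub_zero] at hgd
      have : (Ξ.1 : Mat) 0 0 = A := by
        apply mul_right_cancel₀ (left_ne_zero_of_mul hgd)
        rw [g10, g01] at e00
        linear_combination e00
      rw [Set.mem_ofPred_eq, this, sub_self]
    · intro h
      obtain ⟨e00, -, -⟩ := entries hΨ
      simp at e00
      rw [Set.mem_ofPred_eq, e00, map_add, add_sub_cancel_left] at h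
      exact hl h
  -- unipotent upper triangular matrices fix the lower left entry `C`, diagonal ones scale it
  have step₂ : irredClosure irr₁ < irredClosure irr₂ := by
    obtain ⟨Ψ, hd, hΨ⟩ := wit !![2, 0; 0, 1] (by simp)
    refine irredClosure_lt _ _ (mono h10) (closed 1 0 l (l C)) ?_ (Φ := Ψ)
      ⟨_, ⟨const_mem_endSections _, by simp [c]⟩, hd, hΨ⟩ ?_
    · rintro Ξ ⟨g, ⟨⟨_, g10⟩, g00⟩, hgd, hg⟩
      obtain ⟨-, e10, -⟩ := entries hg
      replace g10 : g 1 0 = 0 := g10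
      replace g00 : g 0 0 - g 1 1 = 0 := g00
      rw [Matrix.det_fin_two, g10, mul_zero, sub_zero] at hgd
      have : (Ξ.1 : Mat) 1 0 = C := by
        apply mul_right_cancel₀ (left_ne_zero_of_mul hgd)
        rw [g10] at e10
        linear_combination e10 - C * g00
      rw [Set.mem_ofPred_eq, this, sub_self]
    · intro h
      obtain ⟨-, e10, -⟩ := entries hΨ
      simp at e10
      have h2 : C = (2 : ℂ) • (Ψ.1 : Mat) 1 0 := by
        rw [Algebra.smul_def, ← e10, mul_comm]
      rw [Set.mem_ofPred_eq, h2, map_smul] at h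
      apply hl
      rw [h2, map_smul]
      simp only [smul_eq_mul] at h ⊢
      linear_combination -2 * h
  -- the Borel subgroup keeps `C` on its line, but the whole group does not
  have step₃ : irredClosure irr₂ < irredClosure irr₃ := by
    obtain ⟨u, hu⟩ : ∃ u : ℂ, u * ν (A - D) - u ^ 2 * ν B ≠ 0 := by
      by_contra! h
      have h1 := h 1
      have h2 := h (-1)
      rcases hν with h3 | h3
      · exact h3 (by linear_combination -(h1 + h2) / 2)
      · exact h3 (by linear_combination (h1 - h2) / 2)
    obtain ⟨Ψ, hd, hΨ⟩ := wit !![1, 0; u, 1] (by simp)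
    refine irredClosure_lt _ _ (mono h21) (closed 1 0 ν 0) ?_ (Φ := Ψ)
      ⟨_, const_mem_endSections _, hd, hΨ⟩ ?_
    · rintro Ξ ⟨g, ⟨hg3, g10⟩, hgd, hg⟩
      obtain ⟨-, e10, -⟩ := entries hg
      replace g10 : g 1 0 = 0 := g10
      rw [Matrix.det_fin_two, g10, mul_zero, sub_zero] at hgd
      obtain ⟨p, hp⟩ := exists_const_of_mem_endSections hg3 0 0
      obtain ⟨q, hq⟩ := exists_const_of_mem_endSections hg3 1 1
      have : (Ξ.1 : Mat) 1 0 = (q / p) • C := by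
        apply mul_right_cancel₀ (left_ne_zero_of_mul hgd)
        have hp0 : algebraMap ℂ RatField p ≠ 0 := hp ▸ left_ne_zero_of_mul hgd
        rw [g10, hp, hq] at e10
        rw [Algebra.smul_def, map_div₀, hp]
        field_simp
        linear_combination e10
      rw [Set.mem_ofPred_eq, this, map_smul, hνC, smul_zero, sub_zero]
    · intro h
      obtain ⟨-, e10, e11⟩ := entries hΨ
      simp at e10 e11
      have h2 : (Ψ.1 : Mat) 1 0 = C + u • (A - D) - u ^ 2 • B := by
        rw [Algebra.smul_def, Algebra.smul_def, map_pow]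
        linear_combination e10 - algebraMap ℂ RatField u * e11
      rw [Set.mem_ofPred_eq, h2, map_sub, map_add, map_smul, map_smul, hνC, sub_zero,
        zero_add] at h
      exact hu h
  have h1 := Order.height_add_one_le step₁
  have h2 := Order.height_add_one_le step₂
  have h3 := Order.height_add_one_le step₃
  calc (3 : ℕ∞) = 0 + 1 + 1 + 1 := by norm_num
    _ ≤ Order.height (irredClosure irr₀) + 1 + 1 + 1 := by gcongr; exact zero_le
    _ ≤ Order.height (irredClosure irr₁) + 1 + 1 := by gcongr
    _ ≤ Order.height (irredClosure irr₂) + 1 := by gcongr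
    _ ≤ _ := h3

theorem topologicalKrullDim_le_zero {n : ℕ}
    (hn : Module.finrank ℂ (higgsFields ![0, 0] d) = n + 3) :
    topologicalKrullDim (StableHiggsModConj ![0, 0] d) ≤ (n : WithBot ℕ∞) := by
  refine topologicalKrullDim_stableHiggsModConj_le hn fun Φ =>
    ⟨_, isIrreducible_conjugatesBy Φ le_rfl (endSections_one _ _), ?_, height_conjugatesBy Φ⟩
  rintro Ψ ⟨g, hg, hd, h⟩
  exact conjClass_eq_of_mul_eq_mul hg hd h

end Zero

/-! ### Invariant functions for `m = 0` -/

section ZeroLower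

variable {d : ℤ}

/-- A Higgs field with its entries replaced by their values under a linear functional. -/
def evalMatrix (l : RatField →ₗ[ℂ] ℂ) (v : higgsFields ![0, 0] d) : Matrix (Fin 2) (Fin 2) ℂ :=
  Matrix.of fun i j => l (entry ![0, 0] d i j v)

/-- The polynomial functions on the space of Higgs fields which are constant on conjugacy classes of
stable Higgs fields. -/
def invariantFunctions (a : Fin 2 → ℤ) (d : ℤ) : Subalgebra ℂ (higgsFields a d → ℂ) where
  carrier := {f | f ∈ polyFunctions (higgsFields a d) ∧
    ∀ Φ Ψ : StableHiggs a d, conjClass Φ = conjClass Ψ → f Φ.1 = f Ψ.1}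
  mul_mem' := fun hf hg => ⟨mul_mem hf.1 hg.1, fun Φ Ψ h => by
    rw [Pi.mul_apply, Pi.mul_apply, hf.2 Φ Ψ h, hg.2 Φ Ψ h]⟩
  add_mem' := fun hf hg => ⟨add_mem hf.1 hg.1, fun Φ Ψ h => by
    rw [Pi.add_apply, Pi.add_apply, hf.2 Φ Ψ h, hg.2 Φ Ψ h]⟩
  algebraMap_mem' := fun c => ⟨Subalgebra.algebraMap_mem _ c, fun _ _ _ => rfl⟩

/-- An invariant function which is constant on `T` but not on `T'` separates the closures of their
images. -/
lemma irredClosureImage_lt_of_invariant {a : Fin 2 → ℤ} {T T' : Set (StableHiggs a d)}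
    (hT : IsIrreducible T) (hT' : IsIrreducible T') (hsub : T ⊆ T') {f : higgsFields a d → ℂ}
    (hf : f ∈ invariantFunctions a d) {c : ℂ} (hc : ∀ Ψ ∈ T, f Ψ.1 = c) {Φ : StableHiggs a d}
    (hΦ : Φ ∈ T') (hΦc : f Φ.1 ≠ c) : irredClosureImage hT < irredClosureImage hT' := by
  refine irredClosureImage_lt hT hT' hsub (K := {Ψ | f Ψ.1 - c = 0})
    (isClosed_stableHiggs (f := fun v => f v - c) (sub_mem hf.1 (const_mem_polyFunctions c)))
    ?_ ?_ hΦ ?_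
  · intro Φ Ψ h hΦ
    rw [Set.mem_ofPred_eq, ← hf.2 Φ Ψ h]
    exact hΦ
  · intro Ψ hΨ
    rw [Set.mem_ofPred_eq, hc Ψ hΨ, sub_self]
  · intro h
    exact hΦc (sub_eq_zero.1 h)

/-- Conjugating a Higgs field by a constant matrix conjugates all its matrices of coefficients
simultaneously. -/
lemma exists_conj_evalMatrix {Φ Ψ : StableHiggs ![0, 0] d} (h : conjClass Φ = conjClass Ψ) :
    ∃ u : (Matrix (Fin 2) (Fin 2) ℂ)ˣ, ∀ l, evalMatrix l Ψ.1 =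
      (u : Matrix (Fin 2) (Fin 2) ℂ) * evalMatrix l Φ.1 * ((u⁻¹ : (Matrix (Fin 2) (Fin 2) ℂ)ˣ) :
        Matrix (Fin 2) (Fin 2) ℂ) := by
  obtain ⟨g, hg, hd, he⟩ := exists_mul_eq_mul_of_conjClass_eq h
  choose c hc using exists_const_of_mem_endSections hg
  have hgc : g = (Matrix.of c).map (algebraMap ℂ RatField) := by
    ext i j
    exact hc i j
  have hdet : (Matrix.of c).det ≠ 0 := by
    intro h0
    refine hd ?_
    rw [hgc, ← RingHom.mapMatrix_apply, ← RingHom.map_det, h0, map_zero]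
  obtain ⟨u, hu⟩ := (Matrix.isUnit_iff_isUnit_det _).2 (isUnit_iff_ne_zero.2 hdet)
  refine ⟨u, fun l => ?_⟩
  have hmul : evalMatrix l Ψ.1 * (u : Matrix (Fin 2) (Fin 2) ℂ) =
      (u : Matrix (Fin 2) (Fin 2) ℂ) * evalMatrix l Φ.1 := by
    ext i j
    have h1 := congrArg l (congrFun (congrFun he i) j)
    simp only [Matrix.mul_apply, Fin.sum_univ_two, hc] at h1
    rw [mul_comm (Ψ.1.1 i 0), mul_comm (Ψ.1.1 i 1)] at h1
    simp only [← Algebra.smul_def, map_add, map_smul, smul_eq_mul] at h1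
    simp only [Matrix.mul_apply, Fin.sum_univ_two, hu, Matrix.of_apply, evalMatrix]
    change l (Ψ.1.1 i 0) * c 0 j + l (Ψ.1.1 i 1) * c 1 j =
      c i 0 * l (Φ.1.1 0 j) + c i 1 * l (Φ.1.1 1 j)
    rw [← h1]
    ring
  rw [← hmul, mul_assoc, Units.mul_inv, mul_one]

/-- The traces of words in the matrices of coefficients are invariant functions. -/
lemma trace_prod_mem_invariantFunctions (ls : List (RatField →ₗ[ℂ] ℂ)) :
    (fun v => ((ls.map fun l => evalMatrix l v).prod).trace) ∈
      invariantFunctions ![0, 0] d := by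
  constructor
  · have key : ∀ i j, (fun v : higgsFields ![0, 0] d =>
        ((ls.map fun l => evalMatrix l v).prod) i j) ∈ polyFunctions (higgsFields ![0, 0] d) := by
      induction ls with
      | nil =>
        intro i j
        exact const_mem_polyFunctions _
      | cons l ls ih =>
        intro i j
        have h1 := fun k => mul_mem
          (dual_mem_polyFunctions (l.comp (entry ![0, 0] d i k))) (ih k j)
        convert add_mem (h1 0) (h1 1) using 1
        ext v
        simp [Matrix.mul_apply, evalMatrix]
    convert add_mem (key 0 0) (key 1 1) using 1
    ext v
    simp [Matrix.trace_fin_two]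
  · intro Φ Ψ h
    obtain ⟨u, hu⟩ := exists_conj_evalMatrix h
    have hprod : (ls.map fun l => evalMatrix l Ψ.1).prod =
        (u : Matrix (Fin 2) (Fin 2) ℂ) * (ls.map fun l => evalMatrix l Φ.1).prod *
          ((u⁻¹ : (Matrix (Fin 2) (Fin 2) ℂ)ˣ) : Matrix (Fin 2) (Fin 2) ℂ) := by
      induction ls with
      | nil => simp
      | cons l ls ih =>
        rw [List.map_cons, List.prod_cons, ih, hu l, List.map_cons, List.prod_cons]
        simp only [mul_assoc, Units.inv_mul_cancel_left]
    change Matrix.trace _ = Matrix.trace _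
    rw [hprod, Matrix.trace_units_conj]

/-- A constant vector spanning an invariant sub-line bundle is a common eigenvector of all matrices
of coefficients. A diagonal matrix with distinct eigenvalues and a matrix with non-zero
off-diagonal entries have none. -/
lemma isStable_of_evalMatrix {Φ : higgsFields ![0, 0] d} (l l' : RatField →ₗ[ℂ] ℂ)
    (h01 : evalMatrix l Φ 0 1 = 0) (h10 : evalMatrix l Φ 1 0 = 0)
    (hne : evalMatrix l Φ 0 0 ≠ evalMatrix l Φ 1 1)
    (h01' : evalMatrix l' Φ 0 1 ≠ 0) (h10' : evalMatrix l' Φ 1 0 ≠ 0) :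
    IsStable ![0, 0] d (Φ : Mat) := by
  refine isStable_zero_of_forall fun s hs lam h => hs ?_
  have key : ∀ (l : RatField →ₗ[ℂ] ℂ) (i : Fin 2),
      evalMatrix l Φ i 0 * s 0 + evalMatrix l Φ i 1 * s 1 = l lam * s i := by
    intro l i
    have h1 := congrArg l (congrFun h i)
    simp only [Matrix.mulVec, dotProduct, Fin.sum_univ_two, Pi.smul_apply, smul_eq_mul] at h1
    rw [mul_comm (Φ.1 i 0), mul_comm (Φ.1 i 1), mul_comm lam] at h1
    simp only [← Algebra.smul_def, map_add, map_smul, smul_eq_mul] at h1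
    change l (Φ.1 i 0) * s 0 + l (Φ.1 i 1) * s 1 = l lam * s i
    rw [mul_comm (l lam), ← h1]
    ring
  have e0 := key l 0
  have e1 := key l 1
  have f0 := key l' 0
  have f1 := key l' 1
  rw [h01] at e0
  rw [h10] at e1
  have hprod : s 0 * s 1 = 0 := by
    have : (evalMatrix l Φ 0 0 - evalMatrix l Φ 1 1) * (s 0 * s 1) = 0 := by
      linear_combination s 1 * e0 - s 0 * e1
    exact (mul_eq_zero.1 this).resolve_left (sub_ne_zero.2 hne)
  rcases mul_eq_zero.1 hprod with h0 | h0
  · rw [h0] at f0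
    have h1 : s 1 = 0 := by simpa [h01'] using f0
    ext i
    fin_cases i
    · exact h0
    · exact h1
  · rw [h0] at f1
    have h1 : s 0 = 0 := by simpa [h10'] using f1
    ext i
    fin_cases i
    · exact h1
    · exact h0

/-- A linear functional on Higgs fields which vanishes on `L` but not at `v`, written as a sum of
functionals of the entries. -/
lemma exists_functional_of_notMem {L : Submodule ℂ (higgsFields ![0, 0] d)}
    {v : higgsFields ![0, 0] d} (hv : v ∉ L) :
    ∃ η : Fin 2 → Fin 2 → RatField →ₗ[ℂ] ℂ,
      (∀ w ∈ L, ∑ i, ∑ j, evalMatrix (η i j) w i j = 0) ∧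
        ∑ i, ∑ j, evalMatrix (η i j) v i j ≠ 0 := by
  have hv' : (v : Mat) ∉ L.map (higgsFields ![0, 0] d).subtype := by
    rintro ⟨w, hw, h⟩
    rw [← Subtype.ext h] at hv
    exact hv hw
  obtain ⟨η, hη, hker⟩ := Submodule.exists_le_ker_of_notMem hv'
  have hsum : ∀ w : higgsFields ![0, 0] d, ∑ i, ∑ j,
      evalMatrix (η.comp (Matrix.singleLinearMap ℂ i j)) w i j = η w := by
    intro w
    conv_rhs => rw [Matrix.matrix_eq_sum_single (w : Mat)]
    simp only [map_sum]
    rfl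
  refine ⟨fun i j => η.comp (Matrix.singleLinearMap ℂ i j), fun w hw => ?_, ?_⟩
  · rw [hsum]
    exact hker ⟨w, hw, rfl⟩
  · rwa [hsum]

end ZeroLower

/-! ### The lower bound for `m = 0` -/

section ZeroChain

variable {d : ℤ}

set_option maxHeartbeats 1600000 in
/-- Write `Y` and `X` for the matrices of coefficients of a Higgs field at two independent sections
of `𝒪(d)`. The chain consists of the images of affine spaces of Higgs fields with `Y` diagonal and
`X 0 1 = 1`, a slice for the action of `GL₂(ℂ)` by conjugation. First all coefficients other than
`Y` and `X` vary, then the five remaining entries of `Y` and `X`; the traces of words in the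
matrices of coefficients tell the affine spaces apart. -/
theorem le_topologicalKrullDim_zero (hd : 2 ≤ Module.finrank ℂ (sections Set.univ d)) {n : ℕ}
    (hn : Module.finrank ℂ (higgsFields ![0, 0] d) = n + 3) :
    (n : WithBot ℕ∞) ≤ topologicalKrullDim (StableHiggsModConj ![0, 0] d) := by
  -- two sections of `𝒪(d)`, and functionals dual to them
  obtain ⟨h, h', l, l', hh, hh', e1, e2, e3, e4⟩ : ∃ (h h' : RatField) (l l' : RatField →ₗ[ℂ] ℂ),
      h ∈ sections Set.univ d ∧ h' ∈ sections Set.univ d ∧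
      l h = 1 ∧ l h' = 0 ∧ l' h = 0 ∧ l' h' = 1 := by
    let b := Module.finBasis ℂ (sections Set.univ d)
    let i₀ : Fin (Module.finrank ℂ (sections Set.univ d)) := ⟨0, by omega⟩
    let i₁ : Fin (Module.finrank ℂ (sections Set.univ d)) := ⟨1, by omega⟩
    have hne : i₀ ≠ i₁ := by simp [i₀, i₁]
    obtain ⟨l, hl⟩ := LinearMap.exists_extend (b.coord i₀)
    obtain ⟨l', hl'⟩ := LinearMap.exists_extend (b.coord i₁)
    have hl := fun v => LinearMap.congr_fun hl v
    have hl' := fun v => LinearMap.congr_fun hl' v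
    simp only [LinearMap.comp_apply, Submodule.subtype_apply, Module.Basis.coord_apply] at hl hl'
    refine ⟨b i₀, b i₁, l, l', (b i₀).2, (b i₁).2, ?_, ?_, ?_, ?_⟩
    · simp [hl]
    · simp [hl, hne]
    · simp [hl', hne.symm]
    · simp [hl']
  let mk (Y X : Matrix (Fin 2) (Fin 2) ℂ) : higgsFields ![0, 0] d :=
    ⟨Matrix.of fun i j => Y i j • h + X i j • h', fun i j => by
      rw [weight_sub_add_eq]
      exact add_mem (Submodule.smul_mem _ _ hh) (Submodule.smul_mem _ _ hh')⟩
  have hmkY : ∀ Y X, evalMatrix l (mk Y X) = Y := by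
    intro Y X
    ext i j
    change l (Y i j • h + X i j • h') = Y i j
    simp [e1, e2]
  have hmkX : ∀ Y X, evalMatrix l' (mk Y X) = X := by
    intro Y X
    ext i j
    change l' (Y i j • h + X i j • h') = X i j
    simp [e3, e4]
  have heval_add : ∀ (l : RatField →ₗ[ℂ] ℂ) (v w : higgsFields ![0, 0] d),
      evalMatrix l (v + w) = evalMatrix l v + evalMatrix l w := by
    intro l v w
    ext i j
    simp [evalMatrix]
  let z := mk !![1, 0; 0, -1] !![0, 1; 1, 0]
  let y : Fin 2 → Fin 2 → Module.Dual ℂ (higgsFields ![0, 0] d) :=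
    fun i j => l.comp (entry ![0, 0] d i j)
  let x : Fin 2 → Fin 2 → Module.Dual ℂ (higgsFields ![0, 0] d) :=
    fun i j => l'.comp (entry ![0, 0] d i j)
  have hyz : ∀ i j, y i j z = !![1, 0; 0, -1] i j := fun i j => congrFun (congrFun (hmkY _ _) i) j
  have hxz : ∀ i j, x i j z = !![0, 1; 1, 0] i j := fun i j => congrFun (congrFun (hmkX _ _) i) j
  let χ := y 0 0 - y 1 1
  let χ' := x 1 0
  -- the freedom of conjugation is used up by normalizing `Y` to be diagonal and `X 0 1 = 1`
  let L₅ := LinearMap.ker (x 0 1) ⊓ LinearMap.ker (y 0 1) ⊓ LinearMap.ker (y 1 0)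
  let L₄ := L₅ ⊓ LinearMap.ker (y 0 0 - y 1 1)
  let L₃ := L₄ ⊓ LinearMap.ker (x 0 0 - x 1 1)
  let L₂ := L₃ ⊓ LinearMap.ker (y 0 0 + y 1 1)
  let L₁ := L₂ ⊓ LinearMap.ker (x 0 0 + x 1 1)
  let L₀ := L₁ ⊓ LinearMap.ker (x 1 0)
  have h45 : L₄ ≤ L₅ := inf_le_left
  have h34 : L₃ ≤ L₄ := inf_le_left
  have h23 : L₂ ≤ L₃ := inf_le_left
  have h12 : L₁ ≤ L₂ := inf_le_left
  have h01 : L₀ ≤ L₁ := inf_le_left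
  have hY : ∀ v, evalMatrix l v = !![y 0 0 v, y 0 1 v; y 1 0 v, y 1 1 v] := by
    intro v
    ext i j
    fin_cases i <;> fin_cases j <;> rfl
  have hX : ∀ v, evalMatrix l' v = !![x 0 0 v, x 0 1 v; x 1 0 v, x 1 1 v] := by
    intro v
    ext i j
    fin_cases i <;> fin_cases j <;> rfl
  have hYX₅ : ∀ v, v - z ∈ L₅ → x 0 1 v = 1 ∧ y 0 1 v = 0 ∧ y 1 0 v = 0 := by
    rintro v ⟨⟨h1, h2⟩, h3⟩
    rw [SetLike.mem_coe, LinearMap.mem_ker, map_sub, sub_eq_zero] at h1 h2 h3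
    rw [h1, h2, h3, hxz, hyz, hyz]
    simp
  have hstable : ∀ v, v - z ∈ L₅ → χ v ≠ 0 → χ' v ≠ 0 →
      IsStable ![0, 0] d (v : Mat) := by
    intro v hv h1 h2
    obtain ⟨a1, a2, a3⟩ := hYX₅ v hv
    exact isStable_of_evalMatrix l l' a2 a3 (sub_ne_zero.1 h1)
      (by change x 0 1 v ≠ 0; rw [a1]; exact one_ne_zero) h2
  have hχz : χ z ≠ 0 := by
    change y 0 0 z - y 1 1 z ≠ 0
    rw [hyz, hyz]
    norm_num
  have hχz' : χ' z ≠ 0 := by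
    change x 1 0 z ≠ 0
    rw [hxz]
    norm_num
  have hirr := fun L => isIrreducible_affinePiece hχz hχz' (L := L ⊓ L₅)
    fun v hv => hstable v hv.2
  let f := fun L => irredClosureImage (hirr L)
  have hpoint : ∀ {L : Submodule ℂ (higgsFields ![0, 0] d)} (v : higgsFields ![0, 0] d),
      v - z ∈ L ⊓ L₅ → χ v ≠ 0 → χ' v ≠ 0 → ∃ Φ ∈ affinePiece z χ χ' (L ⊓ L₅), Φ.1 = v :=
    fun v hv h1 h2 => ⟨⟨v, hstable v hv.2 h1 h2⟩, ⟨hv, h1, h2⟩, rfl⟩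
  have inv₁ := fun l₁ => trace_prod_mem_invariantFunctions (d := d) [l₁]
  have inv₂ := fun l₁ l₂ => trace_prod_mem_invariantFunctions (d := d) [l₁, l₂]
  have inv₃ := fun l₁ l₂ l₃ => trace_prod_mem_invariantFunctions (d := d) [l₁, l₂, l₃]
  simp only [List.map_cons, List.map_nil, List.prod_cons, List.prod_nil, mul_one] at inv₁ inv₂ inv₃
  -- twice the trace form on trace-free parts
  let q (l₁ l₂ : RatField →ₗ[ℂ] ℂ) (v : higgsFields ![0, 0] d) : ℂ :=
    2 * (evalMatrix l₁ v * evalMatrix l₂ v).trace -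
      (evalMatrix l₁ v).trace * (evalMatrix l₂ v).trace
  have hq : ∀ l₁ l₂, q l₁ l₂ ∈ invariantFunctions ![0, 0] d := by
    intro l₁ l₂
    have := sub_mem (Subalgebra.smul_mem _ (inv₂ l₁ l₂) (2 : ℂ)) (mul_mem (inv₁ l₁) (inv₁ l₂))
    exact this
  -- enlarging the affine space by one dimension
  have hstep : ∀ {L L' : Submodule ℂ (higgsFields ![0, 0] d)} {F : higgsFields ![0, 0] d → ℂ}
      (c : ℂ) (Y X : Matrix (Fin 2) (Fin 2) ℂ), L ≤ L' → L' ≤ L₅ →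
      F ∈ invariantFunctions ![0, 0] d →
      (∀ v, v - z ∈ L → F v = c) → mk Y X - z ∈ L' → Y 0 0 - Y 1 1 ≠ 0 → X 1 0 ≠ 0 →
      F (mk Y X) ≠ c → Order.height (f L) + 1 ≤ Order.height (f L') := by
    intro L L' F c Y X hL hL' hF hc hmem hY' hX' hne
    refine Order.height_add_one_le ?_
    obtain ⟨Φ, hΦ, hΦe⟩ := hpoint (L := L') (mk Y X) ⟨hmem, hL' hmem⟩
      (by change evalMatrix l (mk Y X) 0 0 - evalMatrix l (mk Y X) 1 1 ≠ 0; rwa [hmkY])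
      (by change evalMatrix l' (mk Y X) 1 0 ≠ 0; rwa [hmkX])
    exact irredClosureImage_lt_of_invariant _ _ (affinePiece_mono (inf_le_inf_right _ hL)) hF
      (fun Ψ hΨ => hc _ hΨ.1.1) hΦ (by rwa [hΦe])
  have hymk : ∀ Y X i j, y i j (mk Y X) = Y i j := fun Y X i j =>
    congrFun (congrFun (hmkY Y X) i) j
  have hxmk : ∀ Y X i j, x i j (mk Y X) = X i j := fun Y X i j =>
    congrFun (congrFun (hmkX Y X) i) j
  -- the entries of `Y` and `X` on `z + L` for the various subspaces `L`
  have hv₄ : ∀ v, v - z ∈ L₄ → y 0 0 v - y 1 1 v = 2 := by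
    rintro v ⟨-, h⟩
    rw [SetLike.mem_coe, LinearMap.mem_ker, map_sub, sub_eq_zero] at h
    change y 0 0 v - y 1 1 v = y 0 0 z - y 1 1 z at h
    rw [h, hyz, hyz]
    norm_num
  have hv₃ : ∀ v, v - z ∈ L₃ → x 0 0 v = x 1 1 v := by
    rintro v ⟨-, h⟩
    rw [SetLike.mem_coe, LinearMap.mem_ker, map_sub, sub_eq_zero] at h
    change x 0 0 v - x 1 1 v = x 0 0 z - x 1 1 z at h
    rw [hxz, hxz] at h
    simpa [sub_eq_zero] using h
  have hv₂ : ∀ v, v - z ∈ L₂ → y 0 0 v + y 1 1 v = 0 := by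
    rintro v ⟨-, h⟩
    rw [SetLike.mem_coe, LinearMap.mem_ker, map_sub, sub_eq_zero] at h
    change y 0 0 v + y 1 1 v = y 0 0 z + y 1 1 z at h
    rw [h, hyz, hyz]
    simp
  have hv₁ : ∀ v, v - z ∈ L₁ → x 0 0 v + x 1 1 v = 0 := by
    rintro v ⟨-, h⟩
    rw [SetLike.mem_coe, LinearMap.mem_ker, map_sub, sub_eq_zero] at h
    change x 0 0 v + x 1 1 v = x 0 0 z + x 1 1 z at h
    rw [h, hxz, hxz]
    simp
  have hv₀ : ∀ v, v - z ∈ L₀ → x 1 0 v = 1 := by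
    rintro v ⟨-, h⟩
    rw [SetLike.mem_coe, LinearMap.mem_ker, map_sub, sub_eq_zero, hxz] at h
    exact h
  have step₄ : Order.height (f L₄) + 1 ≤ Order.height (f L₅) := by
    refine hstep 4 !![2, 0; 0, -2] !![0, 1; 1, 0] h45 le_rfl (hq l l) (fun v hv => ?_) ?_ ?_ ?_ ?_
    · obtain ⟨-, a1, a2⟩ := hYX₅ v (h45 hv)
      have a3 := hv₄ v hv
      simp only [q, hY, Matrix.trace_fin_two, Matrix.mul_apply, Fin.sum_univ_two, Matrix.of_apply,
        Matrix.cons_val_zero, Matrix.cons_val_one, a1, a2]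
      linear_combination (y 0 0 v - y 1 1 v + 2) * a3
    · simp [L₅, z, hymk, hxmk]
    · norm_num
    · norm_num
    · simp [q, hmkY, Matrix.trace_fin_two, Matrix.mul_apply, Fin.sum_univ_two]
      norm_num
  have step₃ : Order.height (f L₃) + 1 ≤ Order.height (f L₄) := by
    refine hstep 0 !![1, 0; 0, -1] !![1, 1; 1, -1] h34 h45 (hq l l') (fun v hv => ?_) ?_ ?_ ?_ ?_
    · obtain ⟨-, a1, a2⟩ := hYX₅ v (h45 (h34 hv))
      have a3 := hv₃ v hv
      simp only [q, hY, hX, Matrix.trace_fin_two, Matrix.mul_apply, Fin.sum_univ_two,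
        Matrix.of_apply, Matrix.cons_val_zero, Matrix.cons_val_one, a1, a2]
      linear_combination (y 0 0 v - y 1 1 v) * a3
    · simp [L₅, L₄, z, hymk, hxmk]
    · norm_num
    · norm_num
    · simp [q, hmkY, hmkX, Matrix.trace_fin_two, Matrix.mul_apply, Fin.sum_univ_two]
  have step₂ : Order.height (f L₂) + 1 ≤ Order.height (f L₃) := by
    refine hstep 0 !![2, 0; 0, 0] !![0, 1; 1, 0] h23 (h34.trans h45) (inv₁ l) (fun v hv => ?_)
      ?_ ?_ ?_ ?_
    · have a3 := hv₂ v hv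
      simpa [hY, Matrix.trace_fin_two] using a3
    · simp [L₅, L₄, L₃, z, hymk, hxmk]
      norm_num
    · norm_num
    · norm_num
    · simp [hmkY, Matrix.trace_fin_two]
  have step₁ : Order.height (f L₁) + 1 ≤ Order.height (f L₂) := by
    refine hstep 0 !![1, 0; 0, -1] !![1, 1; 1, 1] h12 (h23.trans (h34.trans h45)) (inv₁ l')
      (fun v hv => ?_) ?_ ?_ ?_ ?_
    · have a3 := hv₁ v hv
      simpa [hX, Matrix.trace_fin_two] using a3
    · simp [L₅, L₄, L₃, L₂, z, hymk, hxmk]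
    · norm_num
    · norm_num
    · simp [hmkX, Matrix.trace_fin_two]
  have hXY₀ : ∀ v, v - z ∈ L₀ → evalMatrix l v = !![1, 0; 0, -1] ∧
      evalMatrix l' v = !![0, 1; 1, 0] := by
    intro v hv
    obtain ⟨a0, a1, a2⟩ := hYX₅ v (h45 (h34 (h23 (h12 (h01 hv)))))
    have a3 := hv₀ v hv
    have a4 := hv₁ v (h01 hv)
    have a5 := hv₂ v (h12 (h01 hv))
    have a6 := hv₃ v (h23 (h12 (h01 hv)))
    have a7 := hv₄ v (h34 (h23 (h12 (h01 hv))))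
    have b1 : y 0 0 v = 1 := by linear_combination (a5 + a7) / 2
    have b2 : y 1 1 v = -1 := by linear_combination (a5 - a7) / 2
    have b3 : x 0 0 v = 0 := by linear_combination (a4 + a6) / 2
    have b4 : x 1 1 v = 0 := by linear_combination (a4 - a6) / 2
    rw [hY, hX, a0, a1, a2, a3, b1, b2, b3, b4]
    exact ⟨rfl, rfl⟩
  have step₀ : Order.height (f L₀) + 1 ≤ Order.height (f L₁) := by
    refine hstep 4 !![1, 0; 0, -1] !![0, 1; 2, 0] h01 (h12.trans (h23.trans (h34.trans h45)))
      (hq l' l') (fun v hv => ?_) ?_ ?_ ?_ ?_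
    · simp only [q, (hXY₀ v hv).2]
      simp [Matrix.trace_fin_two]
      norm_num
    · simp [L₅, L₄, L₃, L₂, L₁, z, hymk, hxmk]
    · norm_num
    · norm_num
    · simp [q, hmkX, Matrix.trace_fin_two]
      norm_num
  -- on `z + L₀` the matrices `X` and `Y` are fixed and generate all matrices, so that traces
  -- against words in `X` and `Y` recover all entries of the Higgs field
  have stage : ∀ K₁ K₂, ⊥ ≤ K₁ → K₁ < K₂ → K₂ ≤ L₀ → f K₁ < f K₂ := by
    intro K₁ K₂ _ hlt hle
    obtain ⟨v, hv₂, hv₁⟩ := SetLike.exists_of_lt hlt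
    obtain ⟨η, hη, hηv⟩ := exists_functional_of_notMem hv₁
    let F : higgsFields ![0, 0] d → ℂ := fun w =>
      (evalMatrix (η 0 0) w).trace + (evalMatrix l w * evalMatrix (η 0 0) w).trace +
      ((evalMatrix (η 1 1) w).trace - (evalMatrix l w * evalMatrix (η 1 1) w).trace) +
      ((evalMatrix l' w * evalMatrix (η 0 1) w).trace +
        (evalMatrix l' w * (evalMatrix l w * evalMatrix (η 0 1) w)).trace) +
      ((evalMatrix l' w * evalMatrix (η 1 0) w).trace -
        (evalMatrix l' w * (evalMatrix l w * evalMatrix (η 1 0) w)).trace)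
    have hF : F ∈ invariantFunctions ![0, 0] d :=
      add_mem (add_mem (add_mem (add_mem (inv₁ _) (inv₂ _ _)) (sub_mem (inv₁ _) (inv₂ _ _)))
        (add_mem (inv₂ _ _) (inv₃ _ _ _))) (sub_mem (inv₂ _ _) (inv₃ _ _ _))
    have hval : ∀ v, v - z ∈ L₀ → F v = 2 * ∑ i, ∑ j, evalMatrix (η i j) v i j := by
      intro v hv
      simp only [F, (hXY₀ v hv).1, (hXY₀ v hv).2]
      simp only [Matrix.trace_fin_two, Matrix.mul_apply, Fin.sum_univ_two, Matrix.of_apply,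
        Matrix.cons_val', Matrix.cons_val_zero, Matrix.cons_val_one, Matrix.cons_val_fin_one]
      ring
    have hsum : ∀ v, ∑ i, ∑ j, evalMatrix (η i j) v i j =
        ∑ i, ∑ j, evalMatrix (η i j) z i j + ∑ i, ∑ j, evalMatrix (η i j) (v - z) i j := by
      intro v
      conv_lhs => rw [← add_sub_cancel z v]
      simp only [heval_add, Matrix.add_apply, Finset.sum_add_distrib]
    have hvL : z + v - z ∈ L₀ := by
      rw [add_sub_cancel_left]
      exact hle hv₂
    have hXY := hXY₀ _ hvL
    obtain ⟨Φ, hΦ, hΦe⟩ := hpoint (L := K₂) (z + v)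
      (by rw [add_sub_cancel_left]; exact ⟨hv₂, h45 (h34 (h23 (h12 (h01 (hle hv₂)))))⟩)
      (by
        change evalMatrix l (z + v) 0 0 - evalMatrix l (z + v) 1 1 ≠ 0
        rw [hXY.1]
        norm_num)
      (by
        change evalMatrix l' (z + v) 1 0 ≠ 0
        rw [hXY.2]
        norm_num)
    refine irredClosureImage_lt_of_invariant _ _ (affinePiece_mono (inf_le_inf_right _ hlt.le)) hF
      (c := 2 * ∑ i, ∑ j, evalMatrix (η i j) z i j) (fun Ψ hΨ => ?_) hΦ ?_
    · rw [hval _ (hle (hlt.le hΨ.1.1)), hsum, hη _ hΨ.1.1, add_zero]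
    · rw [hΦe, hval _ hvL, hsum, add_sub_cancel_left, mul_add]
      simpa using hηv
  have hheight : (Module.finrank ℂ L₀ : ℕ∞) ≤ Order.height (f L₀) :=
    finrank_le_height_of_stage f bot_le (by simp) stage
  have hdim : n ≤ Module.finrank ℂ L₀ + 5 := by
    -- all eight entries of `Y` and `X` vanish on the kernel of `ψ`, hence it is contained in `L₀`
    let ψ : higgsFields ![0, 0] d →ₗ[ℂ] (Fin 2 → Fin 2 → ℂ) × (Fin 2 → Fin 2 → ℂ) :=
      (LinearMap.pi fun i => LinearMap.pi fun j => y i j).prod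
        (LinearMap.pi fun i => LinearMap.pi fun j => x i j)
    have hker : LinearMap.ker ψ ≤ L₀ := by
      intro v hv
      have h1 : ∀ i j, y i j v = 0 := fun i j =>
        congrFun (congrFun (congrArg Prod.fst (LinearMap.mem_ker.1 hv)) i) j
      have h2 : ∀ i j, x i j v = 0 := fun i j =>
        congrFun (congrFun (congrArg Prod.snd (LinearMap.mem_ker.1 hv)) i) j
      simp [L₀, L₁, L₂, L₃, L₄, L₅, h1, h2]
    have h1 := LinearMap.finrank_range_add_finrank_ker ψ
    have h2 : Module.finrank ℂ (LinearMap.range ψ) ≤ 8 :=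
      (Submodule.finrank_le _).trans (by simp [Module.finrank_pi_fintype])
    have h4 := Submodule.finrank_mono hker
    omega
  calc (n : WithBot ℕ∞) ≤ ((Module.finrank ℂ L₀ + 5 : ℕ) : ℕ∞) := by exact_mod_cast hdim
    _ = ((Module.finrank ℂ L₀ + 1 + 1 + 1 + 1 + 1 : ℕ∞) : WithBot ℕ∞) := by push_cast; norm_num; rfl
    _ ≤ Order.height (f L₅) := WithBot.coe_le_coe.2 <| by
      refine le_trans ?_ step₄
      gcongr
      refine le_trans ?_ step₃
      gcongr
      refine le_trans ?_ step₂
      gcongr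
      refine le_trans ?_ step₁
      gcongr
      refine le_trans ?_ step₀
      gcongr
    _ ≤ _ := Order.height_le_krullDim _

end ZeroChain

/-! ### Numerical evaluation -/

lemma cast_choose_add_two (n : ℕ) : (((n + 2).choose 2 : ℕ) : ℚ) = (n + 1) * (n + 2) / 2 := by
  rw [Nat.cast_choose_two]
  push_cast
  ring

lemma exists_sections_ne_zero (n : ℕ) : ∃ f ∈ sections Set.univ (n : ℤ), f ≠ 0 := by
  have h : 0 < Module.finrank ℂ (sections Set.univ (n : ℤ)) := by
    rw [finrank_sections]
    exact Nat.choose_pos (by omega)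
  obtain ⟨f, hf⟩ := (Module.finrank_pos_iff_exists_ne_zero).1 h
  exact ⟨f, f.2, fun h => hf (Subtype.ext h)⟩

lemma finrank_endSections_split (m k : ℤ) :
    Module.finrank ℂ (endSections ![0, m] Set.univ k) =
      2 * Module.finrank ℂ (sections Set.univ k) + Module.finrank ℂ (sections Set.univ (k - m)) +
      Module.finrank ℂ (sections Set.univ (k + m)) := by
  have e0 : (![0, m] : Fin 2 → ℤ) 0 - (![0, m] : Fin 2 → ℤ) 0 + k = k := by simp
  have e1 : (![0, m] : Fin 2 → ℤ) 0 - (![0, m] : Fin 2 → ℤ) 1 + k = k - m := by simp; ring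
  have e2 : (![0, m] : Fin 2 → ℤ) 1 - (![0, m] : Fin 2 → ℤ) 0 + k = k + m := by simp; ring
  have e3 : (![0, m] : Fin 2 → ℤ) 1 - (![0, m] : Fin 2 → ℤ) 1 + k = k := by simp
  rw [finrank_endSections, e0, e1, e2, e3]
  ring

lemma finrank_endSections₀_split (m k : ℤ) :
    Module.finrank ℂ (endSections₀ ![0, m] Set.univ k) =
      Module.finrank ℂ (sections Set.univ k) + Module.finrank ℂ (sections Set.univ (k - m)) +
      Module.finrank ℂ (sections Set.univ (k + m)) := by
  have e1 : (![0, m] : Fin 2 → ℤ) 0 - (![0, m] : Fin 2 → ℤ) 1 + k = k - m := by simp; ring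
  have e2 : (![0, m] : Fin 2 → ℤ) 1 - (![0, m] : Fin 2 → ℤ) 0 + k = k + m := by simp; ring
  rw [finrank_endSections₀, e1, e2, add_assoc]

end VafaWitten

end

theorem mainTheorem10 (d m : ℕ) (hmd : m ≤ d) :
    (0 < d →
      ∃ N : ℕ,
        topologicalKrullDim (VafaWitten.StableHiggsModConj ![0, (m : ℤ)] d) = (N : WithBot ℕ∞) ∧
        (m = 0 → (N : ℚ) = 2 * (d : ℚ) ^ 2 + 6 * d + 1) ∧
        (0 < m → (N : ℚ) = 2 * (d : ℚ) ^ 2 + 6 * d + 1 / 2 * m * ((m : ℚ) - 3) + 2)) ∧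
    (∀ Φ ∈ VafaWitten.endSections₀ ![0, (m : ℤ)] Set.univ d,
      VafaWitten.IsStable ![0, (m : ℤ)] d Φ →
        Module.Finite ℂ (VafaWitten.ZariskiTangentSpace ![0, (m : ℤ)] d Φ) ∧
        (m = 0 → (Module.finrank ℂ (VafaWitten.ZariskiTangentSpace ![0, (m : ℤ)] d Φ) : ℚ) =
          3 / 2 * d * ((d : ℚ) + 3)) ∧
        (0 < m → (Module.finrank ℂ (VafaWitten.ZariskiTangentSpace ![0, (m : ℤ)] d Φ) : ℚ) =
          3 / 2 * d * ((d : ℚ) + 3) + 1 / 2 * m * ((m : ℚ) - 3) + 1)) := by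
  obtain ⟨e, rfl⟩ := Nat.exists_eq_add_of_le hmd
  have hsub : ((m + e : ℕ) : ℤ) - m = (e : ℤ) := by push_cast; ring
  have hadd : ((m + e : ℕ) : ℤ) + m = ((m + m + e : ℕ) : ℤ) := by push_cast; ring
  have hd := VafaWitten.finrank_sections (m + e)
  have c₀ := VafaWitten.cast_choose_add_two (m + e)
  have c₁ := VafaWitten.cast_choose_add_two e
  have c₂ := VafaWitten.cast_choose_add_two (m + m + e)
  have c₃ := VafaWitten.cast_choose_add_two m
  push_cast at c₀ c₁ c₂ c₃
  refine ⟨fun hpos => ?_, fun Φ hΦ hs => ?_⟩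
  · have hV : Module.finrank ℂ (VafaWitten.higgsFields ![0, (m : ℤ)] ((m + e : ℕ) : ℤ)) =
        2 * (m + e + 2).choose 2 + (e + 2).choose 2 + (m + m + e + 2).choose 2 := by
      rw [VafaWitten.finrank_endSections_split, hsub, hadd]
      simp only [VafaWitten.finrank_sections]
    rcases Nat.eq_zero_or_pos m with rfl | hm
    · have h3 : 3 ≤ (0 + e + 2).choose 2 := by
        calc 3 = (1 + 2).choose 2 := by decide
          _ ≤ _ := Nat.choose_le_choose 2 (by omega)
      obtain ⟨N, hN⟩ := Nat.exists_eq_add_of_le' (show 3 ≤ Module.finrank ℂ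
        (VafaWitten.higgsFields ![0, ((0 : ℕ) : ℤ)] ((0 + e : ℕ) : ℤ)) by omega)
      refine ⟨N, ?_, fun _ => ?_, fun h => absurd h (lt_irrefl 0)⟩
      · exact le_antisymm (VafaWitten.topologicalKrullDim_le_zero hN)
          (VafaWitten.le_topologicalKrullDim_zero (by omega) hN)
      · rw [hV] at hN
        have hN' := congrArg (Nat.cast (R := ℚ)) hN
        simp only [Nat.cast_add, Nat.cast_mul, c₀, c₁] at hN'
        push_cast at hN' ⊢
        linear_combination -hN'
    · have hle : (m + 2).choose 2 ≤ (m + e + 2).choose 2 := Nat.choose_le_choose 2 (by omega)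
      have hp := Nat.choose_pos (show 2 ≤ e + 2 by omega)
      obtain ⟨N, hN⟩ := Nat.exists_eq_add_of_le'
        (show 1 + Module.finrank ℂ (VafaWitten.sections Set.univ (m : ℤ)) ≤
          Module.finrank ℂ (VafaWitten.higgsFields ![0, (m : ℤ)] ((m + e : ℕ) : ℤ)) by
          rw [VafaWitten.finrank_sections]; omega)
      obtain ⟨B, hB, hB0⟩ := VafaWitten.exists_sections_ne_zero e
      have hm' : (0 : ℤ) < m := by exact_mod_cast hm
      refine ⟨N, le_antisymm (VafaWitten.topologicalKrullDim_le_of_pos hm' hN)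
        (VafaWitten.le_topologicalKrullDim_of_pos hm' (B₀ := B) ?_ hB0 hN),
        fun h => absurd h hm.ne', fun _ => ?_⟩
      · rwa [hsub]
      · rw [hV, VafaWitten.finrank_sections] at hN
        have hN' := congrArg (Nat.cast (R := ℚ)) hN
        push_cast at hN' ⊢
        rw [c₀, c₁, c₂, c₃] at hN'
        linear_combination -hN'
  · obtain ⟨hfin, h⟩ := VafaWitten.finite_and_finrank_zariskiTangentSpace
      (Int.natCast_nonneg m) hΦ.1 hs
    have h0 : Module.finrank ℂ (VafaWitten.sections Set.univ (0 : ℤ)) = 1 :=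
      VafaWitten.finrank_sections 0
    rw [VafaWitten.finrank_endSections₀_split, VafaWitten.finrank_endSections₀_split, hsub, hadd,
      zero_add, h0] at h
    simp only [VafaWitten.finrank_sections] at h
    refine ⟨hfin, ?_, fun hm => ?_⟩
    · rintro rfl
      have h1 : Module.finrank ℂ (VafaWitten.sections Set.univ (0 - ((0 : ℕ) : ℤ))) = 1 := h0
      rw [h1] at h
      have h' := congrArg (Nat.cast (R := ℚ)) h
      simp only [Nat.cast_add, c₀, c₁, c₃] at h'
      push_cast at h' ⊢
      linear_combination h'
    · rw [VafaWitten.finrank_sections_of_neg (by omega)] at h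
      have h' := congrArg (Nat.cast (R := ℚ)) h
      simp only [Nat.cast_add, c₀, c₁, c₂, c₃] at h'
      push_cast at h' ⊢
      linear_combination h'
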